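/- **Setting.** Let $(X,d)$ be a geometrically doubling metric space: there is $N_0\in\mathbb N^+$ such that every ball $B(x,r)$ is covered by at most $N_0$ balls of radius $r/2$. Let $\mu$ be a Borel measure on $X$ that is upper doubling: there are $\lambda:X\times(0,\infty)\to(0,\infty)$, non-decreasing in the second variable, and $C_\lambda>0$ with $\mu(B(x,r))\le\lambda(x,r)\le C_\lambda\lambda(x,r/2)$ for all $x\in X$, $r>0$. A ball $B=B(c_B,r_B)$ carries its centre and radius, and $\rho B:=B(c_B,\rho r_B)$. For balls $B\subset S$ put $$\delta(B,S)=\int_{(2S)\setminus B}\frac{d\mu(x)}{\lambda(c_B,d(x,c_B))}.$$ Functions are complex-valued and $\mu$-measurable, and are identified when they agree $\mu$-a.e. Fix $\eta,\rho\in(1,\infty)$ and $q\in(1,\infty]$. *$\mathrm{RBMO}(\mu)$* is the set of $f$, integrable on balls, for which there are $C\ge0$ and numbers $f_B\in\mathbb C$ ($B$ a ball) with $\int_B|f-f_B|\,d\mu\le C\mu(\eta B)$ for all balls $B$ and $|f_B-f_S|\le C[1+\delta(B,S)]$ for all balls $B\subset S$; $\|f\|_{\mathrm{RBMO}(\mu)}$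 is the infimum of such $C$ (it vanishes on constants). An *atomic block* is a function $b\in L^1(\mu)$ with $\int_X b\,d\mu=0$ that vanishes outside a ball $B$ and is of the form $b=\lambda_1a_1+\lambda_2a_2$ with $\lambda_j\in\mathbb C$ and functions $a_j$ that vanish outside balls $B_j\subset B$ and satisfy $\|a_j\|_{L^q(\mu)}\le\mu(\rho B_j)^{1/q-1}[1+\delta(B_j,B)]^{-1}$; put $|b|=|\lambda_1|+|\lambda_2|$. The *Hardy space* $H^1(\mu)$ is the set of $f\in L^1(\mu)$ of the form $f=\sum_{j=1}^\infty b_j$ with atomic blocks $b_j$ and $\sum_j|b_j|<\infty$; $\|f\|_{H^1(\mu)}$ is the infimum of $\sum_j|b_j|$ over all such representations. An operator $S$ on a linear space of functions, with measurable functions as values, is *sublinear* if $|S(f+g)|\le|Sf|+|Sg|$ and $|S(cf)|=|c||Sf|$ a.e. for all $f,g$ in the space and $c\in\mathbb C$. **Theorem.** Let $T$ be a sublinear operator on $L^\infty(\mu)+H^1(\mu)$ for which there is a constant $C$ with $$\|Tf\|_{\mathrm{RBMO}(\mu)}\le C\|f\|_{L^\infty(\mu)}\ \ (f\in L^\infty(\mu)),\qquad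 \sup_{t>0}t\,\mu(\{|Tf|>t\})\le C\|f\|_{H^1(\mu)}\ \ (f\in H^1(\mu)),$$ where the first estimate includes $Tf\in\mathrm{RBMO}(\mu)$. Then for every $p\in(1,\infty)$ $T$ extends to a bounded sublinear operator on $L^p(\mu)$: there are a sublinear $S:L^p(\mu)\to L^p(\mu)$ and a constant $C_p$ with $\|Sf\|_{L^p(\mu)}\le C_p\|f\|_{L^p(\mu)}$ for all $f\in L^p(\mu)$, such that $Sf=Tf$ for every $f\in L^p(\mu)\cap H^1(\mu)$ and, if $\mu(X)<\infty$, for every $f\in L^p(\mu)\cap(L^\infty(\mu)+H^1(\mu))$. -/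

import Mathlib

open MeasureTheory
open scoped ENNReal NNReal

noncomputable section

namespace NonHom

/-- A ball of a metric space, with its designated centre and (positive) radius. Distinct
centre/radius pairs may describe the same set; the coefficients `delta` depend on the pair. -/
structure Ball (X : Type*) where
  center : X
  radius : ℝ
  radius_pos : 0 < radius

variable {X : Type*} [MetricSpace X]

/-- The set of points of the dilated ball `ρ B`. -/
def Ball.dilate (B : Ball X) (ρ : ℝ) : Set X := Metric.ball B.center (ρ * B.radius)

/-- The set of points of the ball `B`. -/
def Ball.carrier (B : Ball X) : Set X := Metric.ball B.center B.radius

/-- Geometrically doubling metric spaces. -/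
def GeometricallyDoubling (X : Type*) [MetricSpace X] : Prop :=
  ∃ N : ℕ, 1 ≤ N ∧ ∀ (x : X) (r : ℝ), 0 < r →
    ∃ s : Finset X, s.card ≤ N ∧ Metric.ball x r ⊆ ⋃ y ∈ s, Metric.ball y (r / 2)

variable [MeasurableSpace X]

/-- `lam : X × (0,∞) → (0,∞)` is a dominating function for `μ`: the upper doubling condition.
Values of `lam x r` at `r ≤ 0` play no role. -/
structure IsDominating (μ : Measure X) (lam : X → ℝ → ℝ) : Prop where
  pos : ∀ (x : X) (r : ℝ), 0 < r → 0 < lam x r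
  mono : ∀ (x : X) (r s : ℝ), 0 < r → r ≤ s → lam x r ≤ lam x s
  measure_le : ∀ (x : X) (r : ℝ), 0 < r → μ (Metric.ball x r) ≤ ENNReal.ofReal (lam x r)
  doubling : ∃ C : ℝ, 0 < C ∧ ∀ (x : X) (r : ℝ), 0 < r → lam x r ≤ C * lam x (r / 2)

/-- The coefficient `δ(B, S) = ∫_{2S ∖ B} dμ(x) / lam(c_B, d(x, c_B))`. -/
def delta (μ : Measure X) (lam : X → ℝ → ℝ) (B S : Ball X) : ℝ≥0∞ :=
  ∫⁻ x in S.dilate 2 \ B.carrier, (ENNReal.ofReal (lam B.center (dist x B.center)))⁻¹ ∂μ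

/-- `C` is an admissible constant in the definition of `RBMO(μ)` (with dilation `η`) for `f`:
there are numbers `f_B` with `∫_B |f - f_B| dμ ≤ C μ(η B)` for all balls `B` and
`|f_B - f_S| ≤ C (1 + δ(B, S))` for all balls `B ⊆ S`. -/
def RBMOBound (μ : Measure X) (lam : X → ℝ → ℝ) (η : ℝ) (f : X → ℂ) (C : ℝ) : Prop :=
  0 ≤ C ∧ ∃ m : Ball X → ℂ,
    (∀ B : Ball X,
      ∫⁻ y in B.carrier, ‖f y - m B‖ₑ ∂μ ≤ ENNReal.ofReal C * μ (B.dilate η)) ∧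
    (∀ B S : Ball X, B.carrier ⊆ S.carrier →
      ‖m B - m S‖ₑ ≤ ENNReal.ofReal C * (1 + delta μ lam B S))

/-- Membership in `RBMO(μ)`; local integrability is integrability on all balls. -/
def MemRBMO (μ : Measure X) (lam : X → ℝ → ℝ) (η : ℝ) (f : X → ℂ) : Prop :=
  (∀ B : Ball X, IntegrableOn f B.carrier μ) ∧ ∃ C : ℝ, RBMOBound μ lam η f C

/-- The `RBMO(μ)` norm (a seminorm on functions, vanishing on constants). -/
def rbmoNorm (μ : Measure X) (lam : X → ℝ → ℝ) (η : ℝ) (f : X → ℂ) : ℝ :=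
  sInf {C : ℝ | RBMOBound μ lam η f C}

/-- `a` is supported in the ball `A` and
`‖a‖_{L^q} ≤ μ(ρ A)^{1/q - 1} (1 + δ(A, B))⁻¹`.
For `q = ∞` one has `q.toReal⁻¹ = 0`, so that the exponent is `-1`, as it should be. -/
def IsAtom (μ : Measure X) (lam : X → ℝ → ℝ) (ρ : ℝ) (q : ℝ≥0∞) (A B : Ball X)
    (a : X → ℂ) : Prop :=
  AEStronglyMeasurable a μ ∧ Function.support a ⊆ A.carrier ∧
    eLpNorm a q μ ≤ μ (A.dilate ρ) ^ (q.toReal⁻¹ - 1) * (1 + delta μ lam A B)⁻¹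

/-- `b` is a `(q, 1)`-atomic block that has a representation `b = l₁ a₁ + l₂ a₂` with
`|l₁| + |l₂| = w`. -/
def IsAtomicBlock (μ : Measure X) (lam : X → ℝ → ℝ) (ρ : ℝ) (q : ℝ≥0∞)
    (b : X → ℂ) (w : ℝ) : Prop :=
  Integrable b μ ∧ ∫ x, b x ∂μ = 0 ∧
    ∃ B : Ball X, Function.support b ⊆ B.carrier ∧
      ∃ (B₁ B₂ : Ball X) (a₁ a₂ : X → ℂ) (l₁ l₂ : ℂ),
        B₁.carrier ⊆ B.carrier ∧ B₂.carrier ⊆ B.carrier ∧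
        IsAtom μ lam ρ q B₁ B a₁ ∧ IsAtom μ lam ρ q B₂ B a₂ ∧
        (∀ x, b x = l₁ * a₁ x + l₂ * a₂ x) ∧ w = ‖l₁‖ + ‖l₂‖

/-- `f = ∑ⱼ bⱼ` for atomic blocks `bⱼ` of total size `∑ⱼ |bⱼ| = C < ∞`. Since
`‖bⱼ‖_{L¹} ≤ |bⱼ|`, the series converges absolutely in `L¹` and almost everywhere, with the
same sum. -/
def H1Bound (μ : Measure X) (lam : X → ℝ → ℝ) (ρ : ℝ) (q : ℝ≥0∞)
    (f : X → ℂ) (C : ℝ) : Prop :=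
  ∃ (b : ℕ → X → ℂ) (w : ℕ → ℝ), (∀ j, IsAtomicBlock μ lam ρ q (b j) (w j)) ∧
    HasSum w C ∧ ∀ᵐ x ∂μ, HasSum (fun j => b j x) (f x)

/-- Membership in the atomic Hardy space `H¹(μ) = H^{1,q}_{atb}(μ)`. -/
def MemH1 (μ : Measure X) (lam : X → ℝ → ℝ) (ρ : ℝ) (q : ℝ≥0∞) (f : X → ℂ) : Prop :=
  Integrable f μ ∧ ∃ C : ℝ, H1Bound μ lam ρ q f C

/-- The norm of `H¹(μ)`. -/
def h1Norm (μ : Measure X) (lam : X → ℝ → ℝ) (ρ : ℝ) (q : ℝ≥0∞) (f : X → ℂ) : ℝ :=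
  sInf {C : ℝ | H1Bound μ lam ρ q f C}

/-- The quasi-norm of `L^{1,∞}(μ)`. -/
def weakL1Norm (μ : Measure X) (f : X → ℂ) : ℝ≥0∞ :=
  ⨆ t : ℝ≥0, (t : ℝ≥0∞) * μ {x | (t : ℝ) < ‖f x‖}

/-- The space `L^∞(μ) + H¹(μ)` (of classes of functions modulo almost everywhere equality). -/
def linftyAddH1 (μ : Measure X) (lam : X → ℝ → ℝ) (ρ : ℝ) (q : ℝ≥0∞) : Set (X →ₘ[μ] ℂ) :=
  {f | ∃ g h : X →ₘ[μ] ℂ, g ∈ Lp ℂ ∞ μ ∧ MemH1 μ lam ρ q h ∧ f = g + h}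

/-- `T` is a sublinear operator on the linear space `D` of (classes of) functions. Its values
outside `D` are unrestricted. -/
def IsSublinearOn {μ : Measure X} (D : Set (X →ₘ[μ] ℂ))
    (T : (X →ₘ[μ] ℂ) → (X →ₘ[μ] ℂ)) : Prop :=
  (∀ f ∈ D, ∀ g ∈ D, ∀ᵐ x ∂μ, ‖T (f + g) x‖ ≤ ‖T f x‖ + ‖T g x‖) ∧
  (∀ (c : ℂ), ∀ f ∈ D, ∀ᵐ x ∂μ, ‖T (c • f) x‖ = ‖c‖ * ‖T f x‖)

/-- `T` is bounded from `L^∞(μ)` to `RBMO(μ)`. -/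
def BoundedLinftyRBMO (μ : Measure X) (lam : X → ℝ → ℝ) (η : ℝ)
    (T : (X →ₘ[μ] ℂ) → (X →ₘ[μ] ℂ)) : Prop :=
  ∃ C : ℝ, ∀ f ∈ Lp ℂ ∞ μ, MemRBMO μ lam η (T f) ∧
    rbmoNorm μ lam η (T f) ≤ C * (eLpNorm f ∞ μ).toReal

/-- `T` is bounded from `H¹(μ)` to `L^{1,∞}(μ)`. -/
def BoundedH1WeakL1 (μ : Measure X) (lam : X → ℝ → ℝ) (ρ : ℝ) (q : ℝ≥0∞)
    (T : (X →ₘ[μ] ℂ) → (X →ₘ[μ] ℂ)) : Prop :=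
  ∃ C : ℝ, ∀ f : X →ₘ[μ] ℂ, MemH1 μ lam ρ q f →
    weakL1Norm μ (T f) ≤ ENNReal.ofReal (C * h1Norm μ lam ρ q f)

/-- `T` is bounded from `L^p(μ)` to `L^p(μ)`. -/
def BoundedLp (μ : Measure X) (p : ℝ≥0∞) (T : (X →ₘ[μ] ℂ) → (X →ₘ[μ] ℂ)) : Prop :=
  ∃ C : ℝ≥0, ∀ f ∈ Lp ℂ p μ, T f ∈ Lp ℂ p μ ∧ eLpNorm (T f) p μ ≤ C * eLpNorm f p μ

end NonHom

end

/-!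
`T` is bounded on `L^p` by a real interpolation between `L^∞ → RBMO` and `H¹ → L^{1,∞}`. Two
ingredients carry the proof. The first splits a function in `L^p` into a bounded part and a Hardy
space part; the second is a good-`λ` inequality that controls `|T f|` by the two parts.

*Splitting.* For `1 < s < p` and every height `ℓ`, a function `f` is a sum `g + b` with
`|g| ≤ C ℓ` (if `μ(X) < ∞`, for `ℓ` not too small) and with `b ∈ H¹` of size at most
`C ℓ ^ (1 - s) ∫_{|f| > ℓ} |f| ^ s` (`Admissible.exists_decomposition`). All atoms that occur are
bounded functions, so that the exponent `q` plays no role. For a function bounded by `M`, a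
Calderón–Zygmund decomposition at height `ℓ` gives a part `b` made of finitely many blocks, of
size `C (M / ℓ) ‖f‖₁` (`Admissible.exists_decomposition_of_lt`); the compensating functions of the
selected balls are spread over concentric doubling balls (`exists_spread`). The unbounded case
follows by cutting `f` at the values `D ^ k ℓ` and by lowering the supremum norm of each piece
gradually, by factors `D`: the size of the Hardy space part of the `k`-th piece grows by a factor
`16 ^ k`, whereas the `L¹`-norm of that piece contains a factor `D ^ (-(s - 1) k)`.

*Good-`λ` inequality* (`Admissible.measure_lt_le`). With `F = |T f|`, `G = T g`, `H = |T b|`, one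
has `||G| - F| ≤ H` by sublinearity, and the oscillation of `G` is controlled by its `RBMO`
constant, which is small against `t` if `ℓ = a t` with small `a`. Near almost every point with
`F > 6 t` there is a ball `B` on which `F > t` on a fixed part of `B`, and which is maximal with
this property; a doubling ball `S` around `B`, at bounded `δ`-distance, then has `F ≤ t` on most
of `S`. So either `H > t` on a large part of `S`, or `G` is bounded by `2 t` on half of `S`, and
its representing numbers for `S` and for `5 B` are at most `4 t`. Then `G` oscillates by at least
`t` at points of `5 B` where `F > 6 t` and `H ≤ t`. Hence `μ(F > 6 t) ≤ κ μ(F > t) + C μ(H > t)`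
with small `κ`, no maximal functions being needed.

Integration in `t` gives `‖T f‖_p ≤ C ‖f‖_p`, as soon as `T f` is known to be in weak `L¹`, which
makes the term with `κ` finite (`lintegral_rpow_le_of_measure_lt_le`). If `μ(X) = ∞`, this a
priori information comes from `f ∈ H¹`, and `T` is extended from the dense subspace `L^p ∩ H¹` of
`L^p` by continuity of `f ↦ |T f|` (`exists_sublinear_extension`). If `μ(X) < ∞`, all of `L^p` is
in the domain of `T`, and is mapped to weak `L¹`: a bounded function is the sum of a multiple of
the indicator function of a fixed ball and of an element of `H¹`
(`Admissible.exists_eq_indicator_add`), and `RBMO` functions are integrable.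
-/

namespace NonHom

open Set Metric Filter

variable {X : Type*} [MetricSpace X]

/-! ### Balls in geometrically doubling and upper doubling spaces -/

/-- A geometrically doubling space covers a ball by at most `N ^ k` balls of radius `r / 2 ^ k`. -/
lemma GeometricallyDoubling.exists_cover (hX : GeometricallyDoubling X) :
    ∃ N : ℕ, 1 ≤ N ∧ ∀ (k : ℕ) (x : X) (r : ℝ), 0 < r →
      ∃ s : Finset X, s.card ≤ N ^ k ∧ ball x r ⊆ ⋃ y ∈ s, ball y (r / 2 ^ k) := by
  classical
  obtain ⟨N, hN, h⟩ := hX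
  refine ⟨N, hN, fun k => ?_⟩
  induction k with
  | zero =>
    intro x r _
    exact ⟨{x}, by simp, by simp⟩
  | succ k ih =>
    intro x r hr
    obtain ⟨s, hs, hsub⟩ := ih x r hr
    choose t ht htsub using fun y : X => h y (r / 2 ^ k) (by positivity)
    refine ⟨s.biUnion t, ?_, ?_⟩
    · calc (s.biUnion t).card ≤ s.card * N := Finset.card_biUnion_le_card_mul _ _ _ fun y _ => ht y
        _ ≤ N ^ k * N := Nat.mul_le_mul_right _ hs
        _ = N ^ (k + 1) := (pow_succ _ _).symm
    · intro z hz
      obtain ⟨y, hy, hzy⟩ := mem_iUnion₂.1 (hsub hz)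
      obtain ⟨w, hw, hzw⟩ := mem_iUnion₂.1 (htsub y hzy)
      refine mem_iUnion₂.2 ⟨w, Finset.mem_biUnion.2 ⟨y, hy, hw⟩, ?_⟩
      rwa [pow_succ, ← div_div]

lemma GeometricallyDoubling.secondCountableTopology (hX : GeometricallyDoubling X) :
    SecondCountableTopology X := by
  obtain ⟨N, -, h⟩ := hX.exists_cover
  refine Metric.secondCountable_of_almost_dense_set fun ε hε => ?_
  rcases isEmpty_or_nonempty X with hemp | ⟨⟨x₀⟩⟩
  · exact ⟨∅, countable_empty, fun x => hemp.elim x⟩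
  have key : ∀ n : ℕ, ∃ s : Finset X, ∀ x ∈ ball x₀ (n + 1), ∃ y ∈ s, dist x y ≤ ε := by
    intro n
    obtain ⟨k, hk⟩ := pow_unbounded_of_one_lt ((n + 1 : ℝ) / ε) (one_lt_two (α := ℝ))
    obtain ⟨s, -, hs⟩ := h k x₀ (n + 1) (by positivity)
    refine ⟨s, fun x hx => ?_⟩
    obtain ⟨y, hy, hxy⟩ := mem_iUnion₂.1 (hs hx)
    refine ⟨y, hy, (mem_ball.1 hxy).le.trans ?_⟩
    rw [div_le_iff₀ (by positivity)]
    rw [div_lt_iff₀ hε] at hk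
    linarith
  choose s hs using key
  refine ⟨⋃ n, (s n : Set X), countable_iUnion fun n => (s n).countable_toSet, fun x => ?_⟩
  obtain ⟨n, hn⟩ := exists_nat_gt (dist x x₀)
  obtain ⟨y, hy, hxy⟩ := hs n x (mem_ball.2 (by linarith))
  exact ⟨y, mem_iUnion.2 ⟨n, hy⟩, hxy⟩

variable [MeasurableSpace X] {μ : Measure X} {lam : X → ℝ → ℝ}

lemma IsDominating.measure_ball_lt_top (hlam : IsDominating μ lam) (x : X) (r : ℝ) :
    μ (ball x r) < ∞ := by
  rcases le_or_gt r 0 with hr | hr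
  · simp [ball_eq_empty.2 hr]
  · exact (hlam.measure_le x r hr).trans_lt ENNReal.ofReal_lt_top

/-- Outside a ball, the integrand of `delta` is at most its value on the sphere. -/
lemma IsDominating.lintegral_diff_ball_le [OpensMeasurableSpace X] (hlam : IsDominating μ lam)
    (c : X) {r : ℝ} (hr : 0 < r) (U : Set X) (hU : MeasurableSet U) :
    ∫⁻ x in U \ ball c r, (ENNReal.ofReal (lam c (dist x c)))⁻¹ ∂μ
      ≤ μ U * (ENNReal.ofReal (lam c r))⁻¹ := by
  calc ∫⁻ x in U \ ball c r, (ENNReal.ofReal (lam c (dist x c)))⁻¹ ∂μ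
      ≤ ∫⁻ _ in U \ ball c r, (ENNReal.ofReal (lam c r))⁻¹ ∂μ := by
        refine setLIntegral_mono' (hU.diff measurableSet_ball) fun x hx => ?_
        have : r ≤ dist x c := not_lt.1 hx.2
        exact ENNReal.inv_le_inv.2 (ENNReal.ofReal_le_ofReal (hlam.mono c r _ hr this))
    _ = μ (U \ ball c r) * (ENNReal.ofReal (lam c r))⁻¹ := by
        rw [setLIntegral_const, mul_comm]
    _ ≤ _ := by gcongr; exact sdiff_subset

lemma ENNReal_eq_zero_of_two_pow_mul_le {a b : ℝ≥0∞} (hb : b ≠ ∞)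
    (h : ∀ n : ℕ, 2 ^ n * a ≤ b) : a = 0 := by
  by_contra ha
  have ha' : a ≠ ∞ := by
    rintro rfl
    have := h 0
    simp only [pow_zero, one_mul, top_le_iff] at this
    exact hb this
  obtain ⟨n, hn⟩ := pow_unbounded_of_one_lt (b.toReal / a.toReal) (one_lt_two (α := ℝ))
  rw [div_lt_iff₀ (ENNReal.toReal_pos ha ha')] at hn
  have := ENNReal.toReal_mono hb (h n)
  simp at this
  linarith

/-- Constants for which the metric measure space has the doubling properties used below:
`γ` is the dilation factor and `β` the constant in the doubling condition
`μ (γ B) ≤ β μ (B)`, `α` is a smaller dilation factor, and `β` also bounds the coefficients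
`δ` that occur. No ball needs to be doubling, but every ball is contained in a concentric doubling
ball at bounded `δ`-distance, and almost every point is the centre of small doubling balls. -/
structure Admissible (μ : Measure X) (lam : X → ℝ → ℝ) (α γ : ℝ) (β : ℝ≥0) : Prop where
  five_le : 5 ≤ α
  three_mul_le : 3 * α ≤ γ
  one_le : 1 ≤ β
  measure_ball_lt_top : ∀ x r, μ (ball x r) < ∞
  delta_self_le : ∀ B : Ball X, delta μ lam B B ≤ β
  exists_doubling_ge : ∀ A : Ball X, μ A.carrier ≠ 0 → ∃ R : Ball X, R.center = A.center ∧
    A.radius ≤ R.radius ∧ μ (R.dilate γ) ≤ β * μ R.carrier ∧ delta μ lam A R ≤ β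
  exists_doubling_lt : ∀ᵐ x ∂μ, ∀ ε : ℝ, 0 < ε → ∃ r, 0 < r ∧ r < ε ∧
    μ (ball x (γ * r)) ≤ β * μ (ball x r)

/-- If the concentric balls `γ ^ j A` fail to be doubling for all `j < k`, their measures grow
faster than the dominating function, so that `δ(A, γ ^ k A)` is a geometric sum. -/
lemma IsDominating.exists_doubling_ge [OpensMeasurableSpace X] (hlam : IsDominating μ lam)
    {γ : ℝ} (hγ : 2 ≤ γ) {Λ : ℝ≥0} (hΛ : 0 < Λ)
    (hlamγ : ∀ x r, 0 < r → ENNReal.ofReal (lam x (γ * r)) ≤ Λ * ENNReal.ofReal (lam x r))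
    {β : ℝ≥0} (hβ : 3 * Λ ≤ β) (A : Ball X) (hA : μ A.carrier ≠ 0) :
    ∃ R : Ball X, R.center = A.center ∧ A.radius ≤ R.radius ∧
      μ (R.dilate γ) ≤ β * μ R.carrier ∧ delta μ lam A R ≤ β := by
  classical
  obtain ⟨c, r, hr⟩ := A
  have hγ0 : 0 < γ := by linarith
  have hrad : ∀ k : ℕ, 0 < γ ^ k * r := fun k => by positivity
  have hstep : ∀ k : ℕ, γ ^ (k + 1) * r = γ * (γ ^ k * r) := fun k => by ring
  set U : ℕ → Set X := fun k => ball c (γ ^ k * r) with hU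
  set e : ℕ → ℝ≥0∞ := fun k => (ENNReal.ofReal (lam c (γ ^ k * r)))⁻¹ with he
  have hpos : ∀ k, ENNReal.ofReal (lam c (γ ^ k * r)) ≠ 0 := fun k => by
    simpa using hlam.pos c _ (hrad k)
  have hμU : ∀ k, μ (U k) ≤ ENNReal.ofReal (lam c (γ ^ k * r)) := fun k =>
    hlam.measure_le c _ (hrad k)
  have hμe : ∀ k, μ (U k) * e k ≤ 1 := fun k =>
    ENNReal.mul_inv_le_one _ |>.trans' (by simp only [he]; gcongr; exact hμU k)
  have hestep : ∀ k, e k ≤ Λ * e (k + 1) := by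
    intro k
    have h1 := hlamγ c (γ ^ k * r) (hrad k)
    rw [← hstep] at h1
    simp only [he]
    rw [← ENNReal.div_eq_inv_mul.trans (mul_comm _ _)] 
    rw [ENNReal.le_div_iff_mul_le (Or.inl (hpos _)) (Or.inl ENNReal.ofReal_ne_top)]
    calc _ ≤ (ENNReal.ofReal (lam c (γ ^ k * r)))⁻¹ * (Λ * ENNReal.ofReal (lam c (γ ^ k * r))) := by
          gcongr
      _ = Λ * ((ENNReal.ofReal (lam c (γ ^ k * r)))⁻¹ * ENNReal.ofReal (lam c (γ ^ k * r))) := by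
          ring
      _ = Λ := by rw [ENNReal.inv_mul_cancel (hpos k) ENNReal.ofReal_ne_top, mul_one]
  have hmono : ∀ k, r ≤ γ ^ k * r := fun k =>
    le_mul_of_one_le_left hr.le (one_le_pow₀ (by linarith))
  have hex : ∃ k, μ (U (k + 1)) ≤ β * μ (U k) := by
    by_contra! hno
    refine hA (ENNReal_eq_zero_of_two_pow_mul_le (b := ENNReal.ofReal (lam c r))
      ENNReal.ofReal_ne_top fun n => ?_)
    have h1 : ∀ n : ℕ, (Λ : ℝ≥0∞) ^ n * (2 ^ n * μ (U 0)) ≤ μ (U n) := by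
      intro n
      induction n with
      | zero => simp
      | succ n ih =>
        calc (Λ : ℝ≥0∞) ^ (n + 1) * (2 ^ (n + 1) * μ (U 0))
            = (2 * Λ) * (Λ ^ n * (2 ^ n * μ (U 0))) := by ring
          _ ≤ β * μ (U n) := by
            gcongr
            have : 2 * Λ ≤ β := le_trans (by gcongr; norm_num) hβ
            exact_mod_cast this
          _ ≤ _ := (hno n).le
    have h2 : ∀ n : ℕ, ENNReal.ofReal (lam c (γ ^ n * r)) ≤ Λ ^ n * ENNReal.ofReal (lam c r) := by
      intro n
      induction n with
      | zero => simp
      | succ n ih =>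
        rw [hstep]
        calc _ ≤ Λ * ENNReal.ofReal (lam c (γ ^ n * r)) := hlamγ _ _ (hrad n)
          _ ≤ Λ * (Λ ^ n * ENNReal.ofReal (lam c r)) := by gcongr
          _ = _ := by ring
    have h3 := (h1 n).trans ((hμU n).trans (h2 n))
    have hΛn : (Λ : ℝ≥0∞) ^ n ≠ 0 := pow_ne_zero _ (by exact_mod_cast hΛ.ne')
    have hΛn' : (Λ : ℝ≥0∞) ^ n ≠ ∞ := ENNReal.pow_ne_top ENNReal.coe_ne_top
    have h4 := (ENNReal.mul_le_mul_iff_right hΛn hΛn').1 h3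
    simpa [hU, Ball.carrier] using h4
  set k := Nat.find hex with hk
  have hkdbl : μ (U (k + 1)) ≤ β * μ (U k) := Nat.find_spec hex
  have hlt : ∀ j < k, β * μ (U j) ≤ μ (U (j + 1)) := fun j hj =>
    (not_le.1 (Nat.find_min hex hj)).le
  have hI : ∀ j ≤ k, ∫⁻ x in U j \ U 0, (ENNReal.ofReal (lam c (dist x c)))⁻¹ ∂μ
      ≤ 2 * Λ * μ (U j) * e j := by
    intro j
    induction j with
    | zero => simp
    | succ j ih =>
      intro hj
      have hsub : U (j + 1) \ U 0 ⊆ (U j \ U 0) ∪ (U (j + 1) \ U j) := by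
        intro x hx
        by_cases hxj : x ∈ U j
        · exact Or.inl ⟨hxj, hx.2⟩
        · exact Or.inr ⟨hx.1, hxj⟩
      calc _ ≤ ∫⁻ x in (U j \ U 0) ∪ (U (j + 1) \ U j), (ENNReal.ofReal (lam c (dist x c)))⁻¹ ∂μ :=
            lintegral_mono_set hsub
        _ ≤ ∫⁻ x in U j \ U 0, (ENNReal.ofReal (lam c (dist x c)))⁻¹ ∂μ +
            ∫⁻ x in U (j + 1) \ U j, (ENNReal.ofReal (lam c (dist x c)))⁻¹ ∂μ :=
            lintegral_union_le _ _ _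
        _ ≤ 2 * Λ * μ (U j) * e j + μ (U (j + 1)) * e j := by
            gcongr
            · exact ih (by omega)
            · exact hlam.lintegral_diff_ball_le c (hrad j) _ measurableSet_ball
        _ ≤ β * μ (U j) * e j + μ (U (j + 1)) * e j := by
            gcongr
            have : 2 * Λ ≤ β := le_trans (by gcongr; norm_num) hβ
            exact_mod_cast this
        _ ≤ μ (U (j + 1)) * e j + μ (U (j + 1)) * e j := by
            gcongr
            exact hlt j (by omega)
        _ ≤ μ (U (j + 1)) * (Λ * e (j + 1)) + μ (U (j + 1)) * (Λ * e (j + 1)) := by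
            gcongr <;> exact hestep j
        _ = _ := by ring
  refine ⟨⟨c, γ ^ k * r, hrad k⟩, rfl, hmono k, ?_, ?_⟩
  · have : (Ball.dilate ⟨c, γ ^ k * r, hrad k⟩ γ : Set X) = U (k + 1) := by
      simp only [Ball.dilate, hU, hstep]
    rw [this]; exact hkdbl
  · have hA0 : (Ball.carrier ⟨c, r, hr⟩ : Set X) = U 0 := by simp [Ball.carrier, hU]
    have hsub : ball c (2 * (γ ^ k * r)) \ U 0 ⊆
        (U k \ U 0) ∪ (ball c (2 * (γ ^ k * r)) \ U k) := by
      intro x hx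
      by_cases hxj : x ∈ U k
      · exact Or.inl ⟨hxj, hx.2⟩
      · exact Or.inr ⟨hx.1, hxj⟩
    simp only [delta, hA0, Ball.dilate]
    calc _ ≤ ∫⁻ x in (U k \ U 0) ∪ (ball c (2 * (γ ^ k * r)) \ U k),
            (ENNReal.ofReal (lam c (dist x c)))⁻¹ ∂μ := lintegral_mono_set hsub
      _ ≤ ∫⁻ x in U k \ U 0, (ENNReal.ofReal (lam c (dist x c)))⁻¹ ∂μ +
            ∫⁻ x in ball c (2 * (γ ^ k * r)) \ U k, (ENNReal.ofReal (lam c (dist x c)))⁻¹ ∂μ :=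
            lintegral_union_le _ _ _
      _ ≤ 2 * Λ * μ (U k) * e k + μ (ball c (2 * (γ ^ k * r))) * e k := by
            gcongr
            · exact hI k le_rfl
            · exact hlam.lintegral_diff_ball_le c (hrad k) _ measurableSet_ball
      _ ≤ 2 * Λ * μ (U k) * e k + μ (U (k + 1)) * (Λ * e (k + 1)) := by
            gcongr
            · have := hrad k
              simp only [hU, hstep]
              exact ball_subset_ball (by nlinarith)
            · exact hestep k
      _ = 2 * Λ * (μ (U k) * e k) + Λ * (μ (U (k + 1)) * e (k + 1)) := by ring
      _ ≤ 2 * Λ * 1 + Λ * 1 := by gcongr <;> exact hμe _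
      _ = ((3 * Λ : ℝ≥0) : ℝ≥0∞) := by push_cast; ring
      _ ≤ β := by exact_mod_cast hβ

/-- If no ball `B(x, γ⁻ʲ R)` is doubling, then `μ (B(x, γ⁻ʲ R))` decays like `β⁻ʲ`, which for
large `β` beats the number of balls of radius `γ⁻ʲ R` needed to cover a given ball. -/
lemma ae_exists_doubling_lt [SecondCountableTopology X] (hfin : ∀ x r, μ (ball x r) < ∞)
    {N : ℕ} (hN1 : 1 ≤ N) (hN : ∀ (k : ℕ) (x : X) (r : ℝ), 0 < r →
      ∃ s : Finset X, s.card ≤ N ^ k ∧ ball x r ⊆ ⋃ y ∈ s, ball y (r / 2 ^ k))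
    (m : ℕ) {β : ℝ≥0} (hβ : 2 * (N : ℝ≥0) ^ m ≤ β) :
    ∀ᵐ x ∂μ, ∀ ε : ℝ, 0 < ε → ∃ r, 0 < r ∧ r < ε ∧
      μ (ball x (2 ^ m * r)) ≤ β * μ (ball x r) := by
  have key : ∀ R : ℝ, 0 < R → ∀ᵐ x ∂μ, ∃ j : ℕ,
      μ (ball x (R / (2 ^ m) ^ j)) ≤ β * μ (ball x (R / (2 ^ m) ^ (j + 1))) := by
    intro R hR
    rw [ae_iff]
    simp only [not_exists, not_le]
    refine measure_null_of_locally_null _ fun y _ =>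
      ⟨_, inter_mem_nhdsWithin _ (ball_mem_nhds y hR), ?_⟩
    set Z := {x | ∀ j : ℕ, β * μ (ball x (R / (2 ^ m) ^ (j + 1))) < μ (ball x (R / (2 ^ m) ^ j))} ∩
      ball y R with hZ
    refine ENNReal_eq_zero_of_two_pow_mul_le (b := N * μ (ball y (2 * R)))
      (ENNReal.mul_ne_top (by simp) (hfin _ _).ne) fun j => ?_
    have hdec : ∀ x ∈ Z, ∀ j : ℕ, (β : ℝ≥0∞) ^ j * μ (ball x (R / (2 ^ m) ^ j))
        ≤ μ (ball y (2 * R)) := by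
      intro x hx j
      induction j with
      | zero =>
        simp only [pow_zero, one_mul, div_one]
        refine measure_mono (ball_subset_ball' ?_)
        have := mem_ball.1 hx.2
        linarith
      | succ j ih =>
        refine le_trans ?_ ih
        rw [pow_succ, mul_assoc]
        gcongr
        exact (hx.1 j).le
    obtain ⟨s, hs, hcov⟩ := hN (m * j + 1) y R hR
    have hZs : Z ⊆ ⋃ y' ∈ s, Z ∩ ball y' (R / 2 ^ (m * j + 1)) := by
      intro x hx
      obtain ⟨y', hy', hxy⟩ := mem_iUnion₂.1 (hcov hx.2)
      exact mem_iUnion₂.2 ⟨y', hy', hx, hxy⟩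
    have hpiece : ∀ y' : X, (β : ℝ≥0∞) ^ j * μ (Z ∩ ball y' (R / 2 ^ (m * j + 1)))
        ≤ μ (ball y (2 * R)) := by
      intro y'
      rcases (Z ∩ ball y' (R / 2 ^ (m * j + 1))).eq_empty_or_nonempty with h | ⟨z, hz⟩
      · simp [h]
      · refine le_trans ?_ (hdec z hz.1 j)
        gcongr
        refine inter_subset_right.trans (ball_subset_ball' ?_)
        have h1 := mem_ball'.1 hz.2
        have h2 : R / (2 ^ m) ^ j = R / 2 ^ (m * j + 1) + R / 2 ^ (m * j + 1) := by
          rw [← pow_mul, pow_succ]; field_simp; norm_num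
        rw [h2]
        linarith
    have hβj : (2 : ℝ≥0∞) ^ j * ((N : ℝ≥0∞) ^ m) ^ j ≤ β ^ j := by
      rw [← mul_pow]
      gcongr
      exact_mod_cast hβ
    have hNne : ((N : ℝ≥0∞) ^ m) ^ j ≠ 0 :=
      pow_ne_zero _ (pow_ne_zero _ (by exact_mod_cast (by omega : N ≠ 0)))
    have hNtop : ((N : ℝ≥0∞) ^ m) ^ j ≠ ∞ :=
      ENNReal.pow_ne_top (ENNReal.pow_ne_top (by simp))
    refine (ENNReal.mul_le_mul_iff_right hNne hNtop).1 ?_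
    calc ((N : ℝ≥0∞) ^ m) ^ j * (2 ^ j * μ Z) = 2 ^ j * (N ^ m) ^ j * μ Z := by ring
      _ ≤ β ^ j * μ Z := by gcongr
      _ ≤ β ^ j * ∑ y' ∈ s, μ (Z ∩ ball y' (R / 2 ^ (m * j + 1))) := by
          gcongr
          exact (measure_mono hZs).trans (measure_biUnion_finset_le _ _)
      _ = ∑ y' ∈ s, β ^ j * μ (Z ∩ ball y' (R / 2 ^ (m * j + 1))) := Finset.mul_sum _ _ _
      _ ≤ ∑ y' ∈ s, μ (ball y (2 * R)) := Finset.sum_le_sum fun y' _ => hpiece y'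
      _ = s.card * μ (ball y (2 * R)) := by rw [Finset.sum_const, nsmul_eq_mul]
      _ ≤ (N ^ (m * j + 1) : ℕ) * μ (ball y (2 * R)) := by gcongr
      _ = _ := by push_cast; ring
  have hall : ∀ᵐ x ∂μ, ∀ n : ℕ, ∃ j : ℕ, μ (ball x (1 / ((n : ℝ) + 1) / (2 ^ m) ^ j))
      ≤ β * μ (ball x (1 / ((n : ℝ) + 1) / (2 ^ m) ^ (j + 1))) :=
    ae_all_iff.2 fun n => key _ (by positivity)
  filter_upwards [hall] with x hx ε hε
  obtain ⟨n, hn⟩ := exists_nat_one_div_lt hε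
  obtain ⟨j, hj⟩ := hx n
  refine ⟨1 / ((n : ℝ) + 1) / (2 ^ m) ^ (j + 1), by positivity, ?_, ?_⟩
  · refine lt_of_le_of_lt (div_le_self (by positivity) ?_) hn
    exact one_le_pow₀ (one_le_pow₀ (by norm_num))
  · convert hj using 3
    rw [pow_succ]
    field_simp

/-- Admissible constants exist, with an arbitrarily large factor `α`. -/
lemma exists_admissible [OpensMeasurableSpace X] (hX : GeometricallyDoubling X)
    (hlam : IsDominating μ lam) (α : ℝ) (hα : 5 ≤ α) :
    ∃ (γ : ℝ) (β : ℝ≥0), Admissible μ lam α γ β := by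
  have := hX.secondCountableTopology
  obtain ⟨N, hN1, hN⟩ := hX.exists_cover
  obtain ⟨C, hC, hCl⟩ := hlam.doubling
  obtain ⟨m, hm⟩ := pow_unbounded_of_one_lt (3 * α) (one_lt_two (α := ℝ))
  set Λ : ℝ≥0 := Real.toNNReal C ^ m with hΛ
  have hΛpos : 0 < Λ := pow_pos (Real.toNNReal_pos.2 hC) _
  have hlamγ : ∀ x r, 0 < r →
      ENNReal.ofReal (lam x (2 ^ m * r)) ≤ Λ * ENNReal.ofReal (lam x r) := by
    intro x r hr
    have hpow : ∀ k : ℕ, lam x (2 ^ k * r) ≤ C ^ k * lam x r := by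
      intro k
      induction k with
      | zero => simp
      | succ k ih =>
        calc lam x (2 ^ (k + 1) * r) ≤ C * lam x (2 ^ (k + 1) * r / 2) :=
              hCl x _ (by positivity)
          _ = C * lam x (2 ^ k * r) := by congr 2; ring
          _ ≤ C * (C ^ k * lam x r) := by gcongr
          _ = _ := by ring
    calc _ ≤ ENNReal.ofReal (C ^ m * lam x r) := ENNReal.ofReal_le_ofReal (hpow m)
      _ = _ := by
        rw [ENNReal.ofReal_mul (by positivity), ENNReal.ofReal_pow hC.le, hΛ]
        push_cast
        rfl
  have h2m : (2 : ℝ) ≤ 2 ^ m := by linarith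
  have hsmall : 3 * Λ ≤ 3 * Λ + 2 * (N : ℝ≥0) ^ m := le_self_add
  have hlarge : 2 * (N : ℝ≥0) ^ m ≤ 3 * Λ + 2 * (N : ℝ≥0) ^ m := le_add_self
  refine ⟨2 ^ m, 3 * Λ + 2 * (N : ℝ≥0) ^ m, hα, hm.le, ?_, hlam.measure_ball_lt_top, ?_, ?_, ?_⟩
  · refine le_trans ?_ hlarge
    have : (1 : ℝ≥0) ≤ (N : ℝ≥0) ^ m := one_le_pow₀ (by exact_mod_cast hN1)
    calc (1 : ℝ≥0) ≤ 2 * 1 := by norm_num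
      _ ≤ _ := by gcongr
  · intro B
    have h1 : μ (B.dilate 2) ≤ Λ * ENNReal.ofReal (lam B.center B.radius) := by
      refine le_trans ?_ (hlamγ _ _ B.radius_pos)
      refine le_trans (measure_mono (ball_subset_ball ?_))
        (hlam.measure_le _ _ (by have := B.radius_pos; positivity))
      have := B.radius_pos
      gcongr
    have hpos : ENNReal.ofReal (lam B.center B.radius) ≠ 0 := by
      simpa using hlam.pos _ _ B.radius_pos
    calc delta μ lam B B ≤ μ (B.dilate 2) * (ENNReal.ofReal (lam B.center B.radius))⁻¹ :=
          hlam.lintegral_diff_ball_le _ B.radius_pos _ measurableSet_ball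
      _ ≤ Λ * ENNReal.ofReal (lam B.center B.radius) *
          (ENNReal.ofReal (lam B.center B.radius))⁻¹ := by gcongr
      _ = Λ := by
          rw [mul_assoc, ENNReal.mul_inv_cancel hpos ENNReal.ofReal_ne_top, mul_one]
      _ ≤ _ := by
          have : Λ ≤ 3 * Λ + 2 * (N : ℝ≥0) ^ m :=
            le_trans (le_mul_of_one_le_left (by positivity) (by norm_num)) hsmall
          exact_mod_cast this
  · exact fun A hA => hlam.exists_doubling_ge h2m hΛpos hlamγ hsmall A hA
  · exact ae_exists_doubling_lt hlam.measure_ball_lt_top hN1 hN m hlarge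

end NonHom

namespace NonHom

open Set Metric Filter

variable {X : Type*} [MetricSpace X]

/-! ### Density points and selection of balls -/

/-- Vitali's covering lemma for balls with bounded radii. -/
lemma exists_disjoint_balls (D : Set X) (r : X → ℝ) (hr : ∀ x ∈ D, 0 < r x) (R : ℝ)
    (hR : ∀ x ∈ D, r x ≤ R) :
    ∃ u ⊆ D, u.PairwiseDisjoint (fun x => ball x (r x)) ∧
      ∀ x ∈ D, ∃ y ∈ u, ball x (r x) ⊆ ball y (5 * r y) := by
  obtain ⟨u, huD, hdisj, hcov⟩ := Vitali.exists_disjoint_subfamily_covering_enlargement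
    (fun x => ball x (r x)) D r 2 one_lt_two (fun x hx => (hr x hx).le) R hR
    (fun x hx => nonempty_ball.2 (hr x hx))
  refine ⟨u, huD, hdisj, fun x hx => ?_⟩
  obtain ⟨y, hy, ⟨z, hzx, hzy⟩, hle⟩ := hcov x hx
  refine ⟨y, hy, ball_subset_ball' ?_⟩
  have h1 := mem_ball'.1 hzx
  have h2 := mem_ball.1 hzy
  have h3 := dist_triangle x z y
  linarith

variable [MeasurableSpace X] {μ : Measure X} {lam : X → ℝ → ℝ} {α γ : ℝ} {β : ℝ≥0}

/-- `x` is `t`-heavy at radius `r` for the density `φ`: the mass of `B(x, r)` exceeds `t` times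
the measure of the dilated ball `B(x, α r)`. -/
def Heavy (μ : Measure X) (α : ℝ) (φ : X → ℝ≥0∞) (t : ℝ≥0∞) (x : X) (r : ℝ) : Prop :=
  t * μ (ball x (α * r)) < ∫⁻ y in ball x r, φ y ∂μ

lemma Admissible.isLocallyFiniteMeasure (h : Admissible μ lam α γ β) :
    IsLocallyFiniteMeasure μ :=
  ⟨fun x => ⟨ball x 1, ball_mem_nhds x one_pos, h.measure_ball_lt_top x 1⟩⟩

lemma Admissible.alpha_pos (h : Admissible μ lam α γ β) : 0 < α := by
  have := h.five_le; linarith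

lemma Admissible.alpha_le_gamma (h : Admissible μ lam α γ β) : α ≤ γ := by
  have := h.five_le; have := h.three_mul_le; linarith

/-- Almost every point of a set of finite measure is heavy at some radius for its indicator
function: otherwise, small doubling balls around the exceptional points would have half of their
mass outside `E`, but inside an open set that is only slightly larger than `E`. -/
lemma Admissible.ae_heavy [BorelSpace X] [SecondCountableTopology X]
    (h : Admissible μ lam α γ β) {E : Set X} (hE : MeasurableSet E) (hEfin : μ E ≠ ∞)
    {t : ℝ≥0∞} (ht : t * β ≤ 2⁻¹) :
    ∀ᵐ x ∂μ, x ∈ E → ∃ r, 0 < r ∧ Heavy μ α (E.indicator 1) t x r := by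
  have := h.isLocallyFiniteMeasure
  have hα := h.five_le
  set P : Set X := {x | ∀ ε : ℝ, 0 < ε → ∃ r, 0 < r ∧ r < ε ∧
    μ (ball x (γ * r)) ≤ β * μ (ball x r)} with hP
  set Z : Set X := {x | x ∈ E ∧ (∀ r, 0 < r → ¬ Heavy μ α (E.indicator 1) t x r) ∧ x ∈ P} with hZ
  suffices hZ0 : μ Z = 0 by
    filter_upwards [h.exists_doubling_lt, measure_eq_zero_iff_ae_notMem.1 hZ0] with x hxP hxZ hxE
    by_contra! hcon
    exact hxZ ⟨hxE, hcon, hxP⟩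
  have key : ∀ ε : ℝ≥0, 0 < ε → μ Z ≤ 2 * β * ε := by
    intro ε hε
    obtain ⟨U, hEU, hUo, hUlt⟩ := E.exists_isOpen_lt_add hEfin
      (ENNReal.coe_ne_zero.2 hε.ne')
    have hUE : μ (U \ E) ≤ ε := by
      rw [measure_sdiff hEU hE.nullMeasurableSet hEfin]
      exact tsub_le_iff_left.2 hUlt.le
    have hch : ∀ x, ∃ r : ℝ, x ∈ Z → 0 < r ∧ r ≤ 1 ∧ ball x r ⊆ U ∧
        μ (ball x (γ * r)) ≤ β * μ (ball x r) := by
      intro x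
      by_cases hx : x ∈ Z
      · obtain ⟨δ, hδ, hδU⟩ := Metric.isOpen_iff.1 hUo x (hEU hx.1)
        obtain ⟨r, hr, hrlt, hrd⟩ := hx.2.2 (min δ 1) (lt_min hδ one_pos)
        exact ⟨r, fun _ => ⟨hr, (hrlt.trans_le (min_le_right _ _)).le,
          (ball_subset_ball (hrlt.trans_le (min_le_left _ _)).le).trans hδU, hrd⟩⟩
      · exact ⟨0, fun h => absurd h hx⟩
    choose r hr using hch
    obtain ⟨u, huZ, hdisj, hcov⟩ := exists_disjoint_balls Z r (fun x hx => (hr x hx).1) 1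
      (fun x hx => (hr x hx).2.1)
    have hucount : u.Countable := hdisj.countable_of_isOpen (fun x _ => isOpen_ball)
      (fun x hx => nonempty_ball.2 (hr x (huZ hx)).1)
    have hhalf : ∀ x ∈ Z, μ (ball x (r x)) ≤ 2 * μ (ball x (r x) \ E) := by
      intro x hx
      obtain ⟨hrpos, -, -, hdbl⟩ := hr x hx
      have h1 : μ (E ∩ ball x (r x)) ≤ 2⁻¹ * μ (ball x (r x)) := by
        have h2 := not_lt.1 (hx.2.1 (r x) hrpos)
        rw [lintegral_indicator_one hE, Measure.restrict_apply hE] at h2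
        calc _ ≤ t * μ (ball x (α * r x)) := h2
          _ ≤ t * μ (ball x (γ * r x)) := by
              gcongr; exact h.alpha_le_gamma
          _ ≤ t * (β * μ (ball x (r x))) := by gcongr
          _ = t * β * μ (ball x (r x)) := by ring
          _ ≤ _ := by gcongr
      have h3 : μ (ball x (r x)) = μ (E ∩ ball x (r x)) + μ (ball x (r x) \ E) := by
        rw [inter_comm]; exact (measure_inter_add_sdiff _ hE).symm
      have hfin := (h.measure_ball_lt_top x (r x)).ne
      have h4 : 2⁻¹ * μ (ball x (r x)) + 2⁻¹ * μ (ball x (r x))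
          ≤ 2⁻¹ * μ (ball x (r x)) + μ (ball x (r x) \ E) := by
        rw [← add_mul, ENNReal.inv_two_add_inv_two, one_mul]
        conv_lhs => rw [h3]
        gcongr
      have h5 := (ENNReal.add_le_add_iff_left
        (ENNReal.mul_ne_top (by simp) hfin)).1 h4
      calc μ (ball x (r x)) = 2 * (2⁻¹ * μ (ball x (r x))) := by
            rw [← mul_assoc, ENNReal.mul_inv_cancel (by simp) (by simp), one_mul]
        _ ≤ _ := by gcongr
    calc μ Z ≤ μ (⋃ x ∈ u, ball x (5 * r x)) := by
          refine measure_mono fun x hx => ?_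
          obtain ⟨y, hy, hsub⟩ := hcov x hx
          exact mem_iUnion₂.2 ⟨y, hy, hsub (mem_ball_self (hr x hx).1)⟩
      _ ≤ ∑' x : u, μ (ball (x : X) (5 * r x)) := measure_biUnion_le _ hucount _
      _ ≤ ∑' x : u, 2 * β * μ (ball (x : X) (r x) \ E) := by
          refine ENNReal.tsum_le_tsum fun x => ?_
          obtain ⟨hrpos, -, -, hdbl⟩ := hr x (huZ x.2)
          calc _ ≤ μ (ball (x : X) (γ * r x)) := by
                gcongr; linarith [h.alpha_le_gamma]
            _ ≤ β * μ (ball (x : X) (r x)) := hdbl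
            _ ≤ β * (2 * μ (ball (x : X) (r x) \ E)) := by
                gcongr; exact hhalf x (huZ x.2)
            _ = _ := by ring
      _ = 2 * β * ∑' x : u, μ (ball (x : X) (r x) \ E) := ENNReal.tsum_mul_left
      _ = 2 * β * μ (⋃ x ∈ u, ball x (r x) \ E) := by
          rw [measure_biUnion hucount]
          · exact fun x hx y hy hxy => (hdisj hx hy hxy).mono sdiff_subset sdiff_subset
          · exact fun x _ => measurableSet_ball.diff hE
      _ ≤ 2 * β * μ (U \ E) := by
          gcongr
          exact iUnion₂_subset fun x hx => sdiff_subset_sdiff_left (hr x (huZ hx)).2.2.1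
      _ ≤ _ := by gcongr
  by_contra hne
  have h0 : ∀ ε : ℝ≥0, 0 < ε → μ Z ≤ 0 + ε := by
    intro ε hε
    have hβ : 0 < β := lt_of_lt_of_le one_pos h.one_le
    have := key (ε / (2 * β)) (by positivity)
    rw [zero_add]
    convert this using 1
    rw [← ENNReal.coe_ofNat, ← ENNReal.coe_mul, ← ENNReal.coe_mul]
    congr 1
    field_simp
  exact hne (le_antisymm (ENNReal.le_of_forall_pos_le_add fun ε hε _ => h0 ε hε) bot_le)

/-- Selection of balls: for a bounded set of heavy points there are finitely many disjoint heavy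
balls, of nearly maximal radii, whose fivefold dilates cover the set up to small measure. -/
lemma Admissible.exists_balls [BorelSpace X] [SecondCountableTopology X]
    (h : Admissible μ lam α γ β) {φ : X → ℝ≥0∞} {t : ℝ≥0∞} (ht0 : t ≠ 0)
    (htop : t ≠ ∞) (hφ : ∫⁻ x, φ x ∂μ < t * μ univ) {D : Set X} (hDb : Bornology.IsBounded D)
    (hD : ∀ x ∈ D, ∃ r, 0 < r ∧ Heavy μ α φ t x r) {ε : ℝ≥0∞} (hε : ε ≠ 0) :
    ∃ (v : Finset X) (r : X → ℝ), (∀ x ∈ v, 0 < r x ∧ Heavy μ α φ t x (r x) ∧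
        ∀ s, 2 * r x ≤ s → ¬ Heavy μ α φ t x s) ∧
      (v : Set X).PairwiseDisjoint (fun x => ball x (r x)) ∧
      μ (D \ ⋃ x ∈ v, ball x (5 * r x)) ≤ ε := by
  classical
  have hα := h.five_le
  rcases D.eq_empty_or_nonempty with rfl | ⟨x₀, hx₀⟩
  · exact ⟨∅, fun _ => 0, by simp, by simp, by simp⟩
  obtain ⟨b, hb⟩ := hDb.subset_ball x₀
  -- the radii at which points of `D` are heavy are bounded
  obtain ⟨R, hR⟩ : ∃ R : ℝ, ∀ x ∈ D, ∀ r, Heavy μ α φ t x r → r ≤ R := by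
    have hlim : Tendsto (fun n : ℕ => t * μ (ball x₀ n)) atTop (nhds (t * μ univ)) := by
      rw [← iUnion_ball_nat x₀]
      refine ENNReal.Tendsto.const_mul (tendsto_measure_iUnion_atTop ?_) (Or.inr htop)
      exact fun m n hmn => ball_subset_ball (by exact_mod_cast hmn)
    obtain ⟨n, hn⟩ := (hlim.eventually (lt_mem_nhds hφ)).exists
    refine ⟨(n + b) / α, fun x hx r hr => ?_⟩
    by_contra! hlt
    rw [div_lt_iff₀ h.alpha_pos] at hlt
    have h1 : ball x₀ n ⊆ ball x (α * r) := by
      refine ball_subset_ball' ?_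
      have := mem_ball'.1 (hb hx)
      linarith
    have h2 : t * μ (ball x (α * r)) < t * μ (ball x₀ n) :=
      (hr.trans_le (setLIntegral_le_lintegral _ _)).trans hn
    exact absurd (measure_mono h1) (not_le.2 (lt_of_mul_lt_mul_left' h2))
  have hch : ∀ x, ∃ r : ℝ, x ∈ D → 0 < r ∧ Heavy μ α φ t x r ∧
      ∀ s, 2 * r ≤ s → ¬ Heavy μ α φ t x s := by
    intro x
    by_cases hx : x ∈ D
    · obtain ⟨r₀, hr₀, hheavy₀⟩ := hD x hx
      set S : Set ℝ := {r | Heavy μ α φ t x r} with hS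
      have hbdd : BddAbove S := ⟨R, fun r hr => hR x hx r hr⟩
      have hle : r₀ ≤ sSup S := le_csSup hbdd hheavy₀
      obtain ⟨r, hrS, hrlt⟩ := exists_lt_of_lt_csSup (s := S) (b := sSup S / 2) ⟨r₀, hheavy₀⟩
        (by linarith)
      refine ⟨r, fun _ => ⟨by linarith, hrS, fun s hs hsS => ?_⟩⟩
      have := le_csSup hbdd hsS
      linarith
    · exact ⟨0, fun h => absurd h hx⟩
  choose r hr using hch
  obtain ⟨u, huD, hdisj, hcov⟩ := exists_disjoint_balls D r (fun x hx => (hr x hx).1) R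
    (fun x hx => hR x hx _ (hr x hx).2.1)
  have hucount : u.Countable := hdisj.countable_of_isOpen (fun x _ => isOpen_ball)
    (fun x hx => nonempty_ball.2 (hr x (huD hx)).1)
  have hsum : ∑' x : u, μ (ball (x : X) (5 * r x)) ≠ ∞ := by
    have h1 : t * ∑' x : u, μ (ball (x : X) (5 * r x)) ≤ ∫⁻ x, φ x ∂μ := by
      rw [← ENNReal.tsum_mul_left]
      calc _ ≤ ∑' x : u, ∫⁻ y in ball (x : X) (r x), φ y ∂μ := by
            refine ENNReal.tsum_le_tsum fun x => ?_
            obtain ⟨hpos, hheavy, -⟩ := hr x (huD x.2)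
            refine le_trans ?_ hheavy.le
            gcongr
        _ = ∫⁻ y in ⋃ x ∈ u, ball x (r x), φ y ∂μ :=
            (lintegral_biUnion hucount (fun x _ => measurableSet_ball) hdisj _).symm
        _ ≤ _ := setLIntegral_le_lintegral _ _
    intro htopsum
    rw [htopsum, ENNReal.mul_top ht0, top_le_iff] at h1
    exact absurd hφ (by rw [h1]; exact not_top_lt)
  have htail := ENNReal.tendsto_tsum_compl_atTop_zero hsum
  obtain ⟨w, hw⟩ := (htail.eventually (ge_mem_nhds (pos_iff_ne_zero.2 hε))).exists
  refine ⟨w.map (Function.Embedding.subtype _), r, ?_, ?_, ?_⟩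
  · intro x hx
    obtain ⟨y, -, rfl⟩ := Finset.mem_map.1 hx
    exact hr _ (huD y.2)
  · refine hdisj.subset fun x hx => ?_
    obtain ⟨y, -, rfl⟩ := Finset.mem_map.1 hx
    exact y.2
  · have hc : Countable u := hucount.to_subtype
    refine le_trans (le_trans (measure_mono ?_) (measure_iUnion_le
      (fun x : {x : u // x ∉ w} => ball ((x : u) : X) (5 * r ((x : u) : X))))) hw
    intro x hx
    obtain ⟨y, hy, hsub⟩ := hcov x hx.1
    have hxy := hsub (mem_ball_self (hr x hx.1).1)
    refine mem_iUnion.2 ⟨⟨⟨y, hy⟩, fun hyw => hx.2 ?_⟩, hxy⟩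
    exact mem_iUnion₂.2 ⟨y, Finset.mem_map.2 ⟨⟨y, hy⟩, hyw, rfl⟩, hxy⟩

end NonHom

namespace NonHom

open Set Metric Filter

variable {X : Type*} [MetricSpace X]

/-! ### Atomic blocks and the Hardy space -/

lemma Ball.carrier_subset_dilate (B : Ball X) {t : ℝ} (ht : 1 ≤ t) :
    B.carrier ⊆ B.dilate t :=
  ball_subset_ball (le_mul_of_one_le_left B.radius_pos.le ht)

variable [MeasurableSpace X] {μ : Measure X} {lam : X → ℝ → ℝ} {ρ : ℝ} {β : ℝ≥0} {q : ℝ≥0∞}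

lemma Ball.measurableSet_carrier [OpensMeasurableSpace X] (B : Ball X) :
    MeasurableSet B.carrier := measurableSet_ball

/-- Atoms have `L¹`-norm at most one, by Hölder's inequality. -/
lemma IsAtom.lintegral_enorm_le [OpensMeasurableSpace X] (hfin : ∀ x r, μ (ball x r) < ∞)
    (hρ : 1 ≤ ρ) (hq : 1 < q) {A B : Ball X} {a : X → ℂ} (ha : IsAtom μ lam ρ q A B a) :
    ∫⁻ x, ‖a x‖ₑ ∂μ ≤ 1 := by
  obtain ⟨hmeas, hsupp, hnorm⟩ := ha
  have hmono : μ A.carrier ≤ μ (A.dilate ρ) := measure_mono (A.carrier_subset_dilate hρ)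
  rw [← eLpNorm_one_eq_lintegral_enorm, ← eLpNorm_restrict_eq_of_support_subset hsupp]
  rcases eq_or_ne (μ A.carrier) 0 with h0 | h0
  · rw [Measure.restrict_eq_zero.2 h0]; simp
  set m := μ (A.dilate ρ) with hm
  have hm0 : m ≠ 0 := fun h => h0 (le_antisymm (hmono.trans h.le) bot_le)
  have hmtop : m ≠ ∞ := (hfin _ _).ne
  have hqinv : q.toReal⁻¹ ≤ 1 := by
    rcases eq_or_ne q ∞ with rfl | hqt
    · simp
    · exact inv_le_one_of_one_le₀ (by
        rw [← ENNReal.toReal_one]; exact ENNReal.toReal_mono hqt hq.le)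
  calc eLpNorm a 1 (μ.restrict A.carrier)
      ≤ eLpNorm a q (μ.restrict A.carrier) *
        (μ.restrict A.carrier) univ ^ (1 / (1 : ℝ≥0∞).toReal - 1 / q.toReal) :=
        eLpNorm_le_eLpNorm_mul_rpow_measure_univ hq.le hmeas.restrict
    _ ≤ m ^ (q.toReal⁻¹ - 1) * (1 + delta μ lam A B)⁻¹ * m ^ (1 - q.toReal⁻¹) := by
        rw [eLpNorm_restrict_eq_of_support_subset hsupp, Measure.restrict_apply_univ]
        simp only [ENNReal.toReal_one, one_div, inv_one]
        gcongr
    _ ≤ m ^ (q.toReal⁻¹ - 1) * 1 * m ^ (1 - q.toReal⁻¹) := by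
        gcongr
        exact ENNReal.inv_le_one.2 le_self_add
    _ = 1 := by
        rw [mul_one, ← ENNReal.rpow_add _ _ hm0 hmtop]
        simp

lemma IsAtomicBlock.nonneg {b : X → ℂ} {w : ℝ} (hb : IsAtomicBlock μ lam ρ q b w) : 0 ≤ w := by
  obtain ⟨-, -, B, -, B₁, B₂, a₁, a₂, l₁, l₂, -, -, -, -, -, rfl⟩ := hb
  positivity

lemma IsAtomicBlock.lintegral_enorm_le [OpensMeasurableSpace X]
    (hfin : ∀ x r, μ (ball x r) < ∞) (hρ : 1 ≤ ρ) (hq : 1 < q) {b : X → ℂ} {w : ℝ}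
    (hb : IsAtomicBlock μ lam ρ q b w) : ∫⁻ x, ‖b x‖ₑ ∂μ ≤ ENNReal.ofReal w := by
  obtain ⟨-, -, B, -, B₁, B₂, a₁, a₂, l₁, l₂, -, -, h₁, h₂, hb, rfl⟩ := hb
  calc ∫⁻ x, ‖b x‖ₑ ∂μ ≤ ∫⁻ x, (‖l₁‖ₑ * ‖a₁ x‖ₑ + ‖l₂‖ₑ * ‖a₂ x‖ₑ) ∂μ := by
        refine lintegral_mono fun x => ?_
        rw [hb x, ← enorm_mul, ← enorm_mul]
        exact enorm_add_le _ _
    _ = ‖l₁‖ₑ * ∫⁻ x, ‖a₁ x‖ₑ ∂μ + ‖l₂‖ₑ * ∫⁻ x, ‖a₂ x‖ₑ ∂μ := by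
        rw [lintegral_add_left' (h₁.1.enorm.const_mul _), lintegral_const_mul'' _ h₁.1.enorm,
          lintegral_const_mul'' _ h₂.1.enorm]
    _ ≤ ‖l₁‖ₑ * 1 + ‖l₂‖ₑ * 1 := by
        gcongr
        · exact h₁.lintegral_enorm_le hfin hρ hq
        · exact h₂.lintegral_enorm_le hfin hρ hq
    _ = ENNReal.ofReal (‖l₁‖ + ‖l₂‖) := by
        rw [ENNReal.ofReal_add (norm_nonneg _) (norm_nonneg _), ofReal_norm, ofReal_norm,
          mul_one, mul_one]

/-- `h` is a sum of atomic blocks of total size at most `w`. -/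
def H1Le (μ : Measure X) (lam : X → ℝ → ℝ) (ρ : ℝ) (q : ℝ≥0∞) (h : X → ℂ) (w : ℝ≥0∞) : Prop :=
  ∃ (b : ℕ → X → ℂ) (v : ℕ → ℝ), (∀ j, IsAtomicBlock μ lam ρ q (b j) (v j)) ∧
    ∑' j, ENNReal.ofReal (v j) ≤ w ∧ ∀ᵐ x ∂μ, HasSum (fun j => b j x) (h x)

lemma H1Le.mono {h : X → ℂ} {w w' : ℝ≥0∞} (hh : H1Le μ lam ρ q h w) (hw : w ≤ w') :
    H1Le μ lam ρ q h w' := by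
  obtain ⟨b, v, hb, hv, hs⟩ := hh
  exact ⟨b, v, hb, hv.trans hw, hs⟩

lemma H1Le.congr {h h' : X → ℂ} {w : ℝ≥0∞} (hh : H1Le μ lam ρ q h w) (he : h =ᵐ[μ] h') :
    H1Le μ lam ρ q h' w := by
  obtain ⟨b, v, hb, hv, hs⟩ := hh
  refine ⟨b, v, hb, hv, ?_⟩
  filter_upwards [hs, he] with x hx hex
  rwa [← hex]

lemma H1Le.aestronglyMeasurable {h : X → ℂ} {w : ℝ≥0∞} (hh : H1Le μ lam ρ q h w) :
    AEStronglyMeasurable h μ := by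
  obtain ⟨b, v, hb, hv, hs⟩ := hh
  refine aestronglyMeasurable_of_tendsto_ae (u := atTop)
    (f := fun n : ℕ => fun x => ∑ j ∈ Finset.range n, b j x) (fun n => ?_) ?_
  · exact (integrable_finsetSum _ fun j _ => (hb j).1).aestronglyMeasurable
  · filter_upwards [hs] with x hx using hx.tendsto_sum_nat

lemma H1Le.lintegral_enorm_le [OpensMeasurableSpace X] (hfin : ∀ x r, μ (ball x r) < ∞)
    (hρ : 1 ≤ ρ) (hq : 1 < q) {h : X → ℂ} {w : ℝ≥0∞} (hh : H1Le μ lam ρ q h w) :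
    ∫⁻ x, ‖h x‖ₑ ∂μ ≤ w := by
  obtain ⟨b, v, hb, hv, hs⟩ := hh
  calc ∫⁻ x, ‖h x‖ₑ ∂μ ≤ ∫⁻ x, ∑' j, ‖b j x‖ₑ ∂μ := by
        refine lintegral_mono_ae ?_
        filter_upwards [hs] with x hx
        rw [← hx.tsum_eq]
        exact enorm_tsum_le_tsum_enorm
    _ = ∑' j, ∫⁻ x, ‖b j x‖ₑ ∂μ := lintegral_tsum fun j => (hb j).1.aestronglyMeasurable.enorm
    _ ≤ ∑' j, ENNReal.ofReal (v j) :=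
        ENNReal.tsum_le_tsum fun j => (hb j).lintegral_enorm_le hfin hρ hq
    _ ≤ w := hv

lemma H1Le.memH1 [OpensMeasurableSpace X] (hfin : ∀ x r, μ (ball x r) < ∞) (hρ : 1 ≤ ρ)
    (hq : 1 < q) {h : X → ℂ} {w : ℝ≥0∞} (hw : w ≠ ∞) (hh : H1Le μ lam ρ q h w) :
    MemH1 μ lam ρ q h ∧ h1Norm μ lam ρ q h ≤ w.toReal := by
  have hint : Integrable h μ :=
    ⟨hh.aestronglyMeasurable, (hh.lintegral_enorm_le hfin hρ hq).trans_lt hw.lt_top⟩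
  obtain ⟨b, v, hb, hv, hs⟩ := hh
  have hne : ∑' j, ENNReal.ofReal (v j) ≠ ∞ := (hv.trans_lt hw.lt_top).ne
  have hsum : Summable v := by
    have := ENNReal.summable_toReal hne
    refine this.congr fun j => ENNReal.toReal_ofReal (hb j).nonneg
  have hbound : H1Bound μ lam ρ q h (∑' j, v j) := ⟨b, v, hb, hsum.hasSum, hs⟩
  refine ⟨⟨hint, _, hbound⟩, ?_⟩
  have hbdd : BddBelow {C : ℝ | H1Bound μ lam ρ q h C} := by
    refine ⟨0, ?_⟩
    rintro C ⟨b', v', hb', hv', -⟩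
    exact hv'.nonneg fun j => (hb' j).nonneg
  refine (csInf_le hbdd hbound).trans ?_
  rw [← ENNReal.ofReal_le_iff_le_toReal hw,
    ENNReal.ofReal_tsum_of_nonneg (fun j => (hb j).nonneg) hsum]
  exact hv

lemma MemH1.exists_h1Le {h : X → ℂ} (hh : MemH1 μ lam ρ q h) :
    ∃ w : ℝ≥0∞, w ≠ ∞ ∧ H1Le μ lam ρ q h w := by
  obtain ⟨-, C, b, v, hb, hv, hs⟩ := hh
  refine ⟨ENNReal.ofReal C, ENNReal.ofReal_ne_top, b, v, hb, ?_, hs⟩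
  rw [← hv.tsum_eq, ENNReal.ofReal_tsum_of_nonneg (fun j => (hb j).nonneg) hv.summable]

/-- Countable sums of elements of the Hardy space. -/
lemma H1Le.tsum [OpensMeasurableSpace X] (hfin : ∀ x r, μ (ball x r) < ∞) (hρ : 1 ≤ ρ)
    (hq : 1 < q) {f : ℕ → X → ℂ} {w : ℕ → ℝ≥0∞} {W : ℝ≥0∞} {h : X → ℂ}
    (hf : ∀ n, H1Le μ lam ρ q (f n) (w n)) (hw : ∑' n, w n ≤ W) (hW : W ≠ ∞)
    (hs : ∀ᵐ x ∂μ, HasSum (fun n => f n x) (h x)) : H1Le μ lam ρ q h W := by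
  choose b v hb hv hbs using hf
  have htot : ∑' p : ℕ × ℕ, ENNReal.ofReal (v p.1 p.2) ≤ W := by
    rw [ENNReal.tsum_prod (f := fun n j => ENNReal.ofReal (v n j))]
    exact (ENNReal.tsum_le_tsum hv).trans hw
  have hae : ∀ᵐ x ∂μ, ∑' p : ℕ × ℕ, ‖b p.1 p.2 x‖ₑ < ∞ := by
    refine ae_lt_top' (AEMeasurable.tsum fun p =>
      (hb p.1 p.2).1.aestronglyMeasurable.enorm) ?_
    rw [lintegral_tsum fun p : ℕ × ℕ => (hb p.1 p.2).1.aestronglyMeasurable.enorm]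
    refine ((ENNReal.tsum_le_tsum fun p : ℕ × ℕ =>
      (hb p.1 p.2).lintegral_enorm_le hfin hρ hq).trans htot).trans_lt hW.lt_top |>.ne
  obtain ⟨e⟩ : Nonempty (ℕ ≃ ℕ × ℕ) := ⟨Nat.pairEquiv.symm⟩
  refine ⟨fun k => b (e k).1 (e k).2, fun k => v (e k).1 (e k).2, fun k => hb _ _, ?_, ?_⟩
  · refine le_trans (le_of_eq ?_) htot
    exact e.tsum_eq (fun p : ℕ × ℕ => ENNReal.ofReal (v p.1 p.2))
  · filter_upwards [hae, hs, ae_all_iff.2 hbs] with x hx hsx hbx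
    have hsum : Summable fun p : ℕ × ℕ => b p.1 p.2 x := Summable.of_enorm hx.ne
    have h1 := hsum.hasSum.prod_fiberwise hbx
    have h2 : HasSum (fun p : ℕ × ℕ => b p.1 p.2 x) (h x) := by
      rw [hsx.unique h1]; exact hsum.hasSum
    exact e.hasSum_iff.2 h2

lemma isAtom_zero (A B : Ball X) : IsAtom μ lam ρ q A B 0 :=
  ⟨aestronglyMeasurable_zero, by simp, by simp⟩

lemma isAtomicBlock_zero [Nonempty X] : IsAtomicBlock μ lam ρ q 0 0 :=
  let B : Ball X := ⟨Classical.arbitrary X, 1, one_pos⟩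
  ⟨integrable_zero _ _ _, by simp, B, by simp, B, B, 0, 0, 0, 0, Subset.rfl, Subset.rfl,
    isAtom_zero B B, isAtom_zero B B, by simp, by simp⟩

lemma H1Le.zero [Nonempty X] (w : ℝ≥0∞) : H1Le μ lam ρ q 0 w :=
  ⟨fun _ => 0, fun _ => 0, fun _ => isAtomicBlock_zero, by simp,
    Eventually.of_forall fun _ => hasSum_zero⟩

lemma H1Le.add [OpensMeasurableSpace X] [Nonempty X] (hfin : ∀ x r, μ (ball x r) < ∞) (hρ : 1 ≤ ρ)
    (hq : 1 < q) {h₁ h₂ : X → ℂ} {w₁ w₂ : ℝ≥0∞} (hw₁ : w₁ ≠ ∞) (hw₂ : w₂ ≠ ∞)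
    (hh₁ : H1Le μ lam ρ q h₁ w₁) (hh₂ : H1Le μ lam ρ q h₂ w₂) :
    H1Le μ lam ρ q (h₁ + h₂) (w₁ + w₂) := by
  refine H1Le.tsum hfin hρ hq (f := fun n => if n = 0 then h₁ else if n = 1 then h₂ else 0)
    (w := fun n => if n = 0 then w₁ else if n = 1 then w₂ else 0) (fun n => ?_) ?_
    (ENNReal.add_ne_top.2 ⟨hw₁, hw₂⟩) ?_
  · split_ifs
    · exact hh₁
    · exact hh₂
    · exact H1Le.zero _
  · rw [tsum_eq_sum (s := Finset.range 2)]
    · simp [Finset.sum_range_succ]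
    · intro n hn
      have : ¬ n < 2 := by simpa using hn
      simp [show n ≠ 0 by omega, show n ≠ 1 by omega]
  · refine Eventually.of_forall fun x => ?_
    have := hasSum_sum_of_ne_finset_zero (L := .unconditional ℕ) (s := Finset.range 2)
      (f := fun n => (if n = 0 then h₁ else if n = 1 then h₂ else 0 : X → ℂ) x) (by
        intro n hn
        have : ¬ n < 2 := by simpa using hn
        simp [show n ≠ 0 by omega, show n ≠ 1 by omega])
    simpa [Finset.sum_range_succ] using this

lemma H1Le.sum [OpensMeasurableSpace X] [Nonempty X] (hfin : ∀ x r, μ (ball x r) < ∞)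
    (hρ : 1 ≤ ρ) (hq : 1 < q) {ι : Type*} (s : Finset ι) {h : ι → X → ℂ} {w : ι → ℝ≥0∞}
    (hw : ∀ i ∈ s, w i ≠ ∞) (hh : ∀ i ∈ s, H1Le μ lam ρ q (h i) (w i)) :
    H1Le μ lam ρ q (∑ i ∈ s, h i) (∑ i ∈ s, w i) := by
  classical
  induction s using Finset.induction_on with
  | empty => simpa using H1Le.zero 0
  | insert i s hi ih =>
    rw [Finset.sum_insert hi, Finset.sum_insert hi]
    refine H1Le.add hfin hρ hq (hw i (Finset.mem_insert_self _ _)) ?_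
      (hh i (Finset.mem_insert_self _ _)) (ih (fun j hj => hw j (Finset.mem_insert_of_mem hj))
        (fun j hj => hh j (Finset.mem_insert_of_mem hj)))
    exact ENNReal.sum_ne_top.2 fun j hj => hw j (Finset.mem_insert_of_mem hj)

lemma H1Le.const_smul {h : X → ℂ} {w : ℝ≥0∞} (c : ℂ) (hh : H1Le μ lam ρ q h w) :
    H1Le μ lam ρ q (c • h) (‖c‖ₑ * w) := by
  obtain ⟨b, v, hb, hv, hs⟩ := hh
  refine ⟨fun j => c • b j, fun j => ‖c‖ * v j, fun j => ?_, ?_, ?_⟩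
  · obtain ⟨hint, hzero, B, hB, B₁, B₂, a₁, a₂, l₁, l₂, h1, h2, h3, h4, h5, h6⟩ := hb j
    refine ⟨hint.smul c, ?_, B, (Function.support_const_smul_subset c _).trans hB,
      B₁, B₂, a₁, a₂, c * l₁, c * l₂,
      h1, h2, h3, h4, fun x => ?_, ?_⟩
    · simp only [Pi.smul_apply]
      rw [integral_smul, hzero, smul_zero]
    · simp only [Pi.smul_apply, smul_eq_mul, h5 x]; ring
    · dsimp only
      rw [h6, norm_mul, norm_mul]; ring
  · simp_rw [ENNReal.ofReal_mul (norm_nonneg c), ofReal_norm]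
    rw [ENNReal.tsum_mul_left]
    gcongr
  · filter_upwards [hs] with x hx using hx.const_smul c

/-- A bounded function supported in a ball `A` of positive measure is a multiple of an atom. -/
lemma exists_eq_mul_isAtom [OpensMeasurableSpace X] (hfin : ∀ x r, μ (ball x r) < ∞) (hρ : 1 ≤ ρ)
    {A B : Ball X} (hδ : delta μ lam A B ≤ β) (hA : μ A.carrier ≠ 0) {u : X → ℂ}
    (hu : AEStronglyMeasurable u μ) (hsupp : Function.support u ⊆ A.carrier) {K : ℝ≥0}
    (hK : ∀ x, ‖u x‖ₑ ≤ K) :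
    ∃ (l : ℂ) (a : X → ℂ), IsAtom μ lam ρ q A B a ∧ (∀ x, u x = l * a x) ∧
      ‖l‖ₑ ≤ K * μ (A.dilate ρ) * (1 + β) := by
  rcases eq_or_ne K 0 with rfl | hK0
  · refine ⟨0, 0, isAtom_zero A B, fun x => ?_, by simp⟩
    simpa using hK x
  set m := μ (A.dilate ρ) with hm
  have hmono : μ A.carrier ≤ m := measure_mono (A.carrier_subset_dilate hρ)
  have hm0 : m ≠ 0 := fun h => hA (le_antisymm (hmono.trans h.le) bot_le)
  have hmtop : m ≠ ∞ := (hfin _ _).ne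
  set D := 1 + delta μ lam A B with hD
  have hD0 : D ≠ 0 := by simp [hD]
  have hDtop : D ≠ ∞ :=
    ENNReal.add_ne_top.2 ⟨ENNReal.one_ne_top, (hδ.trans_lt ENNReal.coe_lt_top).ne⟩
  set L : ℝ≥0∞ := K * m * D with hL
  have hLtop : L ≠ ∞ := ENNReal.mul_ne_top (ENNReal.mul_ne_top ENNReal.coe_ne_top hmtop) hDtop
  have hL0 : L ≠ 0 := mul_ne_zero (mul_ne_zero (by exact_mod_cast hK0) hm0) hD0
  have hLpos : 0 < L.toReal := ENNReal.toReal_pos hL0 hLtop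
  refine ⟨(L.toReal : ℂ), fun x => (L.toReal : ℂ)⁻¹ * u x,
    ⟨hu.const_mul _, ?_, ?_⟩, fun x => ?_, ?_⟩
  · refine subset_trans (fun x hx => ?_) hsupp
    exact right_ne_zero_of_mul hx
  · have hsupp' : Function.support (fun x => (L.toReal : ℂ)⁻¹ * u x) ⊆ A.carrier :=
      subset_trans (fun x hx => right_ne_zero_of_mul hx) hsupp
    rw [← eLpNorm_restrict_eq_of_support_subset hsupp']
    have hbd : ∀ x, ‖(L.toReal : ℂ)⁻¹ * u x‖ ≤ (L.toReal)⁻¹ * K := by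
      intro x
      rw [norm_mul, norm_inv, Complex.norm_real, Real.norm_of_nonneg hLpos.le]
      gcongr
      have := hK x
      rwa [enorm_le_coe, ← NNReal.coe_le_coe, coe_nnnorm] at this
    have hq0 : 0 ≤ q.toReal⁻¹ := by positivity
    calc eLpNorm (fun x => (L.toReal : ℂ)⁻¹ * u x) q (μ.restrict A.carrier)
        ≤ (μ.restrict A.carrier) univ ^ q.toReal⁻¹ * ENNReal.ofReal ((L.toReal)⁻¹ * K) :=
          eLpNorm_le_of_ae_bound (Eventually.of_forall hbd)
      _ ≤ m ^ q.toReal⁻¹ * (L⁻¹ * K) := by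
          rw [Measure.restrict_apply_univ, ENNReal.ofReal_mul (by positivity),
            ENNReal.ofReal_inv_of_pos hLpos, ENNReal.ofReal_toReal hLtop, ENNReal.ofReal_coe_nnreal]
          gcongr
      _ = m ^ q.toReal⁻¹ * (m⁻¹ * D⁻¹) := by
          congr 1
          rw [hL, ENNReal.mul_inv (Or.inr hDtop) (Or.inr hD0),
            ENNReal.mul_inv (Or.inr hmtop) (Or.inr hm0)]
          rw [mul_comm, ← mul_assoc, ← mul_assoc, ENNReal.mul_inv_cancel (by exact_mod_cast hK0)
            ENNReal.coe_ne_top, one_mul]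
      _ = m ^ (q.toReal⁻¹ - 1) * D⁻¹ := by
          rw [← mul_assoc, ENNReal.rpow_sub _ _ hm0 hmtop, ENNReal.rpow_one, div_eq_mul_inv]
  · rw [← mul_assoc, mul_inv_cancel₀ (by exact_mod_cast hLpos.ne'), one_mul]
  · rw [← ofReal_norm, Complex.norm_real, Real.norm_of_nonneg hLpos.le,
      ENNReal.ofReal_toReal hLtop, hL]
    gcongr
    exact add_le_add_right hδ 1

/-- A sum of two bounded functions, supported in balls close to a common ball, is an atomic block
if its integral vanishes. -/
lemma H1Le.of_add [OpensMeasurableSpace X] [Nonempty X] (hfin : ∀ x r, μ (ball x r) < ∞)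
    (hρ : 1 ≤ ρ) {A₁ A₂ B : Ball X} (hA₁ : A₁.carrier ⊆ B.carrier) (hA₂ : A₂.carrier ⊆ B.carrier)
    (hδ₁ : delta μ lam A₁ B ≤ β) (hδ₂ : delta μ lam A₂ B ≤ β)
    (hμ₁ : μ A₁.carrier ≠ 0) (hμ₂ : μ A₂.carrier ≠ 0) {u₁ u₂ : X → ℂ}
    (hu₁ : AEStronglyMeasurable u₁ μ) (hu₂ : AEStronglyMeasurable u₂ μ)
    (hs₁ : Function.support u₁ ⊆ A₁.carrier) (hs₂ : Function.support u₂ ⊆ A₂.carrier)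
    {K₁ K₂ : ℝ≥0} (hK₁ : ∀ x, ‖u₁ x‖ₑ ≤ K₁) (hK₂ : ∀ x, ‖u₂ x‖ₑ ≤ K₂)
    (hint : ∫ x, (u₁ x + u₂ x) ∂μ = 0) :
    H1Le μ lam ρ q (u₁ + u₂)
      ((K₁ * μ (A₁.dilate ρ) + K₂ * μ (A₂.dilate ρ)) * (1 + β)) := by
  obtain ⟨l₁, a₁, ha₁, h₁, hl₁⟩ :=
    exists_eq_mul_isAtom (q := q) hfin hρ hδ₁ hμ₁ hu₁ hs₁ hK₁
  obtain ⟨l₂, a₂, ha₂, h₂, hl₂⟩ :=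
    exists_eq_mul_isAtom (q := q) hfin hρ hδ₂ hμ₂ hu₂ hs₂ hK₂
  have hsupp : Function.support (u₁ + u₂) ⊆ B.carrier :=
    (Function.support_add u₁ u₂).trans (union_subset (hs₁.trans hA₁) (hs₂.trans hA₂))
  have hinteg : ∀ {u : X → ℂ} {A : Ball X} {K : ℝ≥0}, AEStronglyMeasurable u μ →
      Function.support u ⊆ A.carrier → (∀ x, ‖u x‖ₑ ≤ K) → Integrable u μ := by
    intro u A K hu hs hK
    refine (integrableOn_iff_integrable_of_support_subset hs).1 ⟨hu.restrict, ?_⟩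
    refine (lintegral_mono hK).trans_lt ?_
    rw [lintegral_const, Measure.restrict_apply_univ]
    exact ENNReal.mul_lt_top ENNReal.coe_lt_top (hfin _ _)
  have hblock : IsAtomicBlock μ lam ρ q (u₁ + u₂) (‖l₁‖ + ‖l₂‖) :=
    ⟨(hinteg hu₁ hs₁ hK₁).add (hinteg hu₂ hs₂ hK₂), hint, B, hsupp, A₁, A₂, a₁, a₂, l₁, l₂, hA₁,
      hA₂, ha₁, ha₂, fun x => by simp [h₁ x, h₂ x], rfl⟩
  refine ⟨fun n => if n = 0 then u₁ + u₂ else 0, fun n => if n = 0 then ‖l₁‖ + ‖l₂‖ else 0,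
    fun n => ?_, ?_, Eventually.of_forall fun x => ?_⟩
  · dsimp only
    split_ifs
    · exact hblock
    · exact isAtomicBlock_zero
  · rw [tsum_eq_single 0 (fun n hn => by simp [hn])]
    simp only [if_true]
    rw [ENNReal.ofReal_add (norm_nonneg _) (norm_nonneg _), ofReal_norm, ofReal_norm, add_mul]
    gcongr
  · simpa using hasSum_single (f := fun n : ℕ => (if n = 0 then u₁ + u₂ else 0 : X → ℂ) x) 0
      (fun n hn => by simp [hn])

end NonHom

namespace NonHom

open Set Metric Filter

/-! ### The Calderón–Zygmund decomposition of bounded functions -/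

/-- The sets of a finite family can be shrunk to disjoint ones with the same union. -/
lemma exists_disjoint_subsets {X ι : Type*} [MeasurableSpace X] (v : Finset ι)
    (A : ι → Set X) (hA : ∀ i ∈ v, MeasurableSet (A i)) :
    ∃ P : ι → Set X, (∀ i ∈ v, MeasurableSet (P i)) ∧ (∀ i ∈ v, P i ⊆ A i) ∧
      (v : Set ι).PairwiseDisjoint P ∧ ⋃ i ∈ v, P i = ⋃ i ∈ v, A i := by
  classical
  induction v using Finset.induction_on with
  | empty => exact ⟨fun _ => ∅, by simp⟩
  | insert a v ha ih =>
    obtain ⟨P, hPm, hPA, hPd, hPU⟩ := ih fun i hi => hA i (Finset.mem_insert_of_mem hi)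
    have hne : ∀ i ∈ v, i ≠ a := fun i hi => ne_of_mem_of_not_mem hi ha
    have hUm : MeasurableSet (⋃ i ∈ v, A i) :=
      Finset.measurableSet_biUnion _ fun i hi => hA i (Finset.mem_insert_of_mem hi)
    refine ⟨Function.update P a (A a \ ⋃ i ∈ v, A i), ?_, ?_, ?_, ?_⟩
    · intro i hi
      rcases Finset.mem_insert.1 hi with rfl | hi
      · rw [Function.update_self]; exact (hA i hi).diff hUm
      · rw [Function.update_of_ne (hne i hi)]; exact hPm i hi
    · intro i hi
      rcases Finset.mem_insert.1 hi with rfl | hi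
      · rw [Function.update_self]; exact sdiff_subset
      · rw [Function.update_of_ne (hne i hi)]; exact hPA i hi
    · have hda : ∀ i ∈ v, Disjoint (P i) (A a \ ⋃ i ∈ v, A i) := fun i hi =>
        disjoint_sdiff_right.mono_left ((hPA i hi).trans (subset_biUnion_of_mem (u := A) hi))
      intro i hi j hj hij
      rw [Function.onFun]
      rcases Finset.mem_insert.1 hi with hia | hi' <;> rcases Finset.mem_insert.1 hj with hja | hj'
      · exact absurd (hia.trans hja.symm) hij
      · rw [hia, Function.update_self, Function.update_of_ne (hne j hj')]
        exact (hda j hj').symm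
      · rw [hja, Function.update_self, Function.update_of_ne (hne i hi')]
        exact hda i hi'
      · rw [Function.update_of_ne (hne i hi'), Function.update_of_ne (hne j hj')]
        exact hPd hi' hj' hij
    · have hcongr : ⋃ i ∈ v, Function.update P a (A a \ ⋃ i ∈ v, A i) i = ⋃ i ∈ v, P i :=
        iUnion₂_congr fun i hi => Function.update_of_ne (hne i hi) _ _
      rw [Finset.set_biUnion_insert, Finset.set_biUnion_insert, Function.update_self, hcongr, hPU,
        sdiff_union_self]

/-- Given masses `c i` to be placed on sets `R i`, such that the total mass of the smaller sets
that meet `R k` is at most `L μ (R k)`, the masses can be spread out on the `R i` as functions whose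
absolute values have a uniformly bounded sum. In the order of increasing size, `c k` is spread
over the part of `R k` where the sum of the previous functions is at most `2 L`, which is at
least half of `R k`. -/
lemma exists_spread {X ι : Type*} [MeasurableSpace X] {μ : Measure X} (s : Finset ι)
    (R : ι → Set X) (rr : ι → ℝ) (c : ι → ℂ) {L : ℝ≥0∞} (hLtop : L ≠ ∞)
    (hRm : ∀ i ∈ s, MeasurableSet (R i)) (hR0 : ∀ i ∈ s, μ (R i) ≠ 0)
    (hRtop : ∀ i ∈ s, μ (R i) ≠ ∞)
    (hL : ∀ k ∈ s, ∀ v ⊆ s, (∀ i ∈ v, rr i ≤ rr k ∧ (R i ∩ R k).Nonempty) →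
      ∑ i ∈ v, ‖c i‖ₑ ≤ L * μ (R k)) :
    ∃ φ : ι → X → ℂ, (∀ i ∈ s, Measurable (φ i) ∧ Function.support (φ i) ⊆ R i ∧
      ∫ x, φ i x ∂μ = c i ∧ ∫⁻ x, ‖φ i x‖ₑ ∂μ ≤ ‖c i‖ₑ ∧
      ∀ x, ‖φ i x‖ₑ ≤ 2 * ‖c i‖ₑ / μ (R i)) ∧ ∀ x, ∑ i ∈ s, ‖φ i x‖ₑ ≤ 4 * L := by
  classical
  have hself : ∀ i ∈ s, ‖c i‖ₑ ≤ L * μ (R i) := fun i hi => by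
    have := hL i hi {i} (by simpa using hi) (by
      simpa using nonempty_of_measure_ne_zero (hR0 i hi))
    simpa using this
  rcases eq_or_ne L 0 with rfl | hL0
  · refine ⟨fun _ => 0, fun i hi => ⟨measurable_const, by simp, ?_, by simp, by simp⟩, by simp⟩
    have : c i = 0 := by simpa using hself i hi
    simp [this]
  induction s using Finset.induction_on_max_value rr with
  | empty => exact ⟨fun _ => 0, by simp, by simp⟩
  | insert a s ha hmax ih =>
    have hmem : ∀ {i}, i ∈ s → i ∈ insert a s := fun hi => Finset.mem_insert_of_mem hi
    have haa : a ∈ insert a s := Finset.mem_insert_self _ _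
    obtain ⟨φ, hφ, hsum⟩ := ih (fun i hi => hRm i (hmem hi)) (fun i hi => hR0 i (hmem hi))
      (fun i hi => hRtop i (hmem hi))
      (fun k hk v hv => hL k (hmem hk) v (hv.trans (Finset.subset_insert _ _)))
      (fun i hi => hself i (hmem hi))
    have hne : ∀ i ∈ s, i ≠ a := fun i hi => ne_of_mem_of_not_mem hi ha
    set Φ : X → ℝ≥0∞ := fun x => ∑ i ∈ s, ‖φ i x‖ₑ with hΦ
    have hΦm : Measurable Φ := Finset.measurable_sum _ fun i hi => (hφ i hi).1.enorm
    set A : Set X := R a ∩ {x | Φ x < 2 * L} with hA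
    have hBm : MeasurableSet {x | Φ x < 2 * L} := measurableSet_lt hΦm measurable_const
    have hAm : MeasurableSet A := (hRm a haa).inter hBm
    have hint : ∫⁻ x in R a, Φ x ∂μ ≤ L * μ (R a) := by
      rw [hΦ, lintegral_finsetSum' _ fun i hi => (hφ i hi).1.enorm.aemeasurable]
      refine le_trans ?_ (hL a haa (s.filter fun i => (R i ∩ R a).Nonempty)
        ((Finset.filter_subset _ _).trans (Finset.subset_insert _ _)) fun i hi => ?_)
      · rw [Finset.sum_filter]
        refine Finset.sum_le_sum fun i hi => ?_
        split_ifs with hne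
        · exact (setLIntegral_le_lintegral _ _).trans (hφ i hi).2.2.2.1
        · refine le_of_eq (setLIntegral_eq_zero (hRm a haa) fun x hx => ?_)
          have : φ i x = 0 := by
            by_contra h0
            exact hne ⟨x, (hφ i hi).2.1 h0, hx⟩
          simp [this]
      · rw [Finset.mem_filter] at hi
        exact ⟨hmax i hi.1, hi.2⟩
    have hhalf : μ (R a) ≤ 2 * μ A := by
      have h1 : 2 * μ (R a \ {x | Φ x < 2 * L}) ≤ μ (R a) := by
        have h2 := mul_meas_ge_le_lintegral (μ := μ.restrict (R a)) hΦm (2 * L)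
        rw [Measure.restrict_apply (measurableSet_le measurable_const hΦm)] at h2
        have h3 : {x | 2 * L ≤ Φ x} ∩ R a = R a \ {x | Φ x < 2 * L} := by
          ext x; simp [and_comm]
        rw [h3] at h2
        have h4 : L * (2 * μ (R a \ {x | Φ x < 2 * L})) ≤ L * μ (R a) := by
          refine le_trans (le_of_eq ?_) (h2.trans hint)
          ring
        exact (ENNReal.mul_le_mul_iff_right hL0 hLtop).1 h4
      have h5 : μ (R a) + μ (R a) ≤ 2 * μ A + μ (R a) := by
        calc μ (R a) + μ (R a) = 2 * μ (R a) := (two_mul _).symm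
          _ = 2 * (μ A + μ (R a \ {x | Φ x < 2 * L})) := by
              rw [hA, measure_inter_add_sdiff _ hBm]
          _ = 2 * μ A + 2 * μ (R a \ {x | Φ x < 2 * L}) := mul_add _ _ _
          _ ≤ _ := by gcongr
      exact (ENNReal.add_le_add_iff_right (hRtop a haa)).1 h5
    have hA0 : μ A ≠ 0 := fun h0 => hR0 a haa (by simpa [h0] using hhalf)
    have hAtop : μ A ≠ ∞ := ((measure_mono inter_subset_left).trans_lt (hRtop a haa).lt_top).ne
    set ψ : X → ℂ := A.indicator fun _ => c a / (μ A).toReal with hψ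
    have hval : ‖c a / ((μ A).toReal : ℂ)‖ₑ = ‖c a‖ₑ / μ A := by
      rw [← ofReal_norm, norm_div, Complex.norm_real, Real.norm_of_nonneg ENNReal.toReal_nonneg,
        ENNReal.ofReal_div_of_pos (ENNReal.toReal_pos hA0 hAtop), ofReal_norm,
        ENNReal.ofReal_toReal hAtop]
    have hvalle : ‖c a‖ₑ / μ A ≤ 2 * ‖c a‖ₑ / μ (R a) := by
      rw [ENNReal.div_le_iff_le_mul (Or.inl hA0) (Or.inl hAtop), mul_comm 2, mul_div_assoc,
        mul_assoc]
      have : 1 ≤ 2 / μ (R a) * μ A := by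
        rw [ENNReal.mul_comm_div, ← mul_div_assoc,
          ENNReal.le_div_iff_mul_le (Or.inl (hR0 a haa)) (Or.inl (hRtop a haa)), one_mul]
        exact hhalf
      calc ‖c a‖ₑ = ‖c a‖ₑ * 1 := (mul_one _).symm
        _ ≤ _ := by gcongr
    have hψle : ∀ x, ‖ψ x‖ₑ ≤ ‖c a‖ₑ / μ A := fun x => by
      rw [hψ]
      by_cases hx : x ∈ A
      · rw [indicator_of_mem hx, hval]
      · rw [indicator_of_notMem hx]; simp
    refine ⟨Function.update φ a ψ, ?_, fun x => ?_⟩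
    · intro i hi
      rcases Finset.mem_insert.1 hi with rfl | hi
      · rw [Function.update_self]
        refine ⟨measurable_const.indicator hAm, ?_, ?_, ?_, fun x => (hψle x).trans hvalle⟩
        · exact support_indicator_subset.trans inter_subset_left
        · rw [hψ, integral_indicator hAm, setIntegral_const, Measure.real, Complex.real_smul,
            mul_div_cancel₀]
          exact_mod_cast (ENNReal.toReal_pos hA0 hAtop).ne'
        · have : ∀ x, ‖ψ x‖ₑ = A.indicator (fun _ => ‖c i‖ₑ / μ A) x := fun x => by
            rw [hψ]
            by_cases hx : x ∈ A
            · rw [indicator_of_mem hx, indicator_of_mem hx, hval]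
            · rw [indicator_of_notMem hx, indicator_of_notMem hx]; simp
          simp_rw [this]
          rw [lintegral_indicator_const hAm, ENNReal.div_mul_cancel hA0 hAtop]
      · rw [Function.update_of_ne (hne i hi)]
        exact hφ i hi
    · rw [Finset.sum_insert ha, Function.update_self]
      have heq : ∑ i ∈ s, ‖Function.update φ a ψ i x‖ₑ = Φ x :=
        Finset.sum_congr rfl fun i hi => by rw [Function.update_of_ne (hne i hi)]
      rw [heq]
      by_cases hx : x ∈ A
      · have h1 : ‖ψ x‖ₑ ≤ 2 * L := by
          refine ((hψle x).trans hvalle).trans ?_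
          rw [mul_div_assoc]
          gcongr
          rw [ENNReal.div_le_iff_le_mul (Or.inl (hR0 a haa)) (Or.inl (hRtop a haa))]
          exact hself a haa
        calc ‖ψ x‖ₑ + Φ x ≤ 2 * L + 2 * L := add_le_add h1 (le_of_lt hx.2)
          _ = 4 * L := by ring
      · rw [hψ, indicator_of_notMem hx, enorm_zero, zero_add]
        exact hsum x

end NonHom

namespace NonHom

open Set Metric Filter

variable {X : Type*} [MeasurableSpace X] {μ : Measure X}

lemma enorm_setIntegral_le (f : X → ℂ) (s : Set X) :
    ‖∫ x in s, f x ∂μ‖ₑ ≤ ∫⁻ x in s, ‖f x‖ₑ ∂μ := enorm_integral_le_lintegral_enorm _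

variable [MetricSpace X] {lam : X → ℝ → ℝ}
  {α γ ρ : ℝ} {β : ℝ≥0} {q : ℝ≥0∞}

/-- The Calderón–Zygmund decomposition at a height above the mean value of `|f|`. The part of `f`
on the selected balls is replaced by functions with the same integrals, spread over doubling
balls. Since `f` is bounded, its restrictions to the selected balls are multiples of bounded atoms.
Only finitely many balls are selected, which leaves a remainder on a small set `Z`. -/
lemma Admissible.exists_decomposition_of_lt [BorelSpace X] [SecondCountableTopology X] [Nonempty X]
    (h : Admissible μ lam α γ β) (hρ : 1 ≤ ρ) (hρα : 5 * ρ ≤ α) (hq : 1 < q)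
    {f : X → ℂ} (hf : Measurable f) {M ℓ : ℝ≥0} (hℓ : 0 < ℓ) (hℓM : ℓ ≤ M)
    (hfM : ∀ x, ‖f x‖ₑ ≤ M) (hfb : Bornology.IsBounded (Function.support f))
    (hlt : ∫⁻ x, ‖f x‖ₑ ∂μ < ((2 * β)⁻¹ * ℓ : ℝ≥0) * μ univ) (hfin : ∫⁻ x, ‖f x‖ₑ ∂μ ≠ ∞)
    {ε : ℝ≥0∞} (hε : ε ≠ 0) :
    ∃ (g b : X → ℂ) (Z : Set X), Measurable g ∧ MeasurableSet Z ∧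
      (∀ x, f x = g x + b x + Z.indicator f x) ∧ (∀ x, ‖g x‖ₑ ≤ 3 * ℓ) ∧
      ∫⁻ x, ‖g x‖ₑ ∂μ ≤ ∫⁻ x, ‖f x‖ₑ ∂μ ∧
      H1Le μ lam ρ q b ((4 * β * (1 + β) * (M / ℓ) : ℝ≥0) * ∫⁻ x, ‖f x‖ₑ ∂μ) ∧
      ∫⁻ x in Z, ‖f x‖ₑ ∂μ ≤ ε := by
  classical
  have hα := h.five_le
  have hαγ := h.alpha_le_gamma
  have h3 := h.three_mul_le
  have hβ : 0 < β := lt_of_lt_of_le one_pos h.one_le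
  have hM : 0 < M := hℓ.trans_le hℓM
  have hfint : Integrable f μ := ⟨hf.aestronglyMeasurable, hfin.lt_top⟩
  set τ : ℝ≥0 := (2 * β)⁻¹ with hτ
  have hτβ : τ * β = 2⁻¹ := by rw [hτ]; field_simp
  have hτpos : 0 < τ := by positivity
  set E : Set X := {x | (ℓ : ℝ≥0∞) < ‖f x‖ₑ} with hE
  have hEm : MeasurableSet E := measurableSet_lt measurable_const hf.enorm
  have hEsupp : E ⊆ Function.support f := fun x hx h0 => by
    simp [hE, h0] at hx
  have hEb : Bornology.IsBounded E := hfb.subset hEsupp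
  have hEfin : μ E ≠ ∞ := by
    obtain ⟨r, hr⟩ := hEb.subset_ball (Classical.arbitrary X)
    exact ((measure_mono hr).trans_lt (h.measure_ball_lt_top _ _)).ne
  set φ : X → ℝ≥0∞ := fun x => ‖f x‖ₑ with hφ
  -- density points of `E` are heavy for `|f|`
  have hheavy : ∀ x r, Heavy μ α (E.indicator 1) τ x r →
      Heavy μ α φ ((τ * ℓ : ℝ≥0) : ℝ≥0∞) x r := by
    intro x r hx
    have h1 : (ℓ : ℝ≥0∞) * ∫⁻ y in ball x r, E.indicator 1 y ∂μ ≤ ∫⁻ y in ball x r, φ y ∂μ := by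
      rw [← lintegral_const_mul _ (measurable_one.indicator hEm)]
      refine lintegral_mono fun y => ?_
      by_cases hy : y ∈ E
      · simpa [hy] using le_of_lt hy
      · simp [hy]
    refine lt_of_lt_of_le ?_ h1
    rw [Heavy] at hx
    have h2 := (ENNReal.mul_lt_mul_iff_right (a := (ℓ : ℝ≥0∞)) (by exact_mod_cast hℓ.ne')
      ENNReal.coe_ne_top).2 hx
    refine lt_of_eq_of_lt ?_ h2
    push_cast
    ring
  set D : Set X := {x | x ∈ E ∧ ∃ r, 0 < r ∧ Heavy μ α φ ((τ * ℓ : ℝ≥0) : ℝ≥0∞) x r} with hD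
  have hDE : μ (E \ D) = 0 := by
    have h1 := h.ae_heavy hEm hEfin (t := τ) (by
      rw [← ENNReal.coe_mul, hτβ]; simp)
    refine measure_mono_null (fun x hx => ?_) (ae_iff.1 h1)
    intro hcon
    obtain ⟨r, hr, hr'⟩ := hcon hx.1
    exact hx.2 ⟨hx.1, r, hr, hheavy x r hr'⟩
  obtain ⟨v, r, hv, hvd, hvZ⟩ := h.exists_balls (φ := φ) (t := ((τ * ℓ : ℝ≥0) : ℝ≥0∞))
    (by exact_mod_cast (mul_pos hτpos hℓ).ne') ENNReal.coe_ne_top hlt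
    (hEb.subset fun x hx => hx.1 : Bornology.IsBounded D) (fun x hx => hx.2)
    (ε := ε / M) (ENNReal.div_ne_zero.2 ⟨hε, ENNReal.coe_ne_top⟩)
  -- the enlarged balls and the doubling balls around them
  have hAex : ∀ i, ∃ A : Ball X, i ∈ v → A.center = i ∧ A.radius = 5 * r i := fun i => by
    by_cases hi : i ∈ v
    · exact ⟨⟨i, 5 * r i, by have := (hv i hi).1; positivity⟩, fun _ => ⟨rfl, rfl⟩⟩
    · exact ⟨⟨i, 1, one_pos⟩, fun h => absurd h hi⟩
  choose A hAc using hAex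
  have hAcarrier : ∀ i ∈ v, (A i).carrier = ball i (5 * r i) := fun i hi => by
    rw [Ball.carrier, (hAc i hi).1, (hAc i hi).2]
  have hA0 : ∀ i ∈ v, μ (A i).carrier ≠ 0 := by
    intro i hi h0
    obtain ⟨hri, hheavyi, -⟩ := hv i hi
    have : μ (ball i (r i)) = 0 := by
      refine measure_mono_null ?_ h0
      rw [hAcarrier i hi]
      exact ball_subset_ball (by linarith)
    rw [Heavy, setLIntegral_measure_zero _ _ this] at hheavyi
    exact absurd hheavyi not_lt_bot
  have hRex : ∀ i, ∃ R : Ball X, i ∈ v → R.center = i ∧ 5 * r i ≤ R.radius ∧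
      μ (R.dilate γ) ≤ β * μ R.carrier ∧ delta μ lam (A i) R ≤ β := fun i => by
    by_cases hi : i ∈ v
    · obtain ⟨R, hR1, hR2, hR3, hR4⟩ := h.exists_doubling_ge (A i) (hA0 i hi)
      refine ⟨R, fun _ => ⟨hR1.trans (hAc i hi).1, ?_, hR3, hR4⟩⟩
      rw [← (hAc i hi).2]; exact hR2
    · exact ⟨A i, fun h => absurd h hi⟩
  choose R hR using hRex
  have hRcarrier : ∀ i ∈ v, (R i).carrier = ball i (R i).radius := fun i hi => by
    rw [Ball.carrier, (hR i hi).1]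
  have hAR : ∀ i ∈ v, (A i).carrier ⊆ (R i).carrier := fun i hi => by
    rw [hAcarrier i hi, hRcarrier i hi]; exact ball_subset_ball (hR i hi).2.1
  have hR0 : ∀ i ∈ v, μ (R i).carrier ≠ 0 := fun i hi h0 =>
    hA0 i hi (measure_mono_null (hAR i hi) h0)
  have hRtop : ∀ i, μ (R i).carrier ≠ ∞ := fun i => (h.measure_ball_lt_top _ _).ne
  obtain ⟨P, hPm, hPA, hPd, hPU⟩ := exists_disjoint_subsets v (fun i => (A i).carrier)
    (fun i _ => (A i).measurableSet_carrier)
  set c : X → ℂ := fun i => ∫ x in P i, f x ∂μ with hc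
  have hcsum : ∀ w ⊆ v, ∑ i ∈ w, ‖c i‖ₑ ≤ ∫⁻ x in ⋃ i ∈ w, P i, φ x ∂μ := by
    intro w hw
    rw [lintegral_biUnion_finset (fun i hi j hj hij => hPd (hw hi) (hw hj) hij)
      (fun i hi => hPm i (hw hi))]
    exact Finset.sum_le_sum fun i _ => enorm_setIntegral_le _ _
  obtain ⟨ψ, hψ, hψsum⟩ := exists_spread (μ := μ) v (fun i => (R i).carrier)
    (fun i => (R i).radius) c (L := ((2⁻¹ * ℓ : ℝ≥0) : ℝ≥0∞)) ENNReal.coe_ne_top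
    (fun i _ => (R i).measurableSet_carrier) hR0 (fun i _ => hRtop i) (by
      intro k hk w hw hwk
      obtain ⟨hRk1, hRk2, hRk3, -⟩ := hR k hk
      obtain ⟨hrk, -, hnot⟩ := hv k hk
      -- the smaller balls that meet `R k` lie in `3 R k`, whose centre is not heavy at that radius
      have hsub : ⋃ i ∈ w, P i ⊆ ball k (3 * (R k).radius) := by
        refine iUnion₂_subset fun i hi => ((hPA i (hw hi)).trans (hAR i (hw hi))).trans ?_
        obtain ⟨hle, z, hzi, hzk⟩ := hwk i hi
        rw [hRcarrier i (hw hi)] at hzi ⊢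
        rw [hRcarrier k hk] at hzk
        refine ball_subset_ball' ?_
        have h1 := mem_ball'.1 hzi
        have h2 := mem_ball.1 hzk
        have h3 := dist_triangle i z k
        linarith
      calc ∑ i ∈ w, ‖c i‖ₑ ≤ ∫⁻ x in ⋃ i ∈ w, P i, φ x ∂μ := hcsum w hw
        _ ≤ ∫⁻ x in ball k (3 * (R k).radius), φ x ∂μ := lintegral_mono_set hsub
        _ ≤ (τ * ℓ : ℝ≥0) * μ (ball k (α * (3 * (R k).radius))) :=
            not_lt.1 (hnot _ (by linarith))
        _ ≤ (τ * ℓ : ℝ≥0) * μ ((R k).dilate γ) := by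
            gcongr
            rw [Ball.dilate, hRk1]
            refine ball_subset_ball ?_
            have := (R k).radius_pos
            nlinarith
        _ ≤ (τ * ℓ : ℝ≥0) * (β * μ (R k).carrier) := by gcongr
        _ = ((τ * β * ℓ : ℝ≥0) : ℝ≥0∞) * μ (R k).carrier := by push_cast; ring
        _ = _ := by rw [hτβ])
  set S : Set X := ⋃ i ∈ v, (A i).carrier with hS
  have hSm : MeasurableSet S :=
    Finset.measurableSet_biUnion _ fun i _ => (A i).measurableSet_carrier
  set g : X → ℂ := fun x => (S ∪ E)ᶜ.indicator f x + ∑ i ∈ v, ψ i x with hg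
  have hunion : ∀ x, S.indicator f x = ∑ i ∈ v, (P i).indicator f x := fun x => by
    rw [← hPU, Finset.indicator_biUnion v P hPd]
  refine ⟨g, ∑ i ∈ v, ((P i).indicator f + -ψ i), E \ S, ?_, hEm.diff hSm, ?_, ?_, ?_,
    ?_, ?_⟩
  · exact (hf.indicator (hSm.union hEm).compl).add
      (Finset.measurable_fun_sum _ fun i hi => (hψ i hi).1)
  · intro x
    rw [Finset.sum_apply]
    simp only [Pi.add_apply, Pi.neg_apply]
    rw [Finset.sum_add_distrib, ← hunion, Finset.sum_neg_distrib, hg]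
    by_cases hxS : x ∈ S
    · simp [hxS]
    · by_cases hxE : x ∈ E
      · simp [hxS, hxE]
      · simp [hxS, hxE]
  · intro x
    have h1 : ‖(S ∪ E)ᶜ.indicator f x‖ₑ ≤ ℓ := by
      by_cases hx : x ∈ (S ∪ E)ᶜ
      · rw [indicator_of_mem hx]
        exact not_lt.1 fun hxE => hx (Or.inr hxE)
      · rw [indicator_of_notMem hx]; simp
    calc ‖g x‖ₑ ≤ ‖(S ∪ E)ᶜ.indicator f x‖ₑ + ‖∑ i ∈ v, ψ i x‖ₑ := enorm_add_le _ _
      _ ≤ ℓ + ∑ i ∈ v, ‖ψ i x‖ₑ := add_le_add h1 (enorm_sum_le _ _)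
      _ ≤ ℓ + 4 * ((2⁻¹ * ℓ : ℝ≥0) : ℝ≥0∞) := by gcongr; exact hψsum x
      _ = ((ℓ + 4 * (2⁻¹ * ℓ) : ℝ≥0) : ℝ≥0∞) := by push_cast; rfl
      _ = ((3 * ℓ : ℝ≥0) : ℝ≥0∞) := by
          congr 1
          rw [← NNReal.coe_inj]; push_cast; ring
      _ = 3 * ℓ := by push_cast; rfl
  · calc ∫⁻ x, ‖g x‖ₑ ∂μ
        ≤ ∫⁻ x, (‖(S ∪ E)ᶜ.indicator f x‖ₑ + ∑ i ∈ v, ‖ψ i x‖ₑ) ∂μ := by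
          refine lintegral_mono fun x => (enorm_add_le _ _).trans ?_
          gcongr
          exact enorm_sum_le _ _
      _ = ∫⁻ x in (S ∪ E)ᶜ, φ x ∂μ + ∑ i ∈ v, ∫⁻ x, ‖ψ i x‖ₑ ∂μ := by
          rw [lintegral_add_left (hf.indicator (hSm.union hEm).compl).enorm,
            lintegral_finsetSum' _ fun i hi => (hψ i hi).1.enorm.aemeasurable,
            ← lintegral_indicator (hSm.union hEm).compl]
          congr 2 with x
          rw [enorm_indicator_eq_indicator_enorm]
      _ ≤ ∫⁻ x in Sᶜ, φ x ∂μ + ∑ i ∈ v, ‖c i‖ₑ := by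
          refine add_le_add (lintegral_mono_set (compl_subset_compl.2 subset_union_left))
            (Finset.sum_le_sum fun i hi => (hψ i hi).2.2.2.1)
      _ ≤ ∫⁻ x in Sᶜ, φ x ∂μ + ∫⁻ x in S, φ x ∂μ := by
          gcongr
          rw [← hPU]
          exact hcsum v Subset.rfl
      _ = _ := by rw [add_comm]; exact lintegral_add_compl _ hSm
  · -- each summand is an atomic block supported in the doubling ball `R i`
    have hmass : ∀ i ∈ v, ∃ w : ℝ≥0∞, w ≠ ∞ ∧
        w ≤ (M * (2 * β / ℓ) * (1 + β) : ℝ≥0) * ∫⁻ x in ball i (r i), φ x ∂μ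
          + (2 * β * (1 + β) : ℝ≥0) * ‖c i‖ₑ ∧
        H1Le μ lam ρ q ((P i).indicator f + -ψ i) w := by
      intro i hi
      obtain ⟨hψm, hψs, hψint, hψint', hψb⟩ := hψ i hi
      obtain ⟨hRi1, hRi2, hRi3, hRi4⟩ := hR i hi
      obtain ⟨hri, hheavyi, -⟩ := hv i hi
      have hK : 2 * ‖c i‖ₑ / μ (R i).carrier ≠ ∞ :=
        ENNReal.div_ne_top (ENNReal.mul_ne_top (by simp) enorm_ne_top) (hR0 i hi)
      have hψi : Integrable (ψ i) μ :=
        ⟨hψm.aestronglyMeasurable, hψint'.trans_lt enorm_lt_top⟩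
      refine ⟨_, ?_, ?_, H1Le.of_add (K₁ := M) (K₂ := (2 * ‖c i‖ₑ / μ (R i).carrier).toNNReal)
        h.measure_ball_lt_top hρ (hAR i hi) Subset.rfl hRi4
        (h.delta_self_le (R i)) (hA0 i hi) (hR0 i hi)
        (hf.indicator (hPm i hi)).aestronglyMeasurable hψm.neg.aestronglyMeasurable
        (support_indicator_subset.trans (hPA i hi)) ?_ ?_ ?_ ?_⟩
      · refine ENNReal.mul_ne_top (ENNReal.add_ne_top.2 ⟨?_, ?_⟩) ?_
        · exact ENNReal.mul_ne_top ENNReal.coe_ne_top (h.measure_ball_lt_top _ _).ne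
        · exact ENNReal.mul_ne_top ENNReal.coe_ne_top (h.measure_ball_lt_top _ _).ne
        · exact ENNReal.add_ne_top.2 ⟨ENNReal.one_ne_top, ENNReal.coe_ne_top⟩
      · have h1 : μ ((A i).dilate ρ) ≤ (2 * β / ℓ : ℝ≥0) * ∫⁻ x in ball i (r i), φ x ∂μ := by
          calc μ ((A i).dilate ρ) ≤ μ (ball i (α * r i)) := by
                refine measure_mono ?_
                rw [Ball.dilate, (hAc i hi).1, (hAc i hi).2]
                exact ball_subset_ball (by nlinarith)
            _ = ((2 * β / ℓ * (τ * ℓ) : ℝ≥0) : ℝ≥0∞) * μ (ball i (α * r i)) := by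
                have : 2 * β / ℓ * (τ * ℓ) = 1 := by rw [hτ]; field_simp
                rw [this]; simp
            _ = (2 * β / ℓ : ℝ≥0) * ((τ * ℓ : ℝ≥0) * μ (ball i (α * r i))) := by
                rw [ENNReal.coe_mul, mul_assoc]
            _ ≤ _ := by
                gcongr
                exact hheavyi.le
        have h2 : ((2 * ‖c i‖ₑ / μ (R i).carrier).toNNReal : ℝ≥0∞) * μ ((R i).dilate ρ)
            ≤ 2 * β * ‖c i‖ₑ := by
          rw [ENNReal.coe_toNNReal hK]
          calc _ ≤ 2 * ‖c i‖ₑ / μ (R i).carrier * (β * μ (R i).carrier) := by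
                gcongr
                refine le_trans (measure_mono (ball_subset_ball ?_)) hRi3
                have := (R i).radius_pos
                gcongr
                linarith
            _ = β * (2 * ‖c i‖ₑ / μ (R i).carrier * μ (R i).carrier) := by ring
            _ = β * (2 * ‖c i‖ₑ) := by
                rw [ENNReal.div_mul_cancel (hR0 i hi) (hRtop i)]
            _ = _ := by ring
        calc _ ≤ (M * ((2 * β / ℓ : ℝ≥0) * ∫⁻ x in ball i (r i), φ x ∂μ) + 2 * β * ‖c i‖ₑ) *
              (1 + β) := by gcongr
          _ = _ := by push_cast; ring
      · rw [Function.support_neg]; exact hψs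
      · intro x
        by_cases hx : x ∈ P i
        · rw [indicator_of_mem hx]; exact hfM x
        · rw [indicator_of_notMem hx]; simp
      · intro x
        rw [Pi.neg_apply, enorm_neg, ENNReal.coe_toNNReal hK]
        exact hψb x
      · rw [integral_add (hfint.indicator (hPm i hi)) hψi.neg, integral_neg', hψint,
          integral_indicator (hPm i hi)]
        simp [hc]
    have hex : ∀ i, ∃ w : ℝ≥0∞, i ∈ v → w ≠ ∞ ∧
        w ≤ (M * (2 * β / ℓ) * (1 + β) : ℝ≥0) * ∫⁻ x in ball i (r i), φ x ∂μ
          + (2 * β * (1 + β) : ℝ≥0) * ‖c i‖ₑ ∧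
        H1Le μ lam ρ q ((P i).indicator f + -ψ i) w := fun i => by
      by_cases hi : i ∈ v
      · obtain ⟨w, hw⟩ := hmass i hi
        exact ⟨w, fun _ => hw⟩
      · exact ⟨0, fun h => absurd h hi⟩
    choose w hw using hex
    refine (H1Le.sum h.measure_ball_lt_top hρ hq v (fun i hi => (hw i hi).1)
      (fun i hi => (hw i hi).2.2)).mono ?_
    have hballs : ∑ i ∈ v, ∫⁻ x in ball i (r i), φ x ∂μ ≤ ∫⁻ x, φ x ∂μ := by
      rw [← lintegral_biUnion_finset hvd (fun i _ => measurableSet_ball)]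
      exact setLIntegral_le_lintegral _ _
    have hcs : ∑ i ∈ v, ‖c i‖ₑ ≤ ∫⁻ x, φ x ∂μ :=
      (hcsum v Subset.rfl).trans (setLIntegral_le_lintegral _ _)
    calc ∑ i ∈ v, w i ≤ ∑ i ∈ v, ((M * (2 * β / ℓ) * (1 + β) : ℝ≥0) *
          ∫⁻ x in ball i (r i), φ x ∂μ + (2 * β * (1 + β) : ℝ≥0) * ‖c i‖ₑ) :=
          Finset.sum_le_sum fun i hi => (hw i hi).2.1
      _ = (M * (2 * β / ℓ) * (1 + β) : ℝ≥0) * ∑ i ∈ v, ∫⁻ x in ball i (r i), φ x ∂μ +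
          (2 * β * (1 + β) : ℝ≥0) * ∑ i ∈ v, ‖c i‖ₑ := by
          rw [Finset.sum_add_distrib, Finset.mul_sum, Finset.mul_sum]
      _ ≤ (M * (2 * β / ℓ) * (1 + β) : ℝ≥0) * ∫⁻ x, φ x ∂μ +
          (2 * β * (1 + β) : ℝ≥0) * ∫⁻ x, φ x ∂μ := by gcongr
      _ = ((M * (2 * β / ℓ) * (1 + β) + 2 * β * (1 + β) : ℝ≥0) : ℝ≥0∞) * ∫⁻ x, φ x ∂μ := by
          rw [← add_mul]; push_cast; rfl
      _ ≤ _ := by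
          gcongr
          have h1 : 1 ≤ M / ℓ := (one_le_div hℓ).2 hℓM
          calc M * (2 * β / ℓ) * (1 + β) + 2 * β * (1 + β)
              = 2 * β * (1 + β) * (M / ℓ) + 2 * β * (1 + β) * 1 := by ring
            _ ≤ 2 * β * (1 + β) * (M / ℓ) + 2 * β * (1 + β) * (M / ℓ) := by gcongr
            _ = _ := by ring
  · have hZ : μ (E \ S) ≤ ε / M := by
      have hSv : S = ⋃ i ∈ v, ball i (5 * r i) := iUnion₂_congr hAcarrier
      calc μ (E \ S) ≤ μ ((E \ D) ∪ (D \ S)) := by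
            refine measure_mono fun x hx => ?_
            by_cases hxD : x ∈ D
            · exact Or.inr ⟨hxD, hx.2⟩
            · exact Or.inl ⟨hx.1, hxD⟩
        _ ≤ μ (E \ D) + μ (D \ S) := measure_union_le _ _
        _ ≤ 0 + ε / M := by
            rw [hDE, hSv]
            gcongr
        _ = _ := zero_add _
    calc ∫⁻ x in E \ S, ‖f x‖ₑ ∂μ ≤ ∫⁻ _ in E \ S, (M : ℝ≥0∞) ∂μ := lintegral_mono hfM
      _ = M * μ (E \ S) := by rw [setLIntegral_const]
      _ ≤ M * (ε / M) := by gcongr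
      _ ≤ ε := ENNReal.mul_div_le

end NonHom

namespace NonHom

open Set Metric Filter

variable {X : Type*} [MeasurableSpace X] {μ : Measure X}

lemma exists_measurable_bounded_rep {f : X → ℂ} (hf : AEStronglyMeasurable f μ) {M : ℝ≥0∞}
    (hM : ∀ᵐ x ∂μ, ‖f x‖ₑ ≤ M) :
    ∃ f' : X → ℂ, Measurable f' ∧ f =ᵐ[μ] f' ∧ ∀ x, ‖f' x‖ₑ ≤ M := by
  have hm : Measurable (hf.mk f) := hf.stronglyMeasurable_mk.measurable
  refine ⟨{x | ‖hf.mk f x‖ₑ ≤ M}.indicator (hf.mk f), hm.indicator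
    (measurableSet_le hm.enorm measurable_const), ?_, fun x => ?_⟩
  · filter_upwards [hf.ae_eq_mk, hM] with x hx hxM
    rw [indicator_of_mem, hx]
    rwa [mem_ofPred_eq, ← hx]
  · by_cases hx : x ∈ {x | ‖hf.mk f x‖ₑ ≤ M}
    · rw [indicator_of_mem hx]; exact hx
    · rw [indicator_of_notMem hx]; simp

variable [MetricSpace X] {lam : X → ℝ → ℝ}
  {α γ ρ : ℝ} {β : ℝ≥0} {q : ℝ≥0∞}

/-- The decomposition at a height below the mean value of `|f|`, in a space of finite measure: `f`
differs by one atomic block from a constant multiple of the indicator of a large ball. -/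
lemma Admissible.exists_decomposition_of_ge [BorelSpace X] [Nonempty X]
    (h : Admissible μ lam α γ β) (hρ : 1 ≤ ρ)
    {f : X → ℂ} (hf : Measurable f) {M ℓ : ℝ≥0} (hℓ : 0 < ℓ) (hℓM : ℓ ≤ M)
    (hfM : ∀ x, ‖f x‖ₑ ≤ M) (hfb : Bornology.IsBounded (Function.support f))
    (hge : ((2 * β)⁻¹ * ℓ : ℝ≥0) * μ univ ≤ ∫⁻ x, ‖f x‖ₑ ∂μ) (hfin : ∫⁻ x, ‖f x‖ₑ ∂μ ≠ ∞)
    (hμ0 : μ univ ≠ 0) :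
    ∃ g b : X → ℂ, Measurable g ∧ (∀ x, f x = g x + b x) ∧
      (∀ x, ‖g x‖ₑ ≤ 2 * ((∫⁻ x, ‖f x‖ₑ ∂μ) / μ univ)) ∧
      ∫⁻ x, ‖g x‖ₑ ∂μ ≤ ∫⁻ x, ‖f x‖ₑ ∂μ ∧
      H1Le μ lam ρ q b ((4 * β * (1 + β) * (M / ℓ) : ℝ≥0) * ∫⁻ x, ‖f x‖ₑ ∂μ) := by
  have hβ1 := h.one_le
  have hβ : 0 < β := lt_of_lt_of_le one_pos h.one_le
  set N := ∫⁻ x, ‖f x‖ₑ ∂μ with hN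
  have hμtop : μ univ ≠ ∞ := by
    intro htop
    rw [htop, ENNReal.mul_top (by exact_mod_cast (by positivity : (2 * β)⁻¹ * ℓ ≠ 0)),
      top_le_iff] at hge
    exact hfin hge
  have hμN : μ univ ≤ (2 * β / ℓ : ℝ≥0) * N := by
    calc μ univ = ((2 * β / ℓ * ((2 * β)⁻¹ * ℓ) : ℝ≥0) : ℝ≥0∞) * μ univ := by
          have : 2 * β / ℓ * ((2 * β)⁻¹ * ℓ) = 1 := by field_simp
          rw [this]; simp
      _ = (2 * β / ℓ : ℝ≥0) * (((2 * β)⁻¹ * ℓ : ℝ≥0) * μ univ) := by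
          rw [ENNReal.coe_mul, mul_assoc]
      _ ≤ _ := by gcongr
  -- a large ball carrying half of the measure and containing the support
  obtain ⟨x₀⟩ := ‹Nonempty X›
  have : Nonempty X := ⟨x₀⟩
  obtain ⟨R, hR⟩ := hfb.subset_ball x₀
  obtain ⟨n, hnR, hn⟩ : ∃ n : ℕ, max R 1 < n ∧ μ univ / 2 < μ (ball x₀ n) := by
    have hlim : Tendsto (fun n : ℕ => μ (ball x₀ n)) atTop (nhds (μ univ)) := by
      rw [← iUnion_ball_nat x₀]
      exact tendsto_measure_iUnion_atTop fun m n hmn => ball_subset_ball (by exact_mod_cast hmn)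
    have h1 := hlim.eventually (lt_mem_nhds (ENNReal.half_lt_self hμ0 hμtop))
    have h2 := (tendsto_natCast_atTop_atTop (R := ℝ)).eventually_gt_atTop (max R 1)
    exact (h2.and h1).exists
  let B : Ball X := ⟨x₀, n, by linarith [le_max_right R 1]⟩
  have hBc : B.carrier = ball x₀ n := rfl
  have hB0 : μ B.carrier ≠ 0 := (bot_le.trans_lt hn).ne'
  have hBtop : μ B.carrier ≠ ∞ := (h.measure_ball_lt_top _ _).ne
  have hsupp : Function.support f ⊆ B.carrier :=
    hR.trans (ball_subset_ball ((le_max_left _ _).trans hnR.le))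
  have hfint : Integrable f μ := ⟨hf.aestronglyMeasurable, hfin.lt_top⟩
  have hBm : MeasurableSet B.carrier := B.measurableSet_carrier
  set c : ℂ := ∫ x, f x ∂μ with hc
  have hcN : ‖c‖ₑ ≤ N := enorm_integral_le_lintegral_enorm _
  have hval : ‖c / ((μ B.carrier).toReal : ℂ)‖ₑ = ‖c‖ₑ / μ B.carrier := by
    rw [← ofReal_norm, norm_div, Complex.norm_real, Real.norm_of_nonneg ENNReal.toReal_nonneg,
      ENNReal.ofReal_div_of_pos (ENNReal.toReal_pos hB0 hBtop), ofReal_norm,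
      ENNReal.ofReal_toReal hBtop]
  have hvalle : ‖c‖ₑ / μ B.carrier ≤ 2 * (N / μ univ) := by
    calc ‖c‖ₑ / μ B.carrier ≤ N / (μ univ / 2) := ENNReal.div_le_div hcN hn.le
      _ = 2 * (N / μ univ) := by
          rw [div_eq_mul_inv, ENNReal.inv_div (Or.inl (by simp)) (Or.inl (by simp)),
            div_eq_mul_inv, div_eq_mul_inv]
          ring
  set g : X → ℂ := B.carrier.indicator fun _ => c / (μ B.carrier).toReal with hg
  have hgle : ∀ x, ‖g x‖ₑ ≤ ‖c‖ₑ / μ B.carrier := fun x => by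
    rw [hg]
    by_cases hx : x ∈ B.carrier
    · rw [indicator_of_mem hx, hval]
    · rw [indicator_of_notMem hx]; simp
  have hgm : Measurable g := measurable_const.indicator hBm
  have hgint : ∫ x, g x ∂μ = c := by
    rw [hg, integral_indicator hBm, setIntegral_const, Measure.real, Complex.real_smul,
      mul_div_cancel₀]
    exact_mod_cast (ENNReal.toReal_pos hB0 hBtop).ne'
  have hgL1 : ∫⁻ x, ‖g x‖ₑ ∂μ ≤ N := by
    calc ∫⁻ x, ‖g x‖ₑ ∂μ = ∫⁻ x, B.carrier.indicator (fun _ => ‖c‖ₑ / μ B.carrier) x ∂μ := by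
          congr 1 with x
          by_cases hx : x ∈ B.carrier
          · rw [hg, indicator_of_mem hx, indicator_of_mem hx, hval]
          · rw [hg, indicator_of_notMem hx, indicator_of_notMem hx]; simp
      _ = ‖c‖ₑ := by
          rw [lintegral_indicator_const hBm, ENNReal.div_mul_cancel hB0 hBtop]
      _ ≤ N := hcN
  have hK : ‖c‖ₑ / μ B.carrier ≠ ∞ := ENNReal.div_ne_top enorm_ne_top hB0
  refine ⟨g, f + -g, hgm, fun x => ?_, fun x => (hgle x).trans hvalle, hgL1, ?_⟩
  · simp
  · refine (H1Le.of_add (K₁ := M) (K₂ := (‖c‖ₑ / μ B.carrier).toNNReal)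
      h.measure_ball_lt_top hρ (A₁ := B) (A₂ := B) (B := B) Subset.rfl Subset.rfl
      (h.delta_self_le B) (h.delta_self_le B) hB0 hB0 hf.aestronglyMeasurable
      hgm.neg.aestronglyMeasurable hsupp ?_ hfM ?_ ?_).mono ?_
    · rw [Function.support_neg]; exact support_indicator_subset
    · intro x
      rw [Pi.neg_apply, enorm_neg, ENNReal.coe_toNNReal hK]
      exact hgle x
    · rw [integral_add hfint ?_, integral_neg', hgint, hc, add_neg_cancel]
      exact (Integrable.neg ⟨hgm.aestronglyMeasurable, hgL1.trans_lt hfin.lt_top⟩)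
    · rw [ENNReal.coe_toNNReal hK]
      calc (M * μ (B.dilate ρ) + ‖c‖ₑ / μ B.carrier * μ (B.dilate ρ)) * (1 + β)
          ≤ (M * ((2 * β / ℓ : ℝ≥0) * N) + 2 * (N / μ univ) * μ univ) * (1 + β) := by
            gcongr
            · exact (measure_mono (subset_univ (B.dilate ρ))).trans hμN
            · exact subset_univ _
        _ = (M * ((2 * β / ℓ : ℝ≥0) * N) + 2 * N) * (1 + β) := by
            rw [mul_assoc 2, ENNReal.div_mul_cancel hμ0 hμtop]
        _ = (((M * (2 * β / ℓ) + 2) * (1 + β) : ℝ≥0) : ℝ≥0∞) * N := by push_cast; ring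
        _ ≤ _ := by
            refine mul_le_mul_left (ENNReal.coe_le_coe.2 ?_) _
            have h1 : 1 ≤ M / ℓ := (one_le_div hℓ).2 hℓM
            calc (M * (2 * β / ℓ) + 2) * (1 + β)
                = 2 * β * (1 + β) * (M / ℓ) + 2 * 1 * (1 + β) * 1 := by ring
              _ ≤ 2 * β * (1 + β) * (M / ℓ) + 2 * β * (1 + β) * (M / ℓ) := by gcongr
              _ = _ := by ring

/-- A bounded integrable function is the sum of a function of smaller supremum norm, an element of
the Hardy space, and a remainder of small `L¹`-norm. -/
lemma Admissible.exists_decomposition_add [BorelSpace X] [SecondCountableTopology X] [Nonempty X]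
    (h : Admissible μ lam α γ β) (hρ : 1 ≤ ρ) (hρα : 5 * ρ ≤ α) (hq : 1 < q)
    {f : X → ℂ} (hf : Measurable f) {M ℓ : ℝ≥0} (hℓ : 0 < ℓ) (hℓM : ℓ ≤ M)
    (hfM : ∀ x, ‖f x‖ₑ ≤ M) (hfin : ∫⁻ x, ‖f x‖ₑ ∂μ ≠ ∞) {ε : ℝ≥0∞} (hε : ε ≠ 0) :
    ∃ (g b : X → ℂ) (Z : Set X), Measurable g ∧ MeasurableSet Z ∧
      (∀ x, f x = g x + b x + Z.indicator f x) ∧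
      (∀ x, ‖g x‖ₑ ≤ 3 * (ℓ + (∫⁻ x, ‖f x‖ₑ ∂μ) / μ univ)) ∧
      ∫⁻ x, ‖g x‖ₑ ∂μ ≤ ∫⁻ x, ‖f x‖ₑ ∂μ ∧
      H1Le μ lam ρ q b ((4 * β * (1 + β) * (M / ℓ) : ℝ≥0) * ∫⁻ x, ‖f x‖ₑ ∂μ) ∧
      ∫⁻ x in Z, ‖f x‖ₑ ∂μ ≤ ε := by
  rcases eq_or_ne (μ univ) 0 with hμ0 | hμ0
  · refine ⟨0, 0, univ, measurable_const, MeasurableSet.univ, by simp, by simp, by simp,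
      H1Le.zero _, ?_⟩
    rw [Measure.measure_univ_eq_zero.1 hμ0]; simp
  set x₀ : X := Classical.arbitrary X
  -- cut off `f` outside a large ball
  obtain ⟨n, hn⟩ : ∃ n : ℕ, ∫⁻ x in (ball x₀ n)ᶜ, ‖f x‖ₑ ∂μ ≤ ε / 2 := by
    have hfinite : IsFiniteMeasure (μ.withDensity fun x => ‖f x‖ₑ) :=
      isFiniteMeasure_withDensity hfin
    have hlim := tendsto_measure_iInter_atTop (μ := μ.withDensity fun x => ‖f x‖ₑ)
      (s := fun n : ℕ => (ball x₀ n)ᶜ) (fun n => measurableSet_ball.compl.nullMeasurableSet)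
      (fun m n hmn => compl_subset_compl.2 (ball_subset_ball (by exact_mod_cast hmn)))
      ⟨0, measure_ne_top _ _⟩
    rw [← compl_iUnion, iUnion_ball_nat, compl_univ, measure_empty] at hlim
    obtain ⟨n, hn⟩ := (hlim.eventually (ge_mem_nhds
      (pos_iff_ne_zero.2 (ENNReal.half_pos hε).ne'))).exists
    rw [Function.comp_apply, withDensity_apply _ measurableSet_ball.compl] at hn
    exact ⟨n, hn⟩
  set B := ball x₀ n with hB
  set f' := B.indicator f with hf'
  have hle : ∀ x, ‖f' x‖ₑ ≤ ‖f x‖ₑ := fun x => by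
    rw [hf', enorm_indicator_eq_indicator_enorm]; exact indicator_le_self _ _ _
  have hN' : ∫⁻ x, ‖f' x‖ₑ ∂μ ≤ ∫⁻ x, ‖f x‖ₑ ∂μ := lintegral_mono hle
  have hf'm : Measurable f' := hf.indicator measurableSet_ball
  have hf'fin : ∫⁻ x, ‖f' x‖ₑ ∂μ ≠ ∞ := (hN'.trans_lt hfin.lt_top).ne
  have hsupp : Bornology.IsBounded (Function.support f') :=
    isBounded_ball.subset support_indicator_subset
  have key : ∃ (g b : X → ℂ) (Z : Set X), Measurable g ∧ MeasurableSet Z ∧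
      (∀ x, f' x = g x + b x + Z.indicator f' x) ∧
      (∀ x, ‖g x‖ₑ ≤ 3 * (ℓ + (∫⁻ x, ‖f' x‖ₑ ∂μ) / μ univ)) ∧
      ∫⁻ x, ‖g x‖ₑ ∂μ ≤ ∫⁻ x, ‖f' x‖ₑ ∂μ ∧
      H1Le μ lam ρ q b ((4 * β * (1 + β) * (M / ℓ) : ℝ≥0) * ∫⁻ x, ‖f' x‖ₑ ∂μ) ∧
      ∫⁻ x in Z, ‖f' x‖ₑ ∂μ ≤ ε / 2 := by
    rcases lt_or_ge (∫⁻ x, ‖f' x‖ₑ ∂μ) (((2 * β)⁻¹ * ℓ : ℝ≥0) * μ univ) with hlt | hge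
    · obtain ⟨g, b, Z, h1, h2, h3, h4, h5, h6, h7⟩ := h.exists_decomposition_of_lt hρ hρα hq hf'm hℓ
        hℓM (fun x => (hle x).trans (hfM x)) hsupp hlt hf'fin (ENNReal.half_pos hε).ne'
      exact ⟨g, b, Z, h1, h2, h3, fun x => (h4 x).trans (by gcongr; exact le_self_add), h5, h6, h7⟩
    · obtain ⟨g, b, h1, h2, h3, h4, h5⟩ := h.exists_decomposition_of_ge (q := q) hρ hf'm hℓ
        hℓM (fun x => (hle x).trans (hfM x)) hsupp hge hf'fin hμ0
      refine ⟨g, b, ∅, h1, MeasurableSet.empty, by simpa using h2, fun x => (h3 x).trans ?_, h4,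
        h5, by simp⟩
      gcongr
      · norm_num
      · exact le_add_self
  obtain ⟨g, b, Z, h1, h2, h3, h4, h5, h6, h7⟩ := key
  refine ⟨g, b, (Z ∩ B) ∪ Bᶜ, h1, (h2.inter measurableSet_ball).union measurableSet_ball.compl,
    fun x => ?_, fun x => (h4 x).trans (by gcongr), h5.trans hN', h6.mono (by gcongr), ?_⟩
  · have := h3 x
    by_cases hxB : x ∈ B
    · by_cases hxZ : x ∈ Z <;> simpa [hf', hxB, hxZ] using this
    · by_cases hxZ : x ∈ Z <;> simpa [hf', hxB, hxZ] using this.symm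
  · have hZ : ∫⁻ x in Z ∩ B, ‖f x‖ₑ ∂μ = ∫⁻ x in Z, ‖f' x‖ₑ ∂μ := by
      have : ∀ x, ‖f' x‖ₑ = B.indicator (fun x => ‖f x‖ₑ) x := fun x =>
        enorm_indicator_eq_indicator_enorm _ _
      simp_rw [this]
      rw [lintegral_indicator measurableSet_ball, Measure.restrict_restrict measurableSet_ball,
        inter_comm]
    calc _ ≤ ∫⁻ x in Z ∩ B, ‖f x‖ₑ ∂μ + ∫⁻ x in Bᶜ, ‖f x‖ₑ ∂μ := lintegral_union_le _ _ _
      _ ≤ ε / 2 + ε / 2 := add_le_add (hZ.trans_le h7) hn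
      _ = ε := ENNReal.add_halves ε

/-! ### Lowering the supremum norm -/

/-- `f` is the sum of a function bounded by `a`, of `L¹`-norm at most `m`, and of an element of the
Hardy space of size at most `w`. -/
def HasDecomposition (μ : Measure X) (lam : X → ℝ → ℝ) (ρ : ℝ) (q : ℝ≥0∞) (f : X → ℂ)
    (a m w : ℝ≥0∞) : Prop :=
  ∃ g b : X → ℂ, AEStronglyMeasurable g μ ∧ (∀ᵐ x ∂μ, f x = g x + b x) ∧
    (∀ᵐ x ∂μ, ‖g x‖ₑ ≤ a) ∧ ∫⁻ x, ‖g x‖ₑ ∂μ ≤ m ∧ H1Le μ lam ρ q b w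

lemma HasDecomposition.mono {f : X → ℂ} {a m w a' m' w' : ℝ≥0∞}
    (hf : HasDecomposition μ lam ρ q f a m w) (ha : a ≤ a') (hm : m ≤ m') (hw : w ≤ w') :
    HasDecomposition μ lam ρ q f a' m' w' := by
  obtain ⟨g, b, h1, h2, h3, h4, h5⟩ := hf
  exact ⟨g, b, h1, h2, h3.mono fun x hx => hx.trans ha, h4.trans hm, h5.mono hw⟩

lemma HasDecomposition.congr {f f' : X → ℂ} {a m w : ℝ≥0∞}
    (hf : HasDecomposition μ lam ρ q f a m w) (he : f =ᵐ[μ] f') :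
    HasDecomposition μ lam ρ q f' a m w := by
  obtain ⟨g, b, h1, h2, h3, h4, h5⟩ := hf
  exact ⟨g, b, h1, by filter_upwards [h2, he] with x hx hex; rw [← hex, hx], h3, h4, h5⟩

lemma HasDecomposition.of_le [Nonempty X] {f : X → ℂ} (hf : AEStronglyMeasurable f μ) {a m : ℝ≥0∞}
    (ha : ∀ᵐ x ∂μ, ‖f x‖ₑ ≤ a) (hm : ∫⁻ x, ‖f x‖ₑ ∂μ ≤ m) (w : ℝ≥0∞) :
    HasDecomposition μ lam ρ q f a m w :=
  ⟨f, 0, hf, by simp, ha, hm, H1Le.zero _⟩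

lemma tsum_two_inv_pow : ∑' n : ℕ, (2⁻¹ : ℝ≥0∞) ^ n = 2 := by
  rw [ENNReal.tsum_geometric, ENNReal.one_sub_inv_two, inv_inv]

/-- Decompositions can be added up. -/
lemma HasDecomposition.tsum [OpensMeasurableSpace X] (hfin : ∀ x r, μ (ball x r) < ∞) (hρ : 1 ≤ ρ)
    (hq : 1 < q) {d : ℕ → X → ℂ} {f : X → ℂ} {a m w : ℕ → ℝ≥0∞} {A N W : ℝ≥0∞}
    (hd : ∀ n, HasDecomposition μ lam ρ q (d n) (a n) (m n) (w n)) (hA : ∑' n, a n ≤ A)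
    (hAtop : A ≠ ∞) (hN : ∑' n, m n ≤ N) (hW : ∑' n, w n ≤ W) (hWtop : W ≠ ∞)
    (hf : ∀ᵐ x ∂μ, Tendsto (fun n => ∑ i ∈ Finset.range n, d i x) atTop (nhds (f x))) :
    HasDecomposition μ lam ρ q f A N W := by
  choose g b hgm hdgb hga hgN hb using hd
  have hgs : ∀ᵐ x ∂μ, ∑' n, ‖g n x‖ₑ ≤ A := by
    filter_upwards [ae_all_iff.2 hga] with x hx
    exact (ENNReal.tsum_le_tsum hx).trans hA
  have hbs : ∀ᵐ x ∂μ, ∑' n, ‖b n x‖ₑ < ∞ := by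
    refine ae_lt_top' (AEMeasurable.tsum fun n => (hb n).aestronglyMeasurable.enorm) ?_
    rw [lintegral_tsum fun n => (hb n).aestronglyMeasurable.enorm]
    exact ((ENNReal.tsum_le_tsum fun n =>
      (hb n).lintegral_enorm_le hfin hρ hq).trans hW).trans_lt hWtop.lt_top |>.ne
  refine ⟨fun x => ∑' n, g n x, fun x => ∑' n, b n x, AEStronglyMeasurable.tsum hgm, ?_, ?_, ?_,
    H1Le.tsum hfin hρ hq hb hW hWtop ?_⟩
  · filter_upwards [hgs, hbs, hf, ae_all_iff.2 hdgb] with x hxg hxb hxf hxd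
    have h1 : Summable fun n => g n x := Summable.of_enorm (hxg.trans_lt hAtop.lt_top).ne
    have h2 : Summable fun n => b n x := Summable.of_enorm hxb.ne
    have h3 := (h1.hasSum.add h2.hasSum).tendsto_sum_nat
    refine tendsto_nhds_unique hxf (h3.congr fun n => Finset.sum_congr rfl fun i _ => (hxd i).symm)
  · filter_upwards [hgs] with x hx using enorm_tsum_le_tsum_enorm.trans hx
  · calc ∫⁻ x, ‖∑' n, g n x‖ₑ ∂μ ≤ ∫⁻ x, ∑' n, ‖g n x‖ₑ ∂μ :=
          lintegral_mono fun x => enorm_tsum_le_tsum_enorm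
      _ = ∑' n, ∫⁻ x, ‖g n x‖ₑ ∂μ := lintegral_tsum fun n => (hgm n).enorm
      _ ≤ N := (ENNReal.tsum_le_tsum hgN).trans hN
  · filter_upwards [hbs] with x hx using (Summable.of_enorm hx.ne).hasSum

/-- The supremum norm of a bounded integrable function can be lowered to `ℓ`, up to the mean value
of `|f|` and an element of the Hardy space. The small remainders are decomposed in turn, at
heights that decrease geometrically. -/
lemma Admissible.hasDecomposition [BorelSpace X] [SecondCountableTopology X] [Nonempty X]
    (h : Admissible μ lam α γ β) (hρ : 1 ≤ ρ) (hρα : 5 * ρ ≤ α) (hq : 1 < q) :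
    ∃ C : ℝ≥0, 1 ≤ C ∧ ∀ (f : X → ℂ) (M ℓ : ℝ≥0), AEStronglyMeasurable f μ → 0 < ℓ → ℓ ≤ M →
      (∀ᵐ x ∂μ, ‖f x‖ₑ ≤ M) → ∫⁻ x, ‖f x‖ₑ ∂μ ≠ ∞ →
      HasDecomposition μ lam ρ q f (C * (ℓ + (∫⁻ x, ‖f x‖ₑ ∂μ) / μ univ))
        (2 * ∫⁻ x, ‖f x‖ₑ ∂μ) ((C * (M / ℓ) : ℝ≥0) * ∫⁻ x, ‖f x‖ₑ ∂μ) := by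
  set K : ℝ≥0 := 4 * β * (1 + β) with hK
  refine ⟨6 + 2 * K, le_trans (by norm_num) le_self_add, fun f₀ M ℓ hf₀ hℓ hℓM hf₀M hf₀fin => ?_⟩
  obtain ⟨f, hf, hff, hfM⟩ := exists_measurable_bounded_rep hf₀ hf₀M
  have hNeq : ∫⁻ x, ‖f₀ x‖ₑ ∂μ = ∫⁻ x, ‖f x‖ₑ ∂μ :=
    lintegral_congr_ae (by filter_upwards [hff] with x hx; rw [hx])
  rw [hNeq] at hf₀fin ⊢
  refine HasDecomposition.congr ?_ hff.symm
  set N := ∫⁻ x, ‖f x‖ₑ ∂μ with hN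
  rcases eq_or_ne N 0 with hN0 | hN0
  · refine HasDecomposition.of_le hf.aestronglyMeasurable ?_ (le_mul_of_one_le_left bot_le
      (by norm_num)) _
    have := (lintegral_eq_zero_iff hf.enorm).1 hN0
    filter_upwards [this] with x hx
    simp [show ‖f x‖ₑ = 0 from hx]
  have hμ0 : μ univ ≠ 0 := by
    intro h0
    apply hN0
    rw [hN, Measure.measure_univ_eq_zero.1 h0]; simp
  let F := {e : X → ℂ // Measurable e ∧ (∀ x, ‖e x‖ₑ ≤ M) ∧ ∫⁻ x, ‖e x‖ₑ ∂μ ≠ ∞}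
  have hpow : ∀ n : ℕ, (0 : ℝ≥0) < ℓ * 2⁻¹ ^ n := fun n => by positivity
  have hpowM : ∀ n : ℕ, ℓ * 2⁻¹ ^ n ≤ M := fun n =>
    (mul_le_of_le_one_right bot_le (pow_le_one₀ bot_le (by norm_num))).trans hℓM
  -- lowering the remainder to height `2 ^ (-n) ℓ` costs a factor `2 ^ n`, which the powers of
  -- `4⁻¹` compensate
  choose g b Z hgm hZm hsum hgb hgN hb hZε using fun (n : ℕ) (e : F) =>
    h.exists_decomposition_add hρ hρα hq e.2.1 (hpow n) (hpowM n) e.2.2.1 e.2.2.2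
      (ε := 4⁻¹ ^ (n + 1) * N) (mul_ne_zero (pow_ne_zero _ (by simp)) hN0)
  let next : ℕ → F → F := fun n e => ⟨(Z n e).indicator e.1, e.2.1.indicator (hZm n e), fun x => by
    by_cases hx : x ∈ Z n e
    · rw [indicator_of_mem hx]; exact e.2.2.1 x
    · rw [indicator_of_notMem hx]; simp, by
    refine ((lintegral_mono fun x => ?_).trans_lt e.2.2.2.lt_top).ne
    rw [enorm_indicator_eq_indicator_enorm]; exact indicator_le_self _ _ _⟩
  let e : ℕ → F := fun n => Nat.rec ⟨f, hf, hfM, hf₀fin⟩ next n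
  have he0 : (e 0).1 = f := rfl
  have hes : ∀ n, (e (n + 1)).1 = (Z n (e n)).indicator (e n).1 := fun n => rfl
  have heN : ∀ n, ∫⁻ x, ‖(e n).1 x‖ₑ ∂μ ≤ 4⁻¹ ^ n * N := by
    intro n
    cases n with
    | zero => simp [he0, hN]
    | succ n =>
      rw [hes]
      simp_rw [enorm_indicator_eq_indicator_enorm]
      rw [lintegral_indicator (hZm n (e n))]
      exact hZε n (e n)
  have h42 : ∀ n : ℕ, (4⁻¹ : ℝ≥0∞) ^ n ≤ 2⁻¹ ^ n := fun n => by
    gcongr; norm_num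
  have he2 : ∀ n, ∫⁻ x, ‖(e n).1 x‖ₑ ∂μ ≤ 2⁻¹ ^ n * N := fun n =>
    (heN n).trans (by gcongr; norm_num)
  have hdec : ∀ n, HasDecomposition μ lam ρ q (fun x => (e n).1 x - (e (n + 1)).1 x)
      (2⁻¹ ^ n * (3 * (ℓ + N / μ univ))) (2⁻¹ ^ n * N)
      (2⁻¹ ^ n * ((K * (M / ℓ) : ℝ≥0) * N)) := by
    intro n
    refine ⟨g n (e n), b n (e n), (hgm n (e n)).aestronglyMeasurable,
      Eventually.of_forall fun x => ?_, Eventually.of_forall fun x => (hgb n (e n) x).trans ?_,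
      (hgN n (e n)).trans (he2 n), (hb n (e n)).mono ?_⟩
    · rw [hes, sub_eq_iff_eq_add]; exact hsum n (e n) x
    · calc 3 * (((ℓ * 2⁻¹ ^ n : ℝ≥0) : ℝ≥0∞) + (∫⁻ x, ‖(e n).1 x‖ₑ ∂μ) / μ univ)
          ≤ 3 * (((ℓ * 2⁻¹ ^ n : ℝ≥0) : ℝ≥0∞) + (2⁻¹ ^ n * N) / μ univ) := by
            gcongr; exact he2 n
        _ = _ := by
            push_cast
            rw [mul_div_assoc]
            ring
    · calc (K * (M / (ℓ * 2⁻¹ ^ n)) : ℝ≥0) * ∫⁻ x, ‖(e n).1 x‖ₑ ∂μ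
          ≤ (K * (M / (ℓ * 2⁻¹ ^ n)) : ℝ≥0) * (4⁻¹ ^ n * N) := by gcongr; exact heN n
        _ = (((K * (M / (ℓ * 2⁻¹ ^ n))) * 4⁻¹ ^ n : ℝ≥0) : ℝ≥0∞) * N := by
            push_cast
            ring
        _ = ((2⁻¹ ^ n * (K * (M / ℓ)) : ℝ≥0) : ℝ≥0∞) * N := by
            congr 2
            have : (4 : ℝ≥0)⁻¹ = 2⁻¹ * 2⁻¹ := by rw [← mul_inv]; norm_num
            rw [this, mul_pow]
            field_simp
        _ = _ := by
            push_cast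
            ring
  have htend : ∀ᵐ x ∂μ, Tendsto (fun n => (e n).1 x) atTop (nhds 0) := by
    have : ∀ᵐ x ∂μ, ∑' n, ‖(e n).1 x‖ₑ < ∞ := by
      refine ae_lt_top' (AEMeasurable.tsum fun n => (e n).2.1.enorm.aemeasurable) ?_
      rw [lintegral_tsum fun n => (e n).2.1.enorm.aemeasurable]
      refine ((ENNReal.tsum_le_tsum he2).trans_lt ?_).ne
      rw [ENNReal.tsum_mul_right, tsum_two_inv_pow]
      exact ENNReal.mul_lt_top (by simp) hf₀fin.lt_top
    filter_upwards [this] with x hx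
    exact (Summable.of_enorm hx.ne).tendsto_atTop_zero
  have hθ : N / μ univ ≠ ∞ := ENNReal.div_ne_top hf₀fin hμ0
  refine (HasDecomposition.tsum h.measure_ball_lt_top hρ hq hdec
    (A := 6 * (ℓ + N / μ univ)) (N := 2 * N) (W := 2 * ((K * (M / ℓ) : ℝ≥0) * N)) ?_ ?_ ?_ ?_ ?_
    ?_).mono ?_ le_rfl ?_
  · rw [ENNReal.tsum_mul_right, tsum_two_inv_pow, ← mul_assoc]; norm_num
  · exact ENNReal.mul_ne_top (by simp) (ENNReal.add_ne_top.2 ⟨ENNReal.coe_ne_top, hθ⟩)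
  · rw [ENNReal.tsum_mul_right, tsum_two_inv_pow]
  · rw [ENNReal.tsum_mul_right, tsum_two_inv_pow]
  · exact ENNReal.mul_ne_top (by simp) (ENNReal.mul_ne_top ENNReal.coe_ne_top hf₀fin)
  · filter_upwards [htend] with x hx
    have h1 : ∀ n, ∑ i ∈ Finset.range n, ((e i).1 x - (e (i + 1)).1 x) = f x - (e n).1 x :=
      fun n => Finset.sum_range_sub' (fun n => (e n).1 x) n
    simp_rw [h1]
    simpa using tendsto_const_nhds.sub hx
  · gcongr
    exact_mod_cast (le_self_add : (6 : ℝ≥0) ≤ 6 + 2 * K)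
  · rw [← mul_assoc]
    gcongr
    rw [← ENNReal.coe_ofNat, ← ENNReal.coe_mul, ENNReal.coe_le_coe, ← mul_assoc]
    gcongr
    exact le_add_self

end NonHom

namespace NonHom

open Set Metric Filter

variable {X : Type*} [MetricSpace X] [MeasurableSpace X] {μ : Measure X} {lam : X → ℝ → ℝ}
  {α γ ρ : ℝ} {β : ℝ≥0} {q : ℝ≥0∞}

/-- Lowering the supremum norm `n` times by a factor `D`. The size of the Hardy space part is
at most `C 4 ^ n` times the `L¹`-norm, where `C` depends on `D` but the rate of growth does not. -/
lemma Admissible.hasDecomposition_pow [BorelSpace X] [SecondCountableTopology X] [Nonempty X]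
    (h : Admissible μ lam α γ β) (hρ : 1 ≤ ρ) (hρα : 5 * ρ ≤ α) (hq : 1 < q) {D : ℝ≥0}
    (hD : 1 ≤ D) :
    ∃ C : ℝ≥0, ∀ (n : ℕ) (f : X → ℂ) (M : ℝ≥0), AEStronglyMeasurable f μ →
      (∀ᵐ x ∂μ, ‖f x‖ₑ ≤ M) → ∫⁻ x, ‖f x‖ₑ ∂μ ≠ ∞ →
      HasDecomposition μ lam ρ q f
        ((D⁻¹ ^ n * M : ℝ≥0) + (C * 4 ^ n : ℝ≥0) * ((∫⁻ x, ‖f x‖ₑ ∂μ) / μ univ))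
        ((4 ^ n : ℝ≥0) * ∫⁻ x, ‖f x‖ₑ ∂μ) ((C * 4 ^ n : ℝ≥0) * ∫⁻ x, ‖f x‖ₑ ∂μ) := by
  obtain ⟨C₁, hC₁, hdec⟩ := h.hasDecomposition (q := q) hρ hρα hq
  have hC₁0 : 0 < C₁ := lt_of_lt_of_le one_pos hC₁
  have hD0 : 0 < D := lt_of_lt_of_le one_pos hD
  refine ⟨C₁ * C₁ * D, fun n => ?_⟩
  set C := C₁ * C₁ * D with hC
  have hCC₁ : C₁ ≤ C := by
    calc C₁ = C₁ * 1 * 1 := by ring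
      _ ≤ C₁ * C₁ * D := by gcongr
  induction n with
  | zero =>
    intro f M hf hM hfin
    refine HasDecomposition.of_le hf ?_ (by simp) _
    filter_upwards [hM] with x hx
    refine hx.trans ?_
    simp
  | succ n ih =>
    intro f M hf hM hfin
    set N := ∫⁻ x, ‖f x‖ₑ ∂μ with hN
    rcases eq_or_ne M 0 with rfl | hM0
    · refine HasDecomposition.of_le hf ?_ (le_mul_of_one_le_left bot_le ?_) _
      · filter_upwards [hM] with x hx
        exact hx.trans (by simp)
      · exact_mod_cast one_le_pow₀ (by norm_num)
    rcases eq_or_ne (μ univ) 0 with hμ0 | hμ0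
    · rw [Measure.measure_univ_eq_zero.1 hμ0] at hf ⊢
      exact HasDecomposition.of_le hf (by simp) (by simp) _
    have hMpos : 0 < M := pos_iff_ne_zero.2 hM0
    set θ : ℝ≥0 := (N / μ univ).toNNReal with hθ
    have hθN : (θ : ℝ≥0∞) = N / μ univ := ENNReal.coe_toNNReal (ENNReal.div_ne_top hfin hμ0)
    have hℓM : M / (C₁ * D) ≤ M := div_le_self bot_le (by
      calc (1 : ℝ≥0) = 1 * 1 := by ring
        _ ≤ C₁ * D := by gcongr)
    obtain ⟨g, b, hg, hfgb, hga, hgN, hb⟩ := hdec f M (M / (C₁ * D)) hf (by positivity) hℓM hM hfin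
    rw [← hN, ← hθN] at hga
    have hgM : ∀ᵐ x ∂μ, ‖g x‖ₑ ≤ ((M / D + C₁ * θ : ℝ≥0) : ℝ≥0∞) := by
      filter_upwards [hga] with x hx
      refine hx.trans (le_of_eq ?_)
      rw [← ENNReal.coe_add, ← ENNReal.coe_mul]
      congr 1
      field_simp
    have hgfin : ∫⁻ x, ‖g x‖ₑ ∂μ ≠ ∞ :=
      (hgN.trans_lt (ENNReal.mul_lt_top (by simp) hfin.lt_top)).ne
    obtain ⟨g', b', hg', hgb', hg'a, hg'N, hb'⟩ := ih g _ hg hgM hgfin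
    have hw : ((C * 4 ^ n : ℝ≥0) : ℝ≥0∞) * ∫⁻ x, ‖g x‖ₑ ∂μ ≤ (C * 4 ^ n * 2 : ℝ≥0) * N := by
      calc ((C * 4 ^ n : ℝ≥0) : ℝ≥0∞) * ∫⁻ x, ‖g x‖ₑ ∂μ ≤ (C * 4 ^ n : ℝ≥0) * (2 * N) := by gcongr
        _ = _ := by push_cast; ring
    have hsum := H1Le.add h.measure_ball_lt_top hρ hq (ENNReal.mul_ne_top ENNReal.coe_ne_top hfin)
      (ENNReal.mul_ne_top ENNReal.coe_ne_top hfin) hb (hb'.mono hw)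
    refine ⟨g', b + b', hg', ?_, ?_, ?_, hsum.mono ?_⟩
    · filter_upwards [hfgb, hgb'] with x h1 h2
      rw [h1, h2, Pi.add_apply]; ring
    · filter_upwards [hg'a] with x hx
      refine hx.trans ?_
      have h1 : (∫⁻ x, ‖g x‖ₑ ∂μ) / μ univ ≤ ((2 * θ : ℝ≥0) : ℝ≥0∞) := by
        rw [ENNReal.coe_mul, hθN, ← mul_div_assoc]
        exact ENNReal.div_le_div_right hgN _
      rw [← hθN]
      calc _ ≤ ((D⁻¹ ^ n * (M / D + C₁ * θ) : ℝ≥0) : ℝ≥0∞) +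
            (C * 4 ^ n : ℝ≥0) * ((2 * θ : ℝ≥0) : ℝ≥0∞) := by gcongr
        _ = ((D⁻¹ ^ n * (M / D + C₁ * θ) + C * 4 ^ n * (2 * θ) : ℝ≥0) : ℝ≥0∞) := by
            push_cast; rfl
        _ ≤ ((D⁻¹ ^ (n + 1) * M + C * 4 ^ (n + 1) * θ : ℝ≥0) : ℝ≥0∞) := by
            refine ENNReal.coe_le_coe.2 ?_
            have h2 : D⁻¹ ^ n ≤ 1 := pow_le_one₀ bot_le (inv_le_one_of_one_le₀ hD)
            have h3 : (1 : ℝ≥0) ≤ 4 ^ n := one_le_pow₀ (by norm_num)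
            calc D⁻¹ ^ n * (M / D + C₁ * θ) + C * 4 ^ n * (2 * θ)
                = D⁻¹ ^ (n + 1) * M + D⁻¹ ^ n * C₁ * 1 * θ + C * 4 ^ n * (2 * θ) := by
                  rw [pow_succ, div_eq_mul_inv]; ring
              _ ≤ D⁻¹ ^ (n + 1) * M + 1 * C * 4 ^ n * θ + C * 4 ^ n * (2 * θ) := by gcongr
              _ = D⁻¹ ^ (n + 1) * M + C * 4 ^ n * 3 * θ := by ring
              _ ≤ D⁻¹ ^ (n + 1) * M + C * 4 ^ n * 4 * θ := by gcongr; norm_num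
              _ = _ := by ring
        _ = _ := by push_cast; rfl
    · refine hg'N.trans ?_
      calc ((4 ^ n : ℝ≥0) : ℝ≥0∞) * ∫⁻ x, ‖g x‖ₑ ∂μ ≤ (4 ^ n : ℝ≥0) * (2 * N) := by gcongr
        _ ≤ (4 ^ n : ℝ≥0) * (4 * N) := by gcongr; norm_num
        _ = _ := by push_cast; ring
    · rw [← add_mul, ← ENNReal.coe_add]
      refine mul_le_mul_left (ENNReal.coe_le_coe.2 ?_) _
      have h3 : (1 : ℝ≥0) ≤ 4 ^ n := one_le_pow₀ (by norm_num)
      calc C₁ * (M / (M / (C₁ * D))) + C * 4 ^ n * 2 = C * 1 + C * 4 ^ n * 2 := by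
            rw [div_div_cancel₀ hM0, hC]; ring
        _ ≤ C * 4 ^ n + C * 4 ^ n * 2 := by
            rw [mul_one]; gcongr; exact le_mul_of_one_le_right bot_le h3
        _ = C * 4 ^ n * 3 := by ring
        _ ≤ C * 4 ^ n * 4 := by gcongr; norm_num
        _ = _ := by ring

/-- Decomposition at height `ℓ`: the part of `f` where `|f| > ℓ` contributes to the Hardy space part
only through the integral of `|f| ^ s` over that set, for any given `s > 1`. On the set where
`D ^ k ℓ < |f| ≤ D ^ (k + 1) ℓ` the supremum norm is lowered to `D ^ (-k) ℓ`; the loss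
`4 ^ (2 k + 1)` is compensated by the gain `D ^ (-(s - 1) k)` if `D` is large. -/
lemma Admissible.exists_decomposition [BorelSpace X] [SecondCountableTopology X] [Nonempty X]
    (h : Admissible μ lam α γ β) (hρ : 1 ≤ ρ) (hρα : 5 * ρ ≤ α) (hq : 1 < q) {s : ℝ} (hs : 1 < s) :
    ∃ C : ℝ≥0, ∀ (f : X → ℂ) (ℓ : ℝ≥0), AEStronglyMeasurable f μ → 0 < ℓ →
      ∫⁻ x in {x | (ℓ : ℝ≥0∞) < ‖f x‖ₑ}, ‖f x‖ₑ ^ s ∂μ ≠ ∞ →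
      HasDecomposition μ lam ρ q f
        (C * (ℓ + (ℓ : ℝ≥0∞) ^ (1 - s) *
          (∫⁻ x in {x | (ℓ : ℝ≥0∞) < ‖f x‖ₑ}, ‖f x‖ₑ ^ s ∂μ) / μ univ)) ∞
        (C * ((ℓ : ℝ≥0∞) ^ (1 - s) *
          ∫⁻ x in {x | (ℓ : ℝ≥0∞) < ‖f x‖ₑ}, ‖f x‖ₑ ^ s ∂μ)) := by
  have hs0 : 0 < s - 1 := by linarith
  obtain ⟨D, hD2, hD⟩ : ∃ D : ℝ≥0, 2 ≤ D ∧ 16 ≤ (D : ℝ≥0∞) ^ (s - 1) := by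
    refine ⟨max 2 (16 ^ (s - 1)⁻¹), le_max_left _ _, ?_⟩
    calc (16 : ℝ≥0∞) = (((16 : ℝ≥0) ^ (s - 1)⁻¹ : ℝ≥0) : ℝ≥0∞) ^ (s - 1) := by
          rw [← ENNReal.coe_rpow_of_nonneg _ hs0.le, ← NNReal.rpow_mul, inv_mul_cancel₀ hs0.ne',
            NNReal.rpow_one]
          norm_num
      _ ≤ _ := by
          gcongr
          exact le_max_right _ _
  have hD1 : 1 ≤ D := le_trans (by norm_num) hD2
  have hD0 : 0 < D := lt_of_lt_of_le one_pos hD1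
  obtain ⟨C, hC⟩ := h.hasDecomposition_pow (q := q) hρ hρα hq hD1
  refine ⟨3 + 4 * C, fun f₀ ℓ hf₀ hℓ hfin₀ => ?_⟩
  set f : X → ℂ := hf₀.mk f₀ with hf_def
  have hf : Measurable f := hf₀.stronglyMeasurable_mk.measurable
  have hff : f₀ =ᵐ[μ] f := hf₀.ae_eq_mk
  have hIeq : ∫⁻ x in {x | (ℓ : ℝ≥0∞) < ‖f₀ x‖ₑ}, ‖f₀ x‖ₑ ^ s ∂μ
      = ∫⁻ x in {x | (ℓ : ℝ≥0∞) < ‖f x‖ₑ}, ‖f x‖ₑ ^ s ∂μ := by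
    have h1 : ({x | (ℓ : ℝ≥0∞) < ‖f₀ x‖ₑ} : Set X) =ᵐ[μ] {x | (ℓ : ℝ≥0∞) < ‖f x‖ₑ} := by
      filter_upwards [hff] with x hx
      exact propext (by change _ < ‖f₀ x‖ₑ ↔ _ < ‖f x‖ₑ; rw [hx])
    rw [setLIntegral_congr h1]
    exact lintegral_congr_ae (ae_restrict_of_ae (by filter_upwards [hff] with x hx; rw [hx]))
  rw [hIeq] at hfin₀ ⊢
  refine HasDecomposition.congr ?_ hff.symm
  set I := ∫⁻ x in {x | (ℓ : ℝ≥0∞) < ‖f x‖ₑ}, ‖f x‖ₑ ^ s ∂μ with hI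
  have hℓ0 : (ℓ : ℝ≥0∞) ≠ 0 := by exact_mod_cast hℓ.ne'
  rcases eq_or_ne (μ univ) 0 with hμ0 | hμ0
  · have : μ = 0 := Measure.measure_univ_eq_zero.1 hμ0
    subst this
    exact HasDecomposition.of_le hf.aestronglyMeasurable (by simp) (by simp) _
  set E : ℕ → Set X := fun k => {x | ((D ^ k * ℓ : ℝ≥0) : ℝ≥0∞) < ‖f x‖ₑ ∧
    ‖f x‖ₑ ≤ ((D ^ (k + 1) * ℓ : ℝ≥0) : ℝ≥0∞)} with hE
  have hEm : ∀ k, MeasurableSet (E k) := fun k =>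
    (measurableSet_lt measurable_const hf.enorm).inter (measurableSet_le hf.enorm measurable_const)
  have hmonoD : ∀ {j k : ℕ}, j ≤ k → ((D ^ j * ℓ : ℝ≥0) : ℝ≥0∞) ≤ ((D ^ k * ℓ : ℝ≥0) : ℝ≥0∞) :=
    fun hjk => ENNReal.coe_le_coe.2 (by gcongr)
  have hEd : Pairwise (Function.onFun Disjoint E) := by
    have : ∀ j k, j < k → Disjoint (E j) (E k) := fun j k hjk =>
      Set.disjoint_left.2 fun x hxj hxk =>
        absurd (hxj.2.trans (hmonoD hjk)) (not_le.2 hxk.1)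
    intro j k hjk
    rcases lt_or_gt_of_ne hjk with hlt | hlt
    · exact this j k hlt
    · exact (this k j hlt).symm
  set J : ℕ → ℝ≥0∞ := fun k => ∫⁻ x in E k, ‖f x‖ₑ ^ s ∂μ with hJ
  have hJsum : ∑' k, J k ≤ I := by
    rw [hJ, ← lintegral_iUnion hEm hEd]
    refine lintegral_mono_set (iUnion_subset fun k x hx => ?_)
    refine lt_of_le_of_lt ?_ hx.1
    simpa using hmonoD (Nat.zero_le k)
  set N : ℕ → ℝ≥0∞ := fun k => ∫⁻ x, ‖(E k).indicator f x‖ₑ ∂μ with hN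
  have hNJ : ∀ k, (4 ^ (2 * k + 1) : ℝ≥0) * N k ≤ 4 * ((ℓ : ℝ≥0∞) ^ (1 - s) * J k) := by
    intro k
    have h1 : ((D ^ k * ℓ : ℝ≥0) : ℝ≥0∞) ^ (s - 1) * N k ≤ J k := by
      rw [hN, hJ]
      simp_rw [enorm_indicator_eq_indicator_enorm]
      rw [lintegral_indicator (hEm k), ← lintegral_const_mul _ hf.enorm]
      refine setLIntegral_mono' (hEm k) fun x hx => ?_
      have hx0 : ‖f x‖ₑ ≠ 0 := (bot_le.trans_lt hx.1).ne'
      calc _ ≤ ‖f x‖ₑ ^ (s - 1) * ‖f x‖ₑ := by gcongr; exact hx.1.le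
        _ = ‖f x‖ₑ ^ s := by
            rw [ENNReal.rpow_sub _ _ hx0 enorm_ne_top, ENNReal.rpow_one,
              ENNReal.div_mul_cancel hx0 enorm_ne_top]
    have h2 : ((16 : ℝ≥0∞) ^ k * (ℓ : ℝ≥0∞) ^ (s - 1)) * N k ≤ J k := by
      refine le_trans ?_ h1
      gcongr
      rw [ENNReal.coe_mul, ENNReal.mul_rpow_of_nonneg _ _ hs0.le, ENNReal.coe_pow,
        ← ENNReal.rpow_natCast (D : ℝ≥0∞), ← ENNReal.rpow_mul, mul_comm (k : ℝ),
        ENNReal.rpow_mul, ENNReal.rpow_natCast]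
      gcongr
    have h3 : (ℓ : ℝ≥0∞) ^ (1 - s) * (ℓ : ℝ≥0∞) ^ (s - 1) = 1 := by
      rw [← ENNReal.rpow_add _ _ hℓ0 ENNReal.coe_ne_top]; simp
    calc ((4 ^ (2 * k + 1) : ℝ≥0) : ℝ≥0∞) * N k = 4 * (16 ^ k * N k) := by
          push_cast
          rw [pow_succ, pow_mul, show (4 : ℝ≥0∞) ^ 2 = 16 by norm_num]; ring
      _ = 4 * ((ℓ : ℝ≥0∞) ^ (1 - s) * (ℓ : ℝ≥0∞) ^ (s - 1) * (16 ^ k * N k)) := by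
          rw [h3, one_mul]
      _ = 4 * ((ℓ : ℝ≥0∞) ^ (1 - s) * ((16 ^ k * (ℓ : ℝ≥0∞) ^ (s - 1)) * N k)) := by ring
      _ ≤ _ := by gcongr
  have hℓs : (ℓ : ℝ≥0∞) ^ (1 - s) ≠ ∞ := ENNReal.rpow_ne_top_of_ne_zero hℓ0 ENNReal.coe_ne_top
  have hJtop : ∀ k, J k ≠ ∞ := fun k =>
    (((ENNReal.le_tsum k).trans hJsum).trans_lt hfin₀.lt_top).ne
  have hNtop : ∀ k, N k ≠ ∞ := by
    intro k hk
    have := hNJ k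
    rw [hk, ENNReal.mul_top (by positivity), top_le_iff] at this
    exact ENNReal.mul_ne_top (by simp) (ENNReal.mul_ne_top hℓs (hJtop k)) this
  have hpiece : ∀ k, HasDecomposition μ lam ρ q ((E k).indicator f)
      (2⁻¹ ^ k * ℓ + (4 * C) * ((ℓ : ℝ≥0∞) ^ (1 - s) * J k / μ univ)) ∞
      ((4 * C) * ((ℓ : ℝ≥0∞) ^ (1 - s) * J k)) := by
    intro k
    refine (hC (2 * k + 1) ((E k).indicator f) (D ^ (k + 1) * ℓ)
      (hf.indicator (hEm k)).aestronglyMeasurable (Eventually.of_forall fun x => ?_)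
      (hNtop k)).mono ?_ le_top ?_
    · by_cases hx : x ∈ E k
      · rw [indicator_of_mem hx]; exact hx.2
      · rw [indicator_of_notMem hx]; simp
    · gcongr ?_ + ?_
      · have h1 : D⁻¹ ^ (2 * k + 1) * (D ^ (k + 1) * ℓ) = D⁻¹ ^ k * ℓ := by
          rw [show 2 * k + 1 = k + (k + 1) by ring, pow_add, inv_pow D (k + 1)]
          field_simp
        rw [h1]
        rw [ENNReal.coe_mul, ENNReal.coe_pow, ENNReal.coe_inv hD0.ne']
        gcongr
        exact_mod_cast hD2
      · calc ((C * 4 ^ (2 * k + 1) : ℝ≥0) : ℝ≥0∞) * (N k / μ univ)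
            = C * ((4 ^ (2 * k + 1) : ℝ≥0) * N k / μ univ) := by
              rw [ENNReal.coe_mul, mul_div_assoc, mul_assoc]
          _ ≤ C * (4 * ((ℓ : ℝ≥0∞) ^ (1 - s) * J k) / μ univ) := by
              have := ENNReal.div_le_div_right (hNJ k) (μ univ)
              gcongr
          _ = _ := by rw [mul_div_assoc]; ring
    · calc ((C * 4 ^ (2 * k + 1) : ℝ≥0) : ℝ≥0∞) * N k
            = C * ((4 ^ (2 * k + 1) : ℝ≥0) * N k) := by
              rw [ENNReal.coe_mul, mul_assoc]
          _ ≤ C * (4 * ((ℓ : ℝ≥0∞) ^ (1 - s) * J k)) := mul_le_mul' le_rfl (hNJ k)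
          _ = _ := by ring
  -- the part of `f` where `|f| ≤ ℓ` comes first
  set F : Set X := {x | ‖f x‖ₑ ≤ ℓ} with hF
  have hFm : MeasurableSet F := measurableSet_le hf.enorm measurable_const
  set d : ℕ → X → ℂ := fun n => Nat.casesOn n (F.indicator f) fun k => (E k).indicator f with hd
  set a : ℕ → ℝ≥0∞ := fun n => Nat.casesOn n (ℓ : ℝ≥0∞) fun k =>
    2⁻¹ ^ k * ℓ + (4 * C) * ((ℓ : ℝ≥0∞) ^ (1 - s) * J k / μ univ) with ha
  set w : ℕ → ℝ≥0∞ := fun n => Nat.casesOn n 0 fun k =>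
    (4 * C) * ((ℓ : ℝ≥0∞) ^ (1 - s) * J k) with hw
  have hdec : ∀ n, HasDecomposition μ lam ρ q (d n) (a n) ∞ (w n) := by
    intro n
    cases n with
    | zero =>
      refine HasDecomposition.of_le (hf.indicator hFm).aestronglyMeasurable
        (Eventually.of_forall fun x => ?_) le_top _
      by_cases hx : x ∈ F
      · rw [indicator_of_mem hx]; exact hx
      · rw [indicator_of_notMem hx]; simp
    | succ k => exact hpiece k
  set G : ℕ → Set X := fun n => {x | ‖f x‖ₑ ≤ ((D ^ n * ℓ : ℝ≥0) : ℝ≥0∞)} with hG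
  have hpartial : ∀ n x, ‖f x‖ₑ ≤ ((D ^ n * ℓ : ℝ≥0) : ℝ≥0∞) →
      ∑ i ∈ Finset.range (n + 1), d i x = f x := by
    have hgen : ∀ n x, ∑ i ∈ Finset.range (n + 1), d i x = (G n).indicator f x := by
      intro n x
      induction n with
      | zero => simp [hd, hF, hG]
      | succ n ih =>
        rw [Finset.sum_range_succ, ih]
        change _ + (E n).indicator f x = _
        by_cases h1 : ‖f x‖ₑ ≤ ((D ^ n * ℓ : ℝ≥0) : ℝ≥0∞)
        · have h2 := h1.trans (hmonoD (Nat.le_succ n))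
          have h3 : x ∉ E n := fun hx => absurd h1 (not_le.2 hx.1)
          rw [indicator_of_mem (show x ∈ G n from h1), indicator_of_notMem h3,
            indicator_of_mem (show x ∈ G (n + 1) from h2), add_zero]
        · rw [indicator_of_notMem (show x ∉ G n from h1), zero_add]
          by_cases h2 : ‖f x‖ₑ ≤ ((D ^ (n + 1) * ℓ : ℝ≥0) : ℝ≥0∞)
          · rw [indicator_of_mem (show x ∈ E n from ⟨not_le.1 h1, h2⟩),
              indicator_of_mem (show x ∈ G (n + 1) from h2)]
          · rw [indicator_of_notMem (fun hx : x ∈ E n => h2 hx.2),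
              indicator_of_notMem (show x ∉ G (n + 1) from h2)]
    intro n x hx
    rw [hgen, indicator_of_mem (show x ∈ G n from hx)]
  have hasum : ∑' n, a n ≤ 3 * ℓ + 4 * C * ((ℓ : ℝ≥0∞) ^ (1 - s) * I / μ univ) := by
    rw [tsum_eq_zero_add' ENNReal.summable]
    change (ℓ : ℝ≥0∞) + ∑' k : ℕ, (2⁻¹ ^ k * (ℓ : ℝ≥0∞) +
      (4 * C) * ((ℓ : ℝ≥0∞) ^ (1 - s) * J k / μ univ)) ≤ _
    rw [ENNReal.tsum_add, ENNReal.tsum_mul_right, tsum_two_inv_pow, ENNReal.tsum_mul_left]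
    simp_rw [mul_div_assoc]
    rw [ENNReal.tsum_mul_left]
    simp_rw [div_eq_mul_inv]
    rw [ENNReal.tsum_mul_right]
    calc _ = 3 * (ℓ : ℝ≥0∞) +
          4 * C * ((ℓ : ℝ≥0∞) ^ (1 - s) * ((∑' k, J k) * (μ univ)⁻¹)) := by ring
      _ ≤ _ := by gcongr
  have hwsum : ∑' n, w n ≤ 4 * C * ((ℓ : ℝ≥0∞) ^ (1 - s) * I) := by
    rw [tsum_eq_zero_add' ENNReal.summable]
    change (0 : ℝ≥0∞) + ∑' k : ℕ, (4 * C) * ((ℓ : ℝ≥0∞) ^ (1 - s) * J k) ≤ _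
    rw [zero_add, ENNReal.tsum_mul_left, ENNReal.tsum_mul_left]
    gcongr
  have h4C : (4 * C : ℝ≥0∞) ≠ ∞ := ENNReal.mul_ne_top (by simp) ENNReal.coe_ne_top
  refine (HasDecomposition.tsum h.measure_ball_lt_top hρ hq hdec hasum
    (ENNReal.add_ne_top.2 ⟨ENNReal.mul_ne_top (by simp) ENNReal.coe_ne_top,
      ENNReal.mul_ne_top h4C (ENNReal.div_ne_top (ENNReal.mul_ne_top hℓs hfin₀) hμ0)⟩)
    (N := ∞) le_top hwsum
    (ENNReal.mul_ne_top h4C (ENNReal.mul_ne_top hℓs hfin₀))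
    (Eventually.of_forall fun x => ?_)).mono ?_ le_rfl ?_
  · obtain ⟨n, hn⟩ := pow_unbounded_of_one_lt (‖f x‖₊ / ℓ) (lt_of_lt_of_le one_lt_two hD2)
    refine tendsto_const_nhds.congr' ?_
    filter_upwards [eventually_ge_atTop (n + 1)] with m hm
    obtain ⟨k, rfl⟩ : ∃ k, m = k + 1 := ⟨m - 1, by omega⟩
    refine (hpartial k x ?_).symm
    refine le_trans ?_ (hmonoD (show n ≤ k by omega))
    rw [enorm_eq_nnnorm, ENNReal.coe_le_coe]
    exact ((div_lt_iff₀ hℓ).1 hn).le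
  · push_cast
    calc 3 * (ℓ : ℝ≥0∞) + 4 * C * ((ℓ : ℝ≥0∞) ^ (1 - s) * I / μ univ)
        ≤ (3 + 4 * C) * ℓ + (3 + 4 * C) * ((ℓ : ℝ≥0∞) ^ (1 - s) * I / μ univ) := by
          gcongr
          · exact le_self_add
          · exact le_add_self
      _ = _ := by ring
  · push_cast
    gcongr
    exact le_add_self

end NonHom

namespace NonHom

open Set Metric Filter

variable {X : Type*} [MetricSpace X] [MeasurableSpace X] {μ : Measure X} {lam : X → ℝ → ℝ}
  {α γ η : ℝ} {β : ℝ≥0}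

/-! ### The good-`λ` inequality -/

/-- If `|G| ≤ 2 ℓ` on at least half of a doubling ball `S`, and the oscillation of `G` is small
against `ℓ`, then the number that represents `G` on `S` is at most `3 ℓ`. -/
lemma enorm_le_of_oscillation_le [OpensMeasurableSpace X] {S : Ball X} {G : X → ℂ}
    {F H : X → ℝ≥0∞} {m : ℂ}
    {k : ℝ≥0∞} {ℓ : ℝ≥0} (hℓ : 0 < ℓ) (hk : 4 * (k * β) ≤ ℓ) (hηγ : η ≤ γ)
    (hF : Measurable F) (hH : Measurable H)
    (hGF : ∀ᵐ x ∂μ, ‖G x‖ₑ ≤ F x + H x) (hμS : μ S.carrier ≠ 0) (hμS' : μ S.carrier ≠ ∞)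
    (hS : μ (S.dilate γ) ≤ β * μ S.carrier)
    (hm : ∫⁻ y in S.carrier, ‖G y - m‖ₑ ∂μ ≤ k * μ (S.dilate η))
    (hSF : μ (S.carrier ∩ {x | (ℓ : ℝ≥0∞) < F x}) ≤ 4⁻¹ * μ S.carrier)
    (hSH : μ (S.carrier ∩ {x | (ℓ : ℝ≥0∞) < H x}) ≤ 4⁻¹ * μ S.carrier) :
    ‖m‖ₑ ≤ 3 * ℓ := by
  by_contra! hcon
  set U := {x | (ℓ : ℝ≥0∞) < F x} with hU
  set V := {x | (ℓ : ℝ≥0∞) < H x} with hV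
  have hUm : MeasurableSet U := measurableSet_lt measurable_const hF
  have hVm : MeasurableSet V := measurableSet_lt measurable_const hH
  set W := S.carrier \ (U ∪ V) with hW
  have hWm : MeasurableSet W := S.measurableSet_carrier.diff (hUm.union hVm)
  have h1 : ℓ * μ W ≤ 4⁻¹ * (ℓ * μ S.carrier) := by
    calc ℓ * μ W = ∫⁻ _ in W, ℓ ∂μ := by simp
      _ ≤ ∫⁻ y in W, ‖G y - m‖ₑ ∂μ := by
          refine setLIntegral_mono_ae' hWm ?_
          filter_upwards [hGF] with x hx hxW
          have hxF : F x ≤ ℓ := not_lt.1 fun h => hxW.2 (Or.inl h)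
          have hxH : H x ≤ ℓ := not_lt.1 fun h => hxW.2 (Or.inr h)
          have h2 : ‖m‖ₑ ≤ ‖G x - m‖ₑ + 2 * ℓ := by
            calc ‖m‖ₑ = ‖G x - (G x - m)‖ₑ := by rw [sub_sub_cancel]
              _ ≤ ‖G x‖ₑ + ‖G x - m‖ₑ := enorm_sub_le
              _ ≤ (ℓ + ℓ) + ‖G x - m‖ₑ := by gcongr; exact hx.trans (add_le_add hxF hxH)
              _ = _ := by ring
          have h3 : (ℓ : ℝ≥0∞) + 2 * ℓ ≤ ‖G x - m‖ₑ + 2 * ℓ := by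
            calc (ℓ : ℝ≥0∞) + 2 * ℓ = 3 * ℓ := by ring
              _ ≤ _ := hcon.le.trans h2
          exact (ENNReal.add_le_add_iff_right (ENNReal.mul_ne_top (by simp) (by simp))).1 h3
      _ ≤ ∫⁻ y in S.carrier, ‖G y - m‖ₑ ∂μ := lintegral_mono_set sdiff_subset
      _ ≤ k * μ (S.dilate η) := hm
      _ ≤ k * (β * μ S.carrier) := by
          gcongr
          refine le_trans (measure_mono (ball_subset_ball ?_)) hS
          exact mul_le_mul_of_nonneg_right hηγ S.radius_pos.le
      _ = 4⁻¹ * (4 * (k * β) * μ S.carrier) := by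
          rw [← mul_assoc, ← mul_assoc, ← mul_assoc, ENNReal.inv_mul_cancel (by simp) (by simp),
            one_mul]
      _ ≤ 4⁻¹ * (ℓ * μ S.carrier) := by gcongr
  have h2 : μ S.carrier ≤ μ W + (μ (S.carrier ∩ U) + μ (S.carrier ∩ V)) := by
    refine le_trans (measure_mono fun x hx => ?_)
      ((measure_union_le W _).trans (add_le_add_right (measure_union_le _ _) _))
    by_cases hxU : x ∈ U
    · exact Or.inr (Or.inl ⟨hx, hxU⟩)
    by_cases hxV : x ∈ V
    · exact Or.inr (Or.inr ⟨hx, hxV⟩)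
    exact Or.inl ⟨hx, fun h => h.elim hxU hxV⟩
  have h3 : ℓ * μ S.carrier ≤ 4⁻¹ * (ℓ * μ S.carrier) +
      (4⁻¹ * (ℓ * μ S.carrier) + 4⁻¹ * (ℓ * μ S.carrier)) := by
    calc ℓ * μ S.carrier ≤ ℓ * (μ W + (4⁻¹ * μ S.carrier + 4⁻¹ * μ S.carrier)) := by
          gcongr
          exact h2.trans (add_le_add le_rfl (add_le_add hSF hSH))
      _ = ℓ * μ W + (4⁻¹ * (ℓ * μ S.carrier) + 4⁻¹ * (ℓ * μ S.carrier)) := by ring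
      _ ≤ _ := by gcongr
  have hpos : ℓ * μ S.carrier ≠ 0 := mul_ne_zero (by exact_mod_cast hℓ.ne') hμS
  have htop : ℓ * μ S.carrier ≠ ∞ := ENNReal.mul_ne_top (by simp) hμS'
  generalize (ℓ : ℝ≥0∞) * μ S.carrier = a at h3 hpos htop
  lift a to ℝ≥0 using htop
  have h4 : a ≤ 4⁻¹ * a + (4⁻¹ * a + 4⁻¹ * a) := by
    rw [← ENNReal.coe_le_coe]
    push_cast
    exact h3
  have h5 : 0 < a := pos_iff_ne_zero.2 (by exact_mod_cast hpos)
  have h6 : (a : ℝ) ≤ 4⁻¹ * a + (4⁻¹ * a + 4⁻¹ * a) := by exact_mod_cast h4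
  have h7 : (0 : ℝ) < a := h5
  linarith

/-- Doubling balls in which a set `V` has at least a quarter of the mass cover a set of measure
comparable to that of `V`. -/
lemma measure_biUnion_ball_le [OpensMeasurableSpace X] (hγ : 5 ≤ γ) (v : Finset X) (s : X → ℝ)
    (hs : ∀ x ∈ v, 0 < s x) {V : Set X} (hV : MeasurableSet V)
    (hd : ∀ x ∈ v, μ (ball x (γ * s x)) ≤ β * μ (ball x (s x)))
    (hsV : ∀ x ∈ v, μ (ball x (s x)) ≤ 4 * μ (ball x (s x) ∩ V)) :
    μ (⋃ x ∈ v, ball x (s x)) ≤ 4 * β * μ V := by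
  classical
  obtain ⟨R, hR⟩ : ∃ R, ∀ x ∈ v, s x ≤ R := by
    obtain ⟨R, hR⟩ := (v.image s).bddAbove
    exact ⟨R, fun x hx => hR (by simpa using ⟨x, hx, rfl⟩)⟩
  obtain ⟨u, huv, hdisj, hcov⟩ := exists_disjoint_balls (v : Set X) s hs R hR
  have hufin : u.Finite := v.finite_toSet.subset huv
  lift u to Finset X using hufin
  calc μ (⋃ x ∈ v, ball x (s x)) ≤ μ (⋃ x ∈ u, ball x (5 * s x)) := by
        refine measure_mono (iUnion₂_subset fun x hx => ?_)
        obtain ⟨y, hy, hxy⟩ := hcov x hx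
        exact hxy.trans (subset_biUnion_of_mem (u := fun y => ball y (5 * s y)) hy)
    _ ≤ ∑ x ∈ u, μ (ball x (5 * s x)) := measure_biUnion_finset_le _ _
    _ ≤ ∑ x ∈ u, 4 * β * μ (ball x (s x) ∩ V) := by
        refine Finset.sum_le_sum fun x hx => ?_
        have hxv := huv hx
        calc μ (ball x (5 * s x)) ≤ μ (ball x (γ * s x)) :=
              measure_mono (ball_subset_ball (by gcongr; exact (hs x hxv).le))
          _ ≤ β * (4 * μ (ball x (s x) ∩ V)) :=
              (hd x hxv).trans (mul_le_mul' le_rfl (hsV x hxv))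
          _ = _ := by ring
    _ = 4 * β * μ (⋃ x ∈ u, ball x (s x) ∩ V) := by
        rw [measure_biUnion_finset (fun x hx y hy hxy => (hdisj hx hy hxy).mono inter_subset_left
          inter_subset_left) fun x _ => measurableSet_ball.inter hV, Finset.mul_sum]
    _ ≤ 4 * β * μ V := by
        gcongr
        exact iUnion₂_subset fun x _ => inter_subset_right

/-- The good-`λ` inequality, in place of an estimate for a sharp maximal function. The set where
`F > 6 ℓ` is covered by balls `5 B` such that `F > ℓ` on a fixed part of `B`, and on at most a
quarter of a doubling ball `S ⊇ 5 B`. Unless `H > ℓ` on another quarter of `S`, the representing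
numbers of `G` on `S` and on `5 B` are bounded by `4 ℓ`, so that `G` oscillates by at least `ℓ`
where `F > 6 ℓ` and `H ≤ ℓ`. -/
lemma Admissible.measure_lt_le [BorelSpace X] [SecondCountableTopology X] [Nonempty X]
    (h : Admissible μ lam α γ β) (hηα : 5 * η ≤ α) {G : X → ℂ}
    {F H : X → ℝ≥0∞} {K : ℝ} {ℓ : ℝ≥0} (hℓ : 0 < ℓ) (hK : 4 * (ENNReal.ofReal K * β) ≤ ℓ)
    (hG : RBMOBound μ lam η G K) (hF : Measurable F) (hH : Measurable H)
    (hGF : ∀ᵐ x ∂μ, ‖G x‖ₑ ≤ F x + H x) (hFG : ∀ᵐ x ∂μ, F x ≤ ‖G x‖ₑ + H x)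
    (hsmall : μ {x | (ℓ : ℝ≥0∞) < F x} < (4 * β : ℝ≥0∞)⁻¹ * μ univ) :
    μ {x | 6 * (ℓ : ℝ≥0∞) < F x} ≤ 4 * β * (ENNReal.ofReal K / ℓ) * μ {x | (ℓ : ℝ≥0∞) < F x} +
      (4 * β + 1) * μ {x | (ℓ : ℝ≥0∞) < H x} := by
  classical
  obtain ⟨-, m, hm, hmm⟩ := hG
  set k := ENNReal.ofReal K with hk
  set U := {x | (ℓ : ℝ≥0∞) < F x} with hU
  set V := {x | (ℓ : ℝ≥0∞) < H x} with hV
  have hUm : MeasurableSet U := measurableSet_lt measurable_const hF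
  have hVm : MeasurableSet V := measurableSet_lt measurable_const hH
  have hα := h.five_le
  have hβ1 : (1 : ℝ≥0∞) ≤ β := by exact_mod_cast h.one_le
  have hβ0 : (β : ℝ≥0∞) ≠ 0 := (one_pos.trans_le hβ1).ne'
  -- with this threshold, a centre of a doubling ball `S` that is not heavy at the radius of `S` has
  -- `F > ℓ` on at most a quarter of `S`
  set t : ℝ≥0∞ := (4 * β)⁻¹ with ht
  have h4β : (4 * β : ℝ≥0∞) ≠ 0 := mul_ne_zero (by norm_num) hβ0
  have h4β' : (4 * β : ℝ≥0∞) ≠ ∞ := ENNReal.mul_ne_top (by simp) (by simp)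
  have htβ : t * β = 4⁻¹ := by
    rw [ht, ENNReal.mul_inv (by simp) (by simp), mul_assoc, ENNReal.inv_mul_cancel hβ0 (by simp),
      mul_one]
  have hUfin : μ U ≠ ∞ := (hsmall.trans_le le_top).ne
  have hint : ∀ A : Set X, MeasurableSet A → ∫⁻ y in A, U.indicator 1 y ∂μ = μ (A ∩ U) := by
    intro A hA
    rw [lintegral_indicator_one hUm, Measure.restrict_apply hUm, inter_comm]
  set P : Set X := {x | ∃ r, 0 < r ∧ Heavy μ α (U.indicator 1) t x r} with hP
  have hPae : ∀ᵐ x ∂μ, x ∈ U → x ∈ P := h.ae_heavy hUm hUfin (by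
    rw [htβ]; exact ENNReal.inv_le_inv.2 (by norm_num))
  obtain ⟨x₀⟩ := ‹Nonempty X›
  have key : ∀ n : ℕ, μ ({x | 6 * (ℓ : ℝ≥0∞) < F x} ∩ P ∩ ball x₀ n) ≤
      4 * β * (k / ℓ) * μ U + (4 * β + 1) * μ V := by
    intro n
    refine ENNReal.le_of_forall_pos_le_add fun ε hε _ => ?_
    set D := {x | 6 * (ℓ : ℝ≥0∞) < F x} ∩ P ∩ ball x₀ n with hD
    obtain ⟨v, r, hv, hdisj, hcov⟩ := h.exists_balls (φ := U.indicator 1)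
      (ENNReal.inv_ne_zero.2 h4β') (ENNReal.inv_ne_top.2 h4β)
      (by rw [lintegral_indicator_one hUm]; exact hsmall) (D := D)
      (isBounded_ball.subset inter_subset_right) (fun x hx => hx.1.2)
      (ε := ε) (by exact_mod_cast hε.ne')
    have hball : ∀ x ∈ v, μ (ball x (α * r x)) ≤ 4 * β * μ (ball x (r x) ∩ U) := by
      intro x hx
      have := (hv x hx).2.1
      rw [Heavy, hint _ measurableSet_ball] at this
      calc μ (ball x (α * r x)) = 4 * β * (t * μ (ball x (α * r x))) := by
            rw [← mul_assoc, ENNReal.mul_inv_cancel h4β h4β', one_mul]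
        _ ≤ _ := by gcongr
    have hS : ∀ x ∈ v, ∃ s, 5 * r x ≤ s ∧ μ (ball x (5 * r x)) ≠ 0 ∧
        μ (ball x (γ * s)) ≤ β * μ (ball x s) ∧ μ (ball x s ∩ U) ≤ 4⁻¹ * μ (ball x s) ∧
        ∀ (h5 : 0 < 5 * r x) (hs : 0 < s),
          delta μ lam ⟨x, 5 * r x, h5⟩ ⟨x, s, hs⟩ ≤ β := by
      intro x hx
      obtain ⟨hr, hheavy, hlight⟩ := hv x hx
      have h5 : 0 < 5 * r x := by positivity
      have hne : μ (ball x (5 * r x)) ≠ 0 := by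
        rw [Heavy, hint _ measurableSet_ball] at hheavy
        refine (lt_of_lt_of_le (bot_le.trans_lt hheavy) (measure_mono ?_)).ne'
        exact inter_subset_left.trans (ball_subset_ball (by linarith))
      obtain ⟨⟨c, s, hs⟩, hc, hrs, hdoub, hδ⟩ := h.exists_doubling_ge ⟨x, 5 * r x, h5⟩ hne
      dsimp only at hc hrs
      subst hc
      refine ⟨s, hrs, hne, hdoub, ?_, fun _ _ => hδ⟩
      have hl := hlight s (by linarith)
      rw [Heavy, hint _ measurableSet_ball, not_lt] at hl
      calc μ (ball c s ∩ U) ≤ t * μ (ball c (α * s)) := hl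
        _ ≤ t * (β * μ (ball c s)) := by
            gcongr
            refine le_trans (measure_mono (ball_subset_ball ?_)) hdoub
            exact mul_le_mul_of_nonneg_right h.alpha_le_gamma hs.le
        _ = _ := by rw [← mul_assoc, htβ]
    choose! s hrs hne hdoub hlight hδ using hS
    have hrpos : ∀ x ∈ v, 0 < r x := fun x hx => (hv x hx).1
    have hspos : ∀ x ∈ v, 0 < s x := fun x hx => by
      have := hrpos x hx; have := hrs x hx; linarith
    set bad := v.filter fun x => μ (ball x (s x)) ≤ 4 * μ (ball x (s x) ∩ V) with hbad
    set good := v.filter fun x => ¬ μ (ball x (s x)) ≤ 4 * μ (ball x (s x) ∩ V) with hgood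
    have hbadμ : μ (⋃ x ∈ bad, ball x (s x)) ≤ 4 * β * μ V :=
      measure_biUnion_ball_le (by have := h.three_mul_le; linarith) bad s
        (fun x hx => hspos x (Finset.mem_filter.1 hx).1) hVm
        (fun x hx => hdoub x (Finset.mem_filter.1 hx).1) fun x hx => (Finset.mem_filter.1 hx).2
    have hgoodμ : ∀ x ∈ good, μ (ball x (5 * r x) ∩ ({x | 6 * (ℓ : ℝ≥0∞) < F x} \ V)) ≤
        4 * β * (k / ℓ) * μ (ball x (r x) ∩ U) := by
      intro x hx
      obtain ⟨hxv, hxV⟩ := Finset.mem_filter.1 hx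
      have hr := hrpos x hxv
      have hs := hspos x hxv
      set S : Ball X := ⟨x, s x, hs⟩ with hSdef
      set A : Ball X := ⟨x, 5 * r x, by positivity⟩ with hAdef
      have hAS : A.carrier ⊆ S.carrier := ball_subset_ball (hrs x hxv)
      have hmS : ‖m S‖ₑ ≤ 3 * ℓ := by
        refine enorm_le_of_oscillation_le (S := S) hℓ hK
          (γ := γ) (by have := h.alpha_le_gamma; linarith) hF hH hGF
          ?_ (h.measure_ball_lt_top _ _).ne (hdoub x hxv) (hm S) (hlight x hxv) ?_
        · exact fun h0 => hne x hxv (measure_mono_null hAS h0)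
        · rw [not_le] at hxV
          calc μ (S.carrier ∩ V) = 4⁻¹ * (4 * μ (S.carrier ∩ V)) := by
                rw [← mul_assoc, ENNReal.inv_mul_cancel (by simp) (by simp), one_mul]
            _ ≤ _ := by gcongr; exact hxV.le
      have hmA : ‖m A‖ₑ ≤ 4 * ℓ := by
        calc ‖m A‖ₑ = ‖(m A - m S) + m S‖ₑ := by rw [sub_add_cancel]
          _ ≤ ‖m A - m S‖ₑ + ‖m S‖ₑ := enorm_add_le _ _
          _ ≤ k * (1 + β) + 3 * ℓ := by
              gcongr
              exact (hmm A S hAS).trans (by gcongr; exact hδ x hxv _ _)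
          _ ≤ k * (β + β) + 3 * ℓ := by gcongr
          _ ≤ ℓ + 3 * ℓ := by
              gcongr
              refine le_trans ?_ hK
              calc k * (β + β) = 2 * (k * β) := by ring
                _ ≤ 4 * (k * β) := by gcongr; norm_num
          _ = 4 * ℓ := by ring
      have hℓ0 : (ℓ : ℝ≥0∞) ≠ 0 := by exact_mod_cast hℓ.ne'
      set W := ball x (5 * r x) ∩ ({x | 6 * (ℓ : ℝ≥0∞) < F x} \ V) with hW
      have hWm : MeasurableSet W :=
        measurableSet_ball.inter ((measurableSet_lt measurable_const hF).diff hVm)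
      have h1 : ℓ * μ W ≤ k * (4 * β * μ (ball x (r x) ∩ U)) := by
        calc ℓ * μ W = ∫⁻ _ in W, ℓ ∂μ := by simp
          _ ≤ ∫⁻ y in W, ‖G y - m A‖ₑ ∂μ := by
              refine setLIntegral_mono_ae' hWm ?_
              filter_upwards [hFG] with y hy hyW
              have hyF : 6 * (ℓ : ℝ≥0∞) < F y := hyW.2.1
              have hyH : H y ≤ ℓ := not_lt.1 hyW.2.2
              have h2 : (ℓ : ℝ≥0∞) + 5 * ℓ ≤ ‖G y - m A‖ₑ + 5 * ℓ := by
                calc (ℓ : ℝ≥0∞) + 5 * ℓ = 6 * ℓ := by ring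
                  _ ≤ F y := hyF.le
                  _ ≤ ‖(G y - m A) + m A‖ₑ + H y := by rwa [sub_add_cancel]
                  _ ≤ (‖G y - m A‖ₑ + 4 * ℓ) + ℓ := by
                      gcongr
                      exact (enorm_add_le _ _).trans (by gcongr)
                  _ = _ := by ring
              exact (ENNReal.add_le_add_iff_right (ENNReal.mul_ne_top (by simp) (by simp))).1 h2
          _ ≤ ∫⁻ y in A.carrier, ‖G y - m A‖ₑ ∂μ := lintegral_mono_set inter_subset_left
          _ ≤ k * μ (A.dilate η) := hm A
          _ ≤ k * μ (ball x (α * r x)) := by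
              gcongr
              refine ball_subset_ball ?_
              change η * (5 * r x) ≤ α * r x
              calc η * (5 * r x) = 5 * η * r x := by ring
                _ ≤ _ := by gcongr
          _ ≤ _ := by gcongr; exact hball x hxv
      calc μ W = (ℓ : ℝ≥0∞)⁻¹ * (ℓ * μ W) := by
            rw [← mul_assoc, ENNReal.inv_mul_cancel hℓ0 (by simp), one_mul]
        _ ≤ (ℓ : ℝ≥0∞)⁻¹ * (k * (4 * β * μ (ball x (r x) ∩ U))) := by gcongr
        _ = _ := by rw [div_eq_mul_inv]; ring
    have hcover : D ⊆ (D \ ⋃ x ∈ v, ball x (5 * r x)) ∪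
        ((⋃ x ∈ good, ball x (5 * r x) ∩ ({x | 6 * (ℓ : ℝ≥0∞) < F x} \ V)) ∪
          ((⋃ x ∈ bad, ball x (s x)) ∪ V)) := by
      intro y hy
      by_cases hyv : y ∈ ⋃ x ∈ v, ball x (5 * r x)
      · obtain ⟨x, hx, hyx⟩ := mem_iUnion₂.1 hyv
        by_cases hyV : y ∈ V
        · exact Or.inr (Or.inr (Or.inr hyV))
        by_cases hxb : μ (ball x (s x)) ≤ 4 * μ (ball x (s x) ∩ V)
        · exact Or.inr (Or.inr (Or.inl (mem_iUnion₂.2 ⟨x, Finset.mem_filter.2 ⟨hx, hxb⟩,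
            ball_subset_ball (hrs x hx) hyx⟩)))
        · exact Or.inr (Or.inl (mem_iUnion₂.2 ⟨x, Finset.mem_filter.2 ⟨hx, hxb⟩,
            hyx, hy.1.1, hyV⟩))
      · exact Or.inl ⟨hy, hyv⟩
    calc μ D ≤ ε + (∑ x ∈ good, 4 * β * (k / ℓ) * μ (ball x (r x) ∩ U) +
          (4 * β * μ V + μ V)) := by
          refine (measure_mono hcover).trans ((measure_union_le _ _).trans
            (add_le_add hcov ((measure_union_le _ _).trans (add_le_add ?_
              ((measure_union_le _ _).trans (add_le_add hbadμ le_rfl))))))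
          exact (measure_biUnion_finset_le _ _).trans (Finset.sum_le_sum hgoodμ)
      _ ≤ ε + (4 * β * (k / ℓ) * μ U + (4 * β * μ V + μ V)) := by
          gcongr
          rw [← Finset.mul_sum, ← measure_biUnion_finset (fun x hx y hy hxy =>
            (hdisj (Finset.mem_filter.1 hx).1 (Finset.mem_filter.1 hy).1 hxy).mono
              inter_subset_left inter_subset_left) fun x _ => measurableSet_ball.inter hUm]
          gcongr
          exact iUnion₂_subset fun x _ => inter_subset_right
      _ = _ := by ring
  have hmono : Monotone fun n : ℕ => {x | 6 * (ℓ : ℝ≥0∞) < F x} ∩ P ∩ ball x₀ n := fun i j hij =>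
    inter_subset_inter_right _ (ball_subset_ball (by exact_mod_cast hij))
  calc μ {x | 6 * (ℓ : ℝ≥0∞) < F x}
      ≤ μ (⋃ n : ℕ, {x | 6 * (ℓ : ℝ≥0∞) < F x} ∩ P ∩ ball x₀ n) := by
        refine measure_mono_ae ?_
        filter_upwards [hPae] with x hxP hx
        rw [← inter_iUnion, iUnion_ball_nat]
        refine ⟨⟨hx, hxP ?_⟩, mem_univ x⟩
        have hx' : 6 * (ℓ : ℝ≥0∞) < F x := hx
        refine lt_of_le_of_lt ?_ hx'
        exact le_mul_of_one_le_left bot_le (by norm_num)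
    _ = ⨆ n : ℕ, μ ({x | 6 * (ℓ : ℝ≥0∞) < F x} ∩ P ∩ ball x₀ n) := hmono.measure_iUnion
    _ ≤ _ := iSup_le key

end NonHom

namespace NonHom

open Set Metric Filter

/-! ### Integration of distribution functions -/

/-- The layer cake formula for powers of functions with values in `ℝ≥0`. -/
lemma lintegral_coe_rpow_eq {X : Type*} [MeasurableSpace X] (μ : Measure X) {F : X → ℝ≥0}
    (hF : Measurable F) {p : ℝ} (hp : 0 < p) :
    ∫⁻ x, (F x : ℝ≥0∞) ^ p ∂μ =
      ENNReal.ofReal p * ∫⁻ t in Ioi (0 : ℝ), μ {x | t.toNNReal < F x} *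
        ENNReal.ofReal (t ^ (p - 1)) := by
  have h := lintegral_rpow_eq_lintegral_meas_lt_mul μ (f := fun x => (F x : ℝ))
    (Eventually.of_forall fun x => (F x).2) hF.coe_nnreal_real.aemeasurable hp
  calc ∫⁻ x, (F x : ℝ≥0∞) ^ p ∂μ = ∫⁻ x, ENNReal.ofReal ((F x : ℝ) ^ p) ∂μ := by
        refine lintegral_congr fun x => ?_
        rw [← ENNReal.ofReal_rpow_of_nonneg (NNReal.coe_nonneg _) hp.le, ENNReal.ofReal_coe_nnreal]
    _ = _ := h
    _ = _ := by
        congr 1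
        refine setLIntegral_congr_fun measurableSet_Ioi fun t ht => ?_
        have ht0 : (0 : ℝ) < t := ht
        have : {x | t < (F x : ℝ)} = {x | t.toNNReal < F x} := by
          ext x
          change t < (F x : ℝ) ↔ t.toNNReal < F x
          rw [← NNReal.coe_lt_coe, Real.coe_toNNReal _ ht0.le]
        simp only [this]

/-- A function in weak `L¹` that satisfies a good-`λ` inequality with small relative constant `κ`
is in `L^p`. The weak `L¹` bound makes the integrals of the truncations of `F` finite, so that the
term with `κ` can be absorbed. -/
lemma lintegral_rpow_le_of_measure_lt_le {X : Type*} [MeasurableSpace X] {μ : Measure X}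
    {F φ : X → ℝ≥0} (hF : Measurable F) (hφ : Measurable φ) {p s : ℝ} (hp : 1 < p) (hsp : s < p)
    (hs : 0 < s)
    {κ Q a t₀ : ℝ≥0} (ha : 0 < a) (hκ : (6 : ℝ≥0∞) ^ p * κ ≤ 2⁻¹) {W : ℝ≥0∞} (hW : W ≠ ∞)
    (hweak : ∀ t : ℝ≥0, (t : ℝ≥0∞) * μ {x | t < F x} ≤ W)
    (hgood : ∀ t : ℝ≥0, 0 < t → t₀ ≤ t → μ {x | 6 * t < F x} ≤ κ * μ {x | t < F x} +
      Q * (t : ℝ≥0∞) ^ (-s) * ∫⁻ x in {x | a * t < φ x}, (φ x : ℝ≥0∞) ^ s ∂μ) :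
    ∫⁻ x, (F x : ℝ≥0∞) ^ p ∂μ ≤ 2 * 6 ^ p * ((t₀ : ℝ≥0∞) ^ p * μ univ +
      ENNReal.ofReal p * Q * ((ENNReal.ofReal (p - s))⁻¹ * (a : ℝ≥0∞) ^ (s - p)) *
        ∫⁻ x, (φ x : ℝ≥0∞) ^ p ∂μ) := by
  have hp0 : 0 < p := by linarith
  set ν := μ.withDensity fun x => (φ x : ℝ≥0∞) ^ s with hν
  have hν_apply : ∀ t : ℝ≥0, ∫⁻ x in {x | a * t < φ x}, (φ x : ℝ≥0∞) ^ s ∂μ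
      = ν {x | t < φ x / a} := by
    intro t
    have : {x | t < φ x / a} = {x | a * t < φ x} := by
      ext x
      change t < φ x / a ↔ a * t < φ x
      rw [lt_div_iff₀ ha, mul_comm]
    rw [this, hν, withDensity_apply _ (measurableSet_lt measurable_const hφ)]
  have hps : 0 < p - s := by linarith
  have hErr : ∫⁻ t in Ioi (0 : ℝ), ν {x | t.toNNReal < φ x / a} * ENNReal.ofReal (t ^ (p - s - 1))
      = (ENNReal.ofReal (p - s))⁻¹ * (a : ℝ≥0∞) ^ (s - p) * ∫⁻ x, (φ x : ℝ≥0∞) ^ p ∂μ := by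
    have h1 := lintegral_coe_rpow_eq ν (hφ.div_const a) hps
    have h2 : ∫⁻ x, ((φ x / a : ℝ≥0) : ℝ≥0∞) ^ (p - s) ∂ν
        = (a : ℝ≥0∞) ^ (s - p) * ∫⁻ x, (φ x : ℝ≥0∞) ^ p ∂μ := by
      rw [hν, lintegral_withDensity_eq_lintegral_mul _ (by fun_prop) (by fun_prop),
        ← lintegral_const_mul _ (by fun_prop)]
      refine lintegral_congr fun x => ?_
      simp only [Pi.mul_apply]
      rw [div_eq_mul_inv, ENNReal.coe_mul, ENNReal.mul_rpow_of_nonneg _ _ hps.le,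
        ENNReal.coe_inv ha.ne', ENNReal.inv_rpow, ← ENNReal.rpow_neg, neg_sub, ← mul_assoc,
        ← ENNReal.rpow_add_of_nonneg _ _ hs.le hps.le, add_sub_cancel, mul_comm]
    rw [mul_assoc, ← h2, h1, ← mul_assoc, ENNReal.inv_mul_cancel (by simpa using hsp) (by simp),
      one_mul]
  set R := (t₀ : ℝ≥0∞) ^ p * μ univ +
      ENNReal.ofReal p * Q * ((ENNReal.ofReal (p - s))⁻¹ * (a : ℝ≥0∞) ^ (s - p)) *
        ∫⁻ x, (φ x : ℝ≥0∞) ^ p ∂μ with hR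
  -- the truncations of `F`
  set J : ℝ≥0 → ℝ≥0∞ := fun L => ∫⁻ x, ((min (F x) L : ℝ≥0) : ℝ≥0∞) ^ p ∂μ with hJ
  have hJfin : ∀ L, J L ≠ ∞ := by
    intro L
    rw [hJ]
    dsimp only
    rw [lintegral_coe_rpow_eq μ (hF.min measurable_const) hp0]
    refine ENNReal.mul_ne_top (by simp) (ne_of_lt ?_)
    calc ∫⁻ t in Ioi (0 : ℝ), μ {x | t.toNNReal < min (F x) L} * ENNReal.ofReal (t ^ (p - 1))
        ≤ ∫⁻ t in Ioi (0 : ℝ), (Ioc (0 : ℝ) L).indicator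
            (fun t => W * ENNReal.ofReal (t ^ (p - 2))) t := by
          refine setLIntegral_mono' measurableSet_Ioi fun t ht => ?_
          have ht0 : (0 : ℝ) < t := ht
          by_cases htL : t ≤ L
          · rw [indicator_of_mem (show t ∈ Ioc (0 : ℝ) L from ⟨ht0, htL⟩)]
            have h1 : t ^ (p - 1) = t * t ^ (p - 2) := by
              rw [← Real.rpow_one_add' ht0.le (by linarith)]; congr 1; ring
            rw [h1, ENNReal.ofReal_mul ht0.le, ← mul_assoc]
            gcongr
            refine le_trans ?_ (hweak t.toNNReal)
            rw [mul_comm]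
            refine mul_le_mul' le_rfl (measure_mono fun x hx => ?_)
            exact (lt_min_iff.1 (show t.toNNReal < min (F x) L from hx)).1
          · have : {x | t.toNNReal < min (F x) L} = ∅ := by
              refine eq_empty_of_forall_notMem fun x hx => ?_
              have h1 := (lt_min_iff.1 (show t.toNNReal < min (F x) L from hx)).2
              rw [Real.toNNReal_lt_iff_lt_coe ht0.le] at h1
              exact htL h1.le
            rw [this, measure_empty, zero_mul]
            exact bot_le
      _ ≤ ∫⁻ t in Ioc (0 : ℝ) L, W * ENNReal.ofReal (t ^ (p - 2)) := by
          refine (setLIntegral_le_lintegral _ _).trans (le_of_eq ?_)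
          rw [lintegral_indicator measurableSet_Ioc]
      _ = W * ∫⁻ t in Ioc (0 : ℝ) L, ENNReal.ofReal (t ^ (p - 2)) := by
          rw [lintegral_const_mul' _ _ hW]
      _ < ∞ := by
          refine ENNReal.mul_lt_top hW.lt_top ?_
          have := (intervalIntegral.intervalIntegrable_rpow' (a := 0) (b := L)
            (show -1 < p - 2 by linarith)).1
          exact this.lintegral_lt_top
  have hstep : ∀ L, J (6 * L) ≤ 6 ^ p * (κ * J L + R) := by
    intro L
    have h6 : J (6 * L) = 6 ^ p * ∫⁻ x, ((min (F x) (6 * L) / 6 : ℝ≥0) : ℝ≥0∞) ^ p ∂μ := by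
      rw [hJ]
      dsimp only
      rw [← lintegral_const_mul _ (by fun_prop)]
      refine lintegral_congr fun x => ?_
      rw [← ENNReal.mul_rpow_of_nonneg _ _ hp0.le]
      congr 1
      rw [← ENNReal.coe_ofNat, ← ENNReal.coe_mul, mul_div_cancel₀ _ (by norm_num)]
    rw [h6]
    gcongr
    have hmeas : Measurable fun x => min (F x) (6 * L) / 6 := by fun_prop
    rw [lintegral_coe_rpow_eq μ hmeas hp0]
    have hpt : ∀ t ∈ Ioi (0 : ℝ), μ {x | t.toNNReal < min (F x) (6 * L) / 6} *
          ENNReal.ofReal (t ^ (p - 1)) ≤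
        (Ioo (0 : ℝ) t₀).indicator (fun t => μ univ * ENNReal.ofReal (t ^ (p - 1))) t +
        (κ * (μ {x | t.toNNReal < min (F x) L} * ENNReal.ofReal (t ^ (p - 1))) +
        Q * (ν {x | t.toNNReal < φ x / a} * ENNReal.ofReal (t ^ (p - s - 1)))) := by
      intro t ht
      have ht0 : (0 : ℝ) < t := ht
      by_cases htt : t < t₀
      · rw [indicator_of_mem (show t ∈ Ioo (0 : ℝ) t₀ from ⟨ht0, htt⟩)]
        refine le_trans ?_ le_self_add
        gcongr
        exact subset_univ _
      refine le_trans ?_ le_add_self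
      have hsub : {x | t.toNNReal < min (F x) (6 * L) / 6} ⊆ {x | 6 * t.toNNReal < F x} := by
        intro x hx
        have h1 : t.toNNReal < min (F x) (6 * L) / 6 := hx
        rw [lt_div_iff₀ (by norm_num)] at h1
        have h2 := (lt_min_iff.1 h1).1
        change 6 * t.toNNReal < F x
        rwa [mul_comm]
      by_cases htL : t.toNNReal < L
      · have hg := hgood t.toNNReal (by simpa using ht0) (by
          rw [← NNReal.coe_le_coe, Real.coe_toNNReal _ ht0.le]; exact not_lt.1 htt)
        rw [hν_apply] at hg
        have hset : {x | t.toNNReal < min (F x) L} = {x | t.toNNReal < F x} := by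
          ext x
          change t.toNNReal < min (F x) L ↔ t.toNNReal < F x
          rw [lt_min_iff]
          exact ⟨fun h => h.1, fun h => ⟨h, htL⟩⟩
        rw [hset]
        calc _ ≤ (κ * μ {x | t.toNNReal < F x} +
              Q * (t.toNNReal : ℝ≥0∞) ^ (-s) * ν {x | t.toNNReal < φ x / a}) *
              ENNReal.ofReal (t ^ (p - 1)) := by
              gcongr
              exact (measure_mono hsub).trans hg
          _ = κ * (μ {x | t.toNNReal < F x} * ENNReal.ofReal (t ^ (p - 1))) +
              Q * (ν {x | t.toNNReal < φ x / a} *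
                ((t.toNNReal : ℝ≥0∞) ^ (-s) * ENNReal.ofReal (t ^ (p - 1)))) := by ring
          _ = _ := by
              congr 4
              change ENNReal.ofReal t ^ (-s) * _ = _
              rw [ENNReal.ofReal_rpow_of_pos ht0, ← ENNReal.ofReal_mul (by positivity),
                ← Real.rpow_add ht0]
              congr 2
              ring
      · have : {x | t.toNNReal < min (F x) (6 * L) / 6} = ∅ := by
          refine eq_empty_of_forall_notMem fun x hx => htL ?_
          have h1 : t.toNNReal < min (F x) (6 * L) / 6 := hx
          rw [lt_div_iff₀ (by norm_num)] at h1
          have h2 := (lt_min_iff.1 h1).2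
          rw [mul_comm] at h2
          exact lt_of_mul_lt_mul_left h2 bot_le
        simp [this]
    have hmeasμ : ∀ (G : X → ℝ≥0) (ξ : Measure X),
        Measurable fun t : ℝ => ξ {x | t.toNNReal < G x} := fun G ξ =>
      Antitone.measurable fun t t' htt => measure_mono fun x hx =>
        (Real.toNNReal_le_toNNReal htt).trans_lt hx
    calc ENNReal.ofReal p * ∫⁻ t in Ioi (0 : ℝ), μ {x | t.toNNReal < min (F x) (6 * L) / 6} *
            ENNReal.ofReal (t ^ (p - 1))
        ≤ ENNReal.ofReal p * ∫⁻ t in Ioi (0 : ℝ),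
            ((Ioo (0 : ℝ) t₀).indicator (fun t => μ univ * ENNReal.ofReal (t ^ (p - 1))) t +
            (κ * (μ {x | t.toNNReal < min (F x) L} * ENNReal.ofReal (t ^ (p - 1))) +
            Q * (ν {x | t.toNNReal < φ x / a} * ENNReal.ofReal (t ^ (p - s - 1))))) :=
          mul_le_mul' le_rfl (setLIntegral_mono' measurableSet_Ioi hpt)
      _ = ENNReal.ofReal p * (∫⁻ t in Ioi (0 : ℝ), (Ioo (0 : ℝ) t₀).indicator
              (fun t => μ univ * ENNReal.ofReal (t ^ (p - 1))) t) +
          (κ * J L + Q * (ENNReal.ofReal p * ((ENNReal.ofReal (p - s))⁻¹ *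
            (a : ℝ≥0∞) ^ (s - p) * ∫⁻ x, (φ x : ℝ≥0∞) ^ p ∂μ))) := by
          have hm1 : Measurable fun t : ℝ => κ * (μ {x | t.toNNReal < min (F x) L} *
              ENNReal.ofReal (t ^ (p - 1))) :=
            ((hmeasμ _ _).mul (by fun_prop)).const_mul _
          rw [lintegral_add_left ((by fun_prop : Measurable fun t : ℝ =>
              μ univ * ENNReal.ofReal (t ^ (p - 1))).indicator measurableSet_Ioo),
            lintegral_add_left hm1, lintegral_const_mul' _ _ (by simp),
            lintegral_const_mul' _ _ (by simp), hErr, hJ]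
          dsimp only
          rw [lintegral_coe_rpow_eq μ (hF.min measurable_const) hp0]
          ring
      _ ≤ (t₀ : ℝ≥0∞) ^ p * μ univ + (κ * J L + Q * (ENNReal.ofReal p *
            ((ENNReal.ofReal (p - s))⁻¹ * (a : ℝ≥0∞) ^ (s - p) *
              ∫⁻ x, (φ x : ℝ≥0∞) ^ p ∂μ))) := by
          refine add_le_add ?_ le_rfl
          have h2 := lintegral_coe_rpow_eq μ (F := fun _ => t₀) measurable_const hp0
          rw [lintegral_const] at h2
          rw [h2]
          refine mul_le_mul' le_rfl (setLIntegral_mono' measurableSet_Ioi fun t ht => ?_)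
          by_cases htt : t ∈ Ioo (0 : ℝ) t₀
          · rw [indicator_of_mem htt]
            gcongr
            intro x _
            exact (Real.toNNReal_lt_iff_lt_coe htt.1.le).2 htt.2
          · rw [indicator_of_notMem htt]
            exact bot_le
      _ = _ := by rw [hR]; ring
  have hJL : ∀ L, J L ≤ 2 * 6 ^ p * R := by
    intro L
    have h1 : J L ≤ 2⁻¹ * J L + 6 ^ p * R := by
      calc J L ≤ J (6 * L) := by
            refine lintegral_mono fun x => ?_
            dsimp only
            gcongr
            exact le_mul_of_one_le_left bot_le (by norm_num)
        _ ≤ 6 ^ p * (κ * J L + R) := hstep L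
        _ = (6 ^ p * κ) * J L + 6 ^ p * R := by ring
        _ ≤ _ := by gcongr
    have h2 : J L = 2⁻¹ * J L + 2⁻¹ * J L := by
      rw [← add_mul, ENNReal.inv_two_add_inv_two, one_mul]
    have h3 : 2⁻¹ * J L ≤ 6 ^ p * R := by
      rw [h2] at h1
      have h4 : 2⁻¹ * (2⁻¹ * J L + 2⁻¹ * J L) = 2⁻¹ * J L := by rw [← h2]
      rw [h4] at h1
      exact (ENNReal.add_le_add_iff_left (ENNReal.mul_ne_top (by simp) (hJfin L))).1 h1
    calc J L = 2 * (2⁻¹ * J L) := by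
          rw [← mul_assoc, ENNReal.mul_inv_cancel (by simp) (by simp), one_mul]
      _ ≤ 2 * (6 ^ p * R) := by gcongr
      _ = _ := by ring
  have hlim : ∫⁻ x, (F x : ℝ≥0∞) ^ p ∂μ = ⨆ n : ℕ, J n := by
    rw [hJ, ← lintegral_iSup (fun n => by fun_prop) (fun i j hij x => by
      dsimp only; gcongr)]
    refine lintegral_congr fun x =>
      le_antisymm ?_ (iSup_le fun n => by gcongr; exact min_le_left _ _)
    obtain ⟨n, hn⟩ := exists_nat_ge (F x)
    refine le_iSup_of_le n ?_
    rw [min_eq_left hn]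
  rw [hlim]
  exact iSup_le fun n => hJL n

/-- Chebyshev's inequality for the integral of `|f| ^ s` over the set `|f| > ℓ`. -/
lemma rpow_mul_setLIntegral_le {X : Type*} [MeasurableSpace X] {μ : Measure X} {f : X → ℂ}
    {p s : ℝ} (hs : 0 ≤ s) (hsp : s ≤ p) (ℓ : ℝ≥0∞)
    (hℓ : ℓ ≠ ∞) (hf : AEMeasurable f μ) :
    ℓ ^ (p - s) * ∫⁻ x in {x | ℓ < ‖f x‖ₑ}, ‖f x‖ₑ ^ s ∂μ ≤ ∫⁻ x, ‖f x‖ₑ ^ p ∂μ := by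
  rw [← lintegral_const_mul' _ _ (ENNReal.rpow_ne_top_of_nonneg (by linarith) hℓ)]
  refine le_trans (lintegral_mono_ae (g := fun x => ‖f x‖ₑ ^ p) ?_)
    (setLIntegral_le_lintegral {x | ℓ < ‖f x‖ₑ} _)
  refine (ae_restrict_iff'₀ (nullMeasurableSet_lt aemeasurable_const hf.enorm)).2
    (Eventually.of_forall fun x hx => ?_)
  have hx' : ℓ < ‖f x‖ₑ := hx
  calc ℓ ^ (p - s) * ‖f x‖ₑ ^ s ≤ ‖f x‖ₑ ^ (p - s) * ‖f x‖ₑ ^ s := by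
        gcongr
    _ = ‖f x‖ₑ ^ p := by
        rw [← ENNReal.rpow_add_of_nonneg _ _ (by linarith) hs, sub_add_cancel]

/-- `|T f|` changes by at most `|T b|` when `b` is subtracted from `f`. -/
lemma IsSublinearOn.enorm_le_add {X : Type*} [MeasurableSpace X] {μ : Measure X}
    {T : (X →ₘ[μ] ℂ) → (X →ₘ[μ] ℂ)} {D : Set (X →ₘ[μ] ℂ)} (hT : IsSublinearOn D T)
    {f g b : X →ₘ[μ] ℂ} (hf : f ∈ D) (hg : g ∈ D) (hb : b ∈ D) (hb' : (-1 : ℂ) • b ∈ D)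
    (hfgb : f = g + b) :
    (∀ᵐ x ∂μ, ‖T f x‖ₑ ≤ ‖T g x‖ₑ + ‖T b x‖ₑ) ∧ ∀ᵐ x ∂μ, ‖T g x‖ₑ ≤ ‖T f x‖ₑ + ‖T b x‖ₑ := by
  constructor
  · filter_upwards [hT.1 g hg b hb] with x hx
    rw [hfgb]
    simp only [← ofReal_norm]
    rw [← ENNReal.ofReal_add (norm_nonneg _) (norm_nonneg _)]
    exact ENNReal.ofReal_le_ofReal hx
  · have hgf : g = f + (-1 : ℂ) • b := by
      refine AEEqFun.ext ?_
      filter_upwards [AEEqFun.coeFn_add f ((-1 : ℂ) • b), AEEqFun.coeFn_smul (-1 : ℂ) b,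
        AEEqFun.coeFn_add g b] with x h1 h2 h3
      rw [h1, Pi.add_apply, h2, hfgb, h3]
      simp
    filter_upwards [hT.1 f hf _ hb', hT.2 (-1) b hb] with x hx hx'
    rw [← hgf, hx', norm_neg, norm_one, one_mul] at hx
    simp only [← ofReal_norm]
    rw [← ENNReal.ofReal_add (norm_nonneg _) (norm_nonneg _)]
    exact ENNReal.ofReal_le_ofReal hx

end NonHom

namespace NonHom

open Set Metric Filter

variable {X : Type*} [MetricSpace X] [MeasurableSpace X] {μ : Measure X} {lam : X → ℝ → ℝ}
  {α γ η ρ : ℝ} {β : ℝ≥0} {q : ℝ≥0∞} {T : (X →ₘ[μ] ℂ) → (X →ₘ[μ] ℂ)}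

/-! ### The a priori estimate in `L^p` -/

/-- The infimum that defines the `RBMO` norm need not be attained; a positive bound `A` for `g`
leaves room for an actual `RBMO` constant. -/
lemma BoundedLinftyRBMO.exists_bound (hT : BoundedLinftyRBMO μ lam η T) :
    ∃ C : ℝ≥0, ∀ (g : X →ₘ[μ] ℂ) (A : ℝ≥0), 0 < A → (∀ᵐ x ∂μ, ‖g x‖ₑ ≤ A) →
      (∀ B : Ball X, IntegrableOn (T g) B.carrier μ) ∧
        ∃ K : ℝ, RBMOBound μ lam η (T g) K ∧ ENNReal.ofReal K ≤ (C * A : ℝ≥0) := by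
  obtain ⟨C₀, hC₀⟩ := hT
  refine ⟨C₀.toNNReal + 1, fun g A hA hg => ?_⟩
  have hnorm : eLpNorm g ∞ μ ≤ A := by
    rw [eLpNorm_exponent_top]
    exact essSup_le_of_ae_le _ hg
  have hmem : g ∈ Lp ℂ ∞ μ :=
    Lp.mem_Lp_iff_eLpNorm_lt_top.2 (hnorm.trans_lt ENNReal.coe_lt_top)
  obtain ⟨⟨hint, C', hC'⟩, hle⟩ := hC₀ g hmem
  refine ⟨hint, ?_⟩
  have hlt : rbmoNorm μ lam η (T g) < ((C₀.toNNReal + 1) * A : ℝ≥0) := by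
    have h1 : (eLpNorm g ∞ μ).toReal ≤ A := by
      simpa using ENNReal.toReal_mono ENNReal.coe_ne_top hnorm
    calc rbmoNorm μ lam η (T g) ≤ C₀ * (eLpNorm g ∞ μ).toReal := hle
      _ ≤ C₀.toNNReal * A := by
          gcongr
          exact Real.le_coe_toNNReal C₀
      _ < (C₀.toNNReal + 1) * A := by
          have : (0 : ℝ) < A := hA
          gcongr
          linarith
      _ = _ := by push_cast; rfl
  obtain ⟨K, hK, hKlt⟩ := exists_lt_of_csInf_lt ⟨C', hC'⟩ hlt
  refine ⟨K, hK, ?_⟩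
  rw [ENNReal.ofReal_le_iff_le_toReal ENNReal.coe_ne_top]
  exact hKlt.le

lemma BoundedH1WeakL1.exists_bound [OpensMeasurableSpace X] (hT : BoundedH1WeakL1 μ lam ρ q T)
    (hfin : ∀ x r, μ (ball x r) < ∞) (hρ : 1 ≤ ρ) (hq : 1 < q) :
    ∃ C : ℝ≥0, ∀ (b : X →ₘ[μ] ℂ) (w : ℝ≥0∞), w ≠ ∞ → H1Le μ lam ρ q b w →
      ∀ t : ℝ≥0, t * μ {x | (t : ℝ≥0∞) < ‖T b x‖ₑ} ≤ C * w := by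
  obtain ⟨C₀, hC₀⟩ := hT
  refine ⟨C₀.toNNReal, fun b w hw hb t => ?_⟩
  obtain ⟨hmem, hnorm⟩ := hb.memH1 hfin hρ hq hw
  have hset : {x | (t : ℝ≥0∞) < ‖T b x‖ₑ} = {x | (t : ℝ) < ‖T b x‖} := by
    ext x
    change (t : ℝ≥0∞) < (‖T b x‖₊ : ℝ≥0∞) ↔ (t : ℝ) < (‖T b x‖₊ : ℝ)
    rw [ENNReal.coe_lt_coe, NNReal.coe_lt_coe]
  have hnn : 0 ≤ h1Norm μ lam ρ q b := by
    refine Real.sInf_nonneg fun C hC => ?_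
    obtain ⟨b', v, hb', hv, -⟩ := hC
    exact hv.nonneg fun j => (hb' j).nonneg
  calc t * μ {x | (t : ℝ≥0∞) < ‖T b x‖ₑ} ≤ weakL1Norm μ (T b) := by
        rw [hset]
        exact le_iSup (fun t : ℝ≥0 => (t : ℝ≥0∞) * μ {x | (t : ℝ) < ‖T b x‖}) t
    _ ≤ ENNReal.ofReal (C₀ * h1Norm μ lam ρ q b) := hC₀ b hmem
    _ ≤ ENNReal.ofReal (C₀.toNNReal * w.toReal) := by
        refine ENNReal.ofReal_le_ofReal ?_
        gcongr
        exact Real.le_coe_toNNReal C₀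
    _ = C₀.toNNReal * w := by
        rw [ENNReal.ofReal_mul (by positivity), ENNReal.ofReal_toReal hw,
          ENNReal.ofReal_coe_nnreal]

lemma mem_linftyAddH1 {f g b : X →ₘ[μ] ℂ} {A : ℝ≥0} (hg : ∀ᵐ x ∂μ, ‖g x‖ₑ ≤ A)
    (hb : MemH1 μ lam ρ q b) (hf : f = g + b) : f ∈ linftyAddH1 μ lam ρ q := by
  refine ⟨g, b, Lp.mem_Lp_iff_eLpNorm_lt_top.2 (lt_of_le_of_lt ?_ (ENNReal.coe_lt_top (r := A))),
    hb, hf⟩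
  rw [eLpNorm_exponent_top]
  exact essSup_le_of_ae_le _ hg

lemma MemH1.mem_linftyAddH1 {b : X →ₘ[μ] ℂ} (hb : MemH1 μ lam ρ q b) :
    b ∈ linftyAddH1 μ lam ρ q := by
  refine NonHom.mem_linftyAddH1 (g := 0) (A := 0) ?_ hb (zero_add b).symm
  filter_upwards [AEEqFun.coeFn_zero (α := X) (β := ℂ) (μ := μ)] with x hx
  simp [hx]

lemma MemH1.neg [OpensMeasurableSpace X] (hfin : ∀ x r, μ (ball x r) < ∞) (hρ : 1 ≤ ρ)
    (hq : 1 < q) {b : X →ₘ[μ] ℂ} (hb : MemH1 μ lam ρ q b) :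
    MemH1 μ lam ρ q ((-1 : ℂ) • b : X →ₘ[μ] ℂ) := by
  obtain ⟨w, hw, hbw⟩ := hb.exists_h1Le
  exact (((hbw.const_smul (-1)).congr (AEEqFun.coeFn_smul (-1 : ℂ) b).symm).memH1 hfin hρ hq
    (ENNReal.mul_ne_top enorm_ne_top hw)).1

/-- A decomposition of `f` splits `f` within `L^∞(μ) + H¹(μ)`, so that it can be combined with the
sublinearity of `T`. -/
lemma HasDecomposition.exists_split [OpensMeasurableSpace X] [Nonempty X]
    (hfin : ∀ x r, μ (ball x r) < ∞) (hρ : 1 ≤ ρ) (hq : 1 < q)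
    (hT : IsSublinearOn (linftyAddH1 μ lam ρ q) T) {f : X →ₘ[μ] ℂ} {a : ℝ≥0} {m w : ℝ≥0∞}
    (hw : w ≠ ∞) (hf : HasDecomposition μ lam ρ q f a m w) :
    ∃ g b : X →ₘ[μ] ℂ, f = g + b ∧ (∀ᵐ x ∂μ, ‖g x‖ₑ ≤ a) ∧ H1Le μ lam ρ q b w ∧
      f ∈ linftyAddH1 μ lam ρ q ∧ (∀ᵐ x ∂μ, ‖T f x‖ₑ ≤ ‖T g x‖ₑ + ‖T b x‖ₑ) ∧
        ∀ᵐ x ∂μ, ‖T g x‖ₑ ≤ ‖T f x‖ₑ + ‖T b x‖ₑ := by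
  obtain ⟨g, b, hg, hfgb, hga, -, hb⟩ := hf
  have hbm := hb.aestronglyMeasurable
  have hg' := AEEqFun.coeFn_mk g hg
  have hb' := AEEqFun.coeFn_mk b hbm
  have heq : f = AEEqFun.mk g hg + AEEqFun.mk b hbm := by
    refine AEEqFun.ext ?_
    filter_upwards [hfgb, AEEqFun.coeFn_add (AEEqFun.mk g hg) (AEEqFun.mk b hbm), hg', hb'] with
      x h1 h2 h3 h4
    rw [h2, Pi.add_apply, h1, h3, h4]
  have hga' : ∀ᵐ x ∂μ, ‖AEEqFun.mk g hg x‖ₑ ≤ a := by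
    filter_upwards [hga, hg'] with x h1 h2
    rwa [h2]
  have hbw : H1Le μ lam ρ q (AEEqFun.mk b hbm) w := hb.congr hb'.symm
  have hbm1 := (hbw.memH1 hfin hρ hq hw).1
  have hzero : MemH1 μ lam ρ q (0 : X →ₘ[μ] ℂ) :=
    (((H1Le.zero 0).congr AEEqFun.coeFn_zero.symm).memH1 hfin hρ hq ENNReal.zero_ne_top).1
  have hfD := mem_linftyAddH1 hga' hbm1 heq
  obtain ⟨h1, h2⟩ := hT.enorm_le_add hfD (mem_linftyAddH1 hga' hzero (add_zero _).symm)
    hbm1.mem_linftyAddH1 (hbm1.neg hfin hρ hq).mem_linftyAddH1 heq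
  exact ⟨_, _, heq, hga', hbw, hfD, h1, h2⟩

/-- The `L^p` estimate for `T f`, given that `T f` is in weak `L¹` with some constant. The height
`t₀` below which the good-`λ` inequality does not apply contributes `t₀ ^ p μ(X)`. -/
lemma Admissible.exists_lintegral_rpow_le [BorelSpace X] [SecondCountableTopology X] [Nonempty X]
    (h : Admissible μ lam α γ β) (hηα : 5 * η ≤ α) (hρ : 1 ≤ ρ) (hρα : 5 * ρ ≤ α) (hq : 1 < q)
    (hT : IsSublinearOn (linftyAddH1 μ lam ρ q) T) (hT_infty : BoundedLinftyRBMO μ lam η T)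
    (hT_one : BoundedH1WeakL1 μ lam ρ q T) {p : ℝ} (hp : 1 < p) :
    ∃ C a : ℝ≥0, 0 < a ∧ ∀ (f : X →ₘ[μ] ℂ) (t₀ : ℝ≥0) (W : ℝ≥0∞), W ≠ ∞ →
      ∫⁻ x, ‖f x‖ₑ ^ p ∂μ ≠ ∞ →
      (∀ t : ℝ≥0, t * μ {x | (t : ℝ≥0∞) < ‖T f x‖ₑ} ≤ W) →
      (∀ t : ℝ≥0, 0 < t → t₀ ≤ t →
        μ {x | (t : ℝ≥0∞) < ‖T f x‖ₑ} < (4 * β : ℝ≥0∞)⁻¹ * μ univ ∧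
          ∫⁻ x, ‖f x‖ₑ ^ p ∂μ ≤ (a * t : ℝ≥0∞) ^ p * μ univ) →
      ∫⁻ x, ‖T f x‖ₑ ^ p ∂μ ≤ C * ((t₀ : ℝ≥0∞) ^ p * μ univ + ∫⁻ x, ‖f x‖ₑ ^ p ∂μ) := by
  have hp0 : 0 < p := by linarith
  obtain ⟨s, hs1, hsp⟩ : ∃ s, 1 < s ∧ s < p := exists_between hp
  have hs0 : 0 < s := by linarith
  obtain ⟨C₁, hC₁⟩ := hT_infty.exists_bound
  obtain ⟨C₂, hC₂⟩ := hT_one.exists_bound h.measure_ball_lt_top hρ hq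
  obtain ⟨C, hC⟩ := h.exists_decomposition (q := q) hρ hρα hq hs1
  have hβ : 0 < β := one_pos.trans_le h.one_le
  -- `f` is decomposed at height `a t`; `a` is chosen such that `6 ^ p κ ≤ 1 / 2`
  set d : ℝ≥0 := 16 * β * (C₁ + 1) * (C + 1) * 6 ^ p with hd
  have hd0 : 0 < d := by positivity
  set a : ℝ≥0 := d⁻¹ with ha_def
  have ha : 0 < a := by positivity
  set κ : ℝ≥0 := 8 * β * C₁ * (C + 1) * a with hκ
  have hκ6 : 6 ^ p * κ ≤ 2⁻¹ := by
    calc 6 ^ p * κ = (8 * β * C₁ * (C + 1) * 6 ^ p) / d := by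
          rw [hκ, ha_def, div_eq_mul_inv]; ring
      _ ≤ (8 * β * (C₁ + 1) * (C + 1) * 6 ^ p) / d := by
          gcongr
          exact le_self_add
      _ = 2⁻¹ := by
          rw [div_eq_iff hd0.ne', hd]
          have : (2 : ℝ≥0)⁻¹ * 16 = 8 := by
            rw [inv_mul_eq_iff_eq_mul₀ (by norm_num)]; norm_num
          rw [← this]; ring
  have h6 : (1 : ℝ≥0) ≤ 6 ^ p := NNReal.one_le_rpow (by norm_num) hp0.le
  have hκ1 : κ ≤ 1 := by
    calc κ ≤ 6 ^ p * κ := le_mul_of_one_le_left bot_le h6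
      _ ≤ 2⁻¹ := hκ6
      _ ≤ 1 := inv_le_one_of_one_le₀ (by norm_num)
  set Q : ℝ≥0 := (4 * β + 1) * C₂ * C * a ^ (1 - s) with hQ
  set E : ℝ≥0∞ := ENNReal.ofReal p * Q * ((ENNReal.ofReal (p - s))⁻¹ * (a : ℝ≥0∞) ^ (s - p)) with hE
  have ha0 : (a : ℝ≥0∞) ≠ 0 := by exact_mod_cast ha.ne'
  have hEtop : E ≠ ∞ := by
    refine ENNReal.mul_ne_top (ENNReal.mul_ne_top (by simp) (by simp)) (ENNReal.mul_ne_top ?_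
      (ENNReal.rpow_ne_top_of_ne_zero ha0 (by simp)))
    simpa using hsp
  have h6top : (6 : ℝ≥0∞) ^ p ≠ ∞ := ENNReal.rpow_ne_top_of_nonneg hp0.le (by simp)
  refine ⟨(2 * 6 ^ p * (1 + E)).toNNReal, a, ha, fun f t₀ W hW hf hweak hsmall => ?_⟩
  rw [ENNReal.coe_toNNReal (ENNReal.mul_ne_top (ENNReal.mul_ne_top (by simp) h6top)
    (ENNReal.add_ne_top.2 ⟨by simp, hEtop⟩))]
  have hset : ∀ (u : X →ₘ[μ] ℂ) (t : ℝ≥0),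
      {x | t < ‖u x‖₊} = {x | (t : ℝ≥0∞) < ‖u x‖ₑ} := fun u t => by
    ext x
    exact ENNReal.coe_lt_coe.symm
  have hmeas : ∀ u : X →ₘ[μ] ℂ, Measurable u := fun u => u.measurable
  refine (lintegral_rpow_le_of_measure_lt_le (F := fun x => ‖T f x‖₊) (φ := fun x => ‖f x‖₊)
    (hmeas _).nnnorm (hmeas _).nnnorm hp hsp hs0 (κ := κ) (Q := Q) (t₀ := t₀) ha ?_ hW ?_
    ?_).trans ?_
  · have := ENNReal.coe_le_coe.2 hκ6
    rw [ENNReal.coe_mul, ENNReal.coe_rpow_of_nonneg _ hp0.le, ENNReal.coe_inv (by norm_num)] at this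
    exact_mod_cast this
  · intro t
    rw [hset]
    exact hweak t
  · intro t ht htt
    obtain ⟨hμt, hft⟩ := hsmall t ht htt
    rw [hset, hset, hset]
    set ℓ : ℝ≥0 := a * t with hℓ
    have hℓpos : 0 < ℓ := by positivity
    have hℓ0 : (ℓ : ℝ≥0∞) ≠ 0 := by exact_mod_cast hℓpos.ne'
    have ht0 : (t : ℝ≥0∞) ≠ 0 := by exact_mod_cast ht.ne'
    change _ ≤ _ + _ * ∫⁻ x in {x | (ℓ : ℝ≥0∞) < ‖f x‖ₑ}, ‖f x‖ₑ ^ s ∂μ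
    set I := ∫⁻ x in {x | (ℓ : ℝ≥0∞) < ‖f x‖ₑ}, ‖f x‖ₑ ^ s ∂μ with hI
    have hIle : (ℓ : ℝ≥0∞) ^ (p - s) * I ≤ ∫⁻ x, ‖f x‖ₑ ^ p ∂μ :=
      rpow_mul_setLIntegral_le hs0.le hsp.le ℓ (by simp) (hmeas f).aemeasurable
    have hIfin : I ≠ ∞ := by
      intro hI'
      rw [hI', ENNReal.mul_top (by simp [ENNReal.rpow_eq_zero_iff, hℓ0]), top_le_iff] at hIle
      exact hf hIle
    have hIμ : (ℓ : ℝ≥0∞) ^ (1 - s) * I / μ univ ≤ ℓ := by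
      refine ENNReal.div_le_of_le_mul ?_
      calc (ℓ : ℝ≥0∞) ^ (1 - s) * I = (ℓ : ℝ≥0∞) ^ (1 - p) * ((ℓ : ℝ≥0∞) ^ (p - s) * I) := by
            rw [← mul_assoc, ← ENNReal.rpow_add _ _ hℓ0 (by simp)]
            congr 2; ring
        _ ≤ (ℓ : ℝ≥0∞) ^ (1 - p) * ((ℓ : ℝ≥0∞) ^ p * μ univ) := by
            refine mul_le_mul' le_rfl (hIle.trans (hft.trans (le_of_eq ?_)))
            rw [hℓ, ENNReal.coe_mul]
        _ = ℓ * μ univ := by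
            rw [← mul_assoc, ← ENNReal.rpow_add _ _ hℓ0 (by simp), sub_add_cancel,
              ENNReal.rpow_one]
    have hdec := (hC f ℓ f.aestronglyMeasurable hℓpos hIfin).mono
      (a' := ((2 * (C + 1) * ℓ : ℝ≥0) : ℝ≥0∞)) (m' := ∞)
      (w' := C * ((ℓ : ℝ≥0∞) ^ (1 - s) * I)) (by
        calc C * (ℓ + (ℓ : ℝ≥0∞) ^ (1 - s) * I / μ univ) ≤ C * (ℓ + ℓ) := by gcongr
          _ ≤ (C + 1) * (ℓ + ℓ) := by gcongr; exact le_self_add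
          _ = _ := by push_cast; ring) le_rfl le_rfl
    have hwtop : C * ((ℓ : ℝ≥0∞) ^ (1 - s) * I) ≠ ∞ := ENNReal.mul_ne_top (by simp)
      (ENNReal.mul_ne_top (ENNReal.rpow_ne_top_of_ne_zero hℓ0 (by simp)) hIfin)
    obtain ⟨g, b, -, hga, hb, -, hTf, hTg⟩ :=
      hdec.exists_split h.measure_ball_lt_top hρ hq hT hwtop
    obtain ⟨-, K, hK, hKle⟩ := hC₁ g _ (by positivity) hga
    have hKt : 4 * β * ENNReal.ofReal K ≤ κ * t := by
      calc 4 * β * ENNReal.ofReal K ≤ 4 * β * (C₁ * (2 * (C + 1) * ℓ) : ℝ≥0) := by gcongr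
        _ = ((8 * β * C₁ * (C + 1) * a * t : ℝ≥0) : ℝ≥0∞) := by
            rw [hℓ]; push_cast; ring
        _ = _ := by rw [ENNReal.coe_mul]
    have hgood := h.measure_lt_le hηα (G := T g) (F := fun x => ‖T f x‖ₑ)
      (H := fun x => ‖T b x‖ₑ) (K := K) (ℓ := t) ht (by
        calc 4 * (ENNReal.ofReal K * β) = 4 * β * ENNReal.ofReal K := by ring
          _ ≤ κ * t := hKt
          _ ≤ 1 * t := by gcongr; exact_mod_cast hκ1
          _ = t := one_mul _) hK (hmeas _).enorm (hmeas _).enorm hTg hTf hμt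
    have hbweak := hC₂ b _ hwtop hb t
    rw [show ((6 * t : ℝ≥0) : ℝ≥0∞) = 6 * t by push_cast; rfl]
    refine hgood.trans (add_le_add ?_ ?_)
    · gcongr
      rw [← mul_div_assoc]
      exact ENNReal.div_le_of_le_mul hKt
    · calc (4 * β + 1) * μ {x | (t : ℝ≥0∞) < ‖T b x‖ₑ}
          = (4 * β + 1) * ((t : ℝ≥0∞)⁻¹ * (t * μ {x | (t : ℝ≥0∞) < ‖T b x‖ₑ})) := by
            rw [← mul_assoc (t : ℝ≥0∞)⁻¹, ENNReal.inv_mul_cancel ht0 (by simp), one_mul]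
        _ ≤ (4 * β + 1) * ((t : ℝ≥0∞)⁻¹ * (C₂ * (C * ((ℓ : ℝ≥0∞) ^ (1 - s) * I)))) := by gcongr
        _ = (4 * β + 1) * C₂ * C * (a : ℝ≥0∞) ^ (1 - s) *
              ((t : ℝ≥0∞) ^ (-1 : ℝ) * (t : ℝ≥0∞) ^ (1 - s)) * I := by
            rw [hℓ, ENNReal.coe_mul, ENNReal.mul_rpow_of_ne_top (by simp) (by simp),
              ENNReal.rpow_neg_one]
            ring
        _ = _ := by
            rw [← ENNReal.rpow_add _ _ ht0 (by simp), hQ]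
            push_cast
            rw [ENNReal.coe_rpow_of_ne_zero ha.ne']
            congr 3
            ring
  · change 2 * 6 ^ p * ((t₀ : ℝ≥0∞) ^ p * μ univ + E * ∫⁻ x, ‖f x‖ₑ ^ p ∂μ) ≤ _
    rw [mul_assoc (2 * 6 ^ p : ℝ≥0∞)]
    refine mul_le_mul' le_rfl ?_
    rw [mul_add]
    exact add_le_add (le_mul_of_one_le_left bot_le le_self_add) (mul_le_mul' le_add_self le_rfl)

end NonHom

namespace NonHom

open Set Metric Filter

variable {X : Type*} [MetricSpace X] [MeasurableSpace X] {μ : Measure X} {lam : X → ℝ → ℝ}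
  {α γ η ρ : ℝ} {β : ℝ≥0} {q : ℝ≥0∞} {T : (X →ₘ[μ] ℂ) → (X →ₘ[μ] ℂ)}

/-! ### Spaces of finite measure -/

lemma exists_ball_measure_compl_le [OpensMeasurableSpace X] [Nonempty X] (hμ : μ univ ≠ ∞)
    (hμ0 : μ univ ≠ 0) {ε : ℝ≥0∞} (hε : ε ≠ 0) :
    ∃ B : Ball X, μ B.carrier ≠ 0 ∧ μ B.carrierᶜ ≤ ε := by
  obtain ⟨x₀⟩ := ‹Nonempty X›
  have hmono : Monotone fun n : ℕ => ball x₀ (n : ℝ) := fun i j hij =>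
    ball_subset_ball (by exact_mod_cast hij)
  have htend := tendsto_measure_iUnion_atTop (μ := μ) hmono
  rw [iUnion_ball_nat] at htend
  obtain ⟨n, hn, hn0⟩ := ((htend.eventually (lt_mem_nhds (ENNReal.sub_lt_self hμ hμ0 hε))).and
    (eventually_gt_atTop 0)).exists
  refine ⟨⟨x₀, n, by exact_mod_cast hn0⟩, (bot_le.trans_lt hn).ne', ?_⟩
  change μ (ball x₀ n)ᶜ ≤ ε
  rw [measure_compl measurableSet_ball (ne_top_of_le_ne_top hμ (measure_mono (subset_univ _)))]
  exact tsub_le_iff_tsub_le.1 hn.le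

/-- If `μ(X) < ∞`, a function bounded by `M` is the sum of a constant multiple of the indicator
function of a fixed ball `B` and of an element of the Hardy space, both of size `O(M)`. Since the
complement of `B` has small measure, the part of the function outside of `B` can be replaced,
modulo the Hardy space, by a function bounded by `M / 2`, and this can be iterated. -/
lemma Admissible.exists_eq_indicator_add [BorelSpace X] [SecondCountableTopology X] [Nonempty X]
    (h : Admissible μ lam α γ β) (hρ : 1 ≤ ρ) (hρα : 5 * ρ ≤ α) (hq : 1 < q) (hμ : μ univ ≠ ∞)
    (hμ0 : μ univ ≠ 0) :
    ∃ (B : Ball X) (C : ℝ≥0), ∀ (g : X → ℂ) (M : ℝ≥0), AEStronglyMeasurable g μ → 0 < M →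
      (∀ᵐ x ∂μ, ‖g x‖ₑ ≤ M) → ∃ c : ℂ, ‖c‖ₑ ≤ (C * M : ℝ≥0) ∧
        H1Le μ lam ρ q (fun x => g x - B.carrier.indicator (fun _ => c) x) (C * M : ℝ≥0) := by
  obtain ⟨C₁, hC₁, hdec⟩ := h.hasDecomposition (q := q) hρ hρα hq
  have hC₁0 : 0 < C₁ := one_pos.trans_le hC₁
  obtain ⟨m, hm⟩ : ∃ m : ℝ≥0, μ univ = m := ⟨_, (ENNReal.coe_toNNReal hμ).symm⟩
  have hm0 : m ≠ 0 := fun h0 => hμ0 (by rw [hm, h0, ENNReal.coe_zero])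
  obtain ⟨B, hB, hBc⟩ := exists_ball_measure_compl_le hμ hμ0
    (ε := ((m / (4 * C₁) : ℝ≥0) : ℝ≥0∞)) (by exact_mod_cast (by positivity))
  have hBm : MeasurableSet B.carrier := B.measurableSet_carrier
  have hstep : ∀ (g : X → ℂ) (M : ℝ≥0), 0 < M → AEStronglyMeasurable g μ ∧ (∀ᵐ x ∂μ, ‖g x‖ₑ ≤ M) →
      ∃ u : X → ℂ, (AEStronglyMeasurable u μ ∧ ∀ᵐ x ∂μ, ‖u x‖ₑ ≤ (M / 2 : ℝ≥0)) ∧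
        H1Le μ lam ρ q (fun x => B.carrierᶜ.indicator g x - u x) (C₁ * m * M : ℝ≥0) := by
    rintro g M hM ⟨hg, hgM⟩
    have hint : ∫⁻ x, ‖B.carrierᶜ.indicator g x‖ₑ ∂μ ≤ (M * (m / (4 * C₁)) : ℝ≥0) := by
      simp_rw [enorm_indicator_eq_indicator_enorm]
      rw [lintegral_indicator hBm.compl]
      calc ∫⁻ x in B.carrierᶜ, ‖g x‖ₑ ∂μ ≤ ∫⁻ _ in B.carrierᶜ, M ∂μ :=
            lintegral_mono_ae (ae_restrict_of_ae hgM)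
        _ = M * μ B.carrierᶜ := by simp
        _ ≤ _ := by rw [ENNReal.coe_mul]; gcongr
    obtain ⟨u, b, hu, hub, hua, -, hb⟩ := hdec (B.carrierᶜ.indicator g) M (M / (4 * C₁))
      (hg.indicator hBm.compl) (by positivity)
      (div_le_self bot_le (hC₁.trans (le_mul_of_one_le_left bot_le (by norm_num))))
      (by
        filter_upwards [hgM] with x hx
        by_cases hxB : x ∈ B.carrierᶜ
        · rwa [indicator_of_mem hxB]
        · rw [indicator_of_notMem hxB]; simp) (hint.trans_lt ENNReal.coe_lt_top).ne
    refine ⟨u, ⟨hu, hua.mono fun x hx => hx.trans ?_⟩, (hb.mono ?_).congr ?_⟩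
    · rw [hm]
      calc (C₁ : ℝ≥0∞) * ((M / (4 * C₁) : ℝ≥0) + (∫⁻ x, ‖B.carrierᶜ.indicator g x‖ₑ ∂μ) / m)
          ≤ C₁ * ((M / (4 * C₁) : ℝ≥0) + ((M * (m / (4 * C₁)) : ℝ≥0) : ℝ≥0∞) / m) := by gcongr
        _ = ((C₁ * (M / (4 * C₁) + M * (m / (4 * C₁)) / m) : ℝ≥0) : ℝ≥0∞) := by
            rw [← ENNReal.coe_div hm0, ← ENNReal.coe_add, ← ENNReal.coe_mul]
        _ = _ := by
            congr 1
            rw [← NNReal.coe_inj]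
            have : (m : ℝ) ≠ 0 := by exact_mod_cast hm0
            have : (C₁ : ℝ) ≠ 0 := by exact_mod_cast hC₁0.ne'
            push_cast
            field_simp
            norm_num
    · calc ((C₁ * (M / (M / (4 * C₁))) : ℝ≥0) : ℝ≥0∞) * ∫⁻ x, ‖B.carrierᶜ.indicator g x‖ₑ ∂μ
          ≤ ((C₁ * (M / (M / (4 * C₁))) : ℝ≥0) : ℝ≥0∞) * (M * (m / (4 * C₁)) : ℝ≥0) := by gcongr
        _ = ((C₁ * (M / (M / (4 * C₁))) * (M * (m / (4 * C₁))) : ℝ≥0) : ℝ≥0∞) := by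
            rw [← ENNReal.coe_mul]
        _ = _ := by
            congr 1
            rw [← NNReal.coe_inj]
            have : (M : ℝ) ≠ 0 := by exact_mod_cast hM.ne'
            have : (C₁ : ℝ) ≠ 0 := by exact_mod_cast hC₁0.ne'
            push_cast
            field_simp
    · filter_upwards [hub] with x hx
      rw [hx, add_sub_cancel_left]
  refine ⟨B, 4 + 2 * (C₁ * m) + 4 * (μ (B.dilate ρ)).toNNReal * (1 + β),
    fun g M hg hM hgM => ?_⟩
  choose! u hu hub using hstep
  -- the bounded parts that remain after each step
  set G : ℕ → X → ℂ := fun n => Nat.rec g (fun n v => u v (M / 2 ^ n)) n with hG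
  have hGs : ∀ n, G (n + 1) = u (G n) (M / 2 ^ n) := fun n => rfl
  have hGn : ∀ n, AEStronglyMeasurable (G n) μ ∧ ∀ᵐ x ∂μ, ‖G n x‖ₑ ≤ (M / 2 ^ n : ℝ≥0) := by
    intro n
    induction n with
    | zero =>
      change AEStronglyMeasurable g μ ∧ ∀ᵐ x ∂μ, ‖g x‖ₑ ≤ (M / 2 ^ 0 : ℝ≥0)
      rw [pow_zero, div_one]
      exact ⟨hg, hgM⟩
    | succ n ih =>
      have := hu (G n) (M / 2 ^ n) (by positivity) ih
      rw [hGs, pow_succ, ← div_div]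
      exact this
  have hGb : ∀ n, H1Le μ lam ρ q (fun x => B.carrierᶜ.indicator (G n) x - G (n + 1) x)
      (C₁ * m * (M / 2 ^ n) : ℝ≥0) := fun n => hub (G n) _ (by positivity) (hGn n)
  have hgeo : ∑' n : ℕ, ((M / 2 ^ n : ℝ≥0) : ℝ≥0∞) = 2 * M := by
    calc ∑' n : ℕ, ((M / 2 ^ n : ℝ≥0) : ℝ≥0∞) = ∑' n : ℕ, (M : ℝ≥0∞) * 2⁻¹ ^ n := by
          refine tsum_congr fun n => ?_
          rw [div_eq_mul_inv, ← inv_pow, ENNReal.coe_mul, ENNReal.coe_pow,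
            ENNReal.coe_inv (by norm_num)]
          rfl
      _ = _ := by rw [ENNReal.tsum_mul_left, tsum_two_inv_pow, mul_comm]
  have hae : ∀ᵐ x ∂μ, ∀ n, ‖G n x‖ₑ ≤ (M / 2 ^ n : ℝ≥0) := ae_all_iff.2 fun n => (hGn n).2
  have hsummable : ∀ᵐ x ∂μ, Summable fun n => G n x := by
    filter_upwards [hae] with x hx
    refine Summable.of_nnnorm (NNReal.summable_of_le (f := fun n => M / 2 ^ n) (fun n => ?_) ?_)
    · exact ENNReal.coe_le_coe.1 (hx n)
    · rw [← ENNReal.tsum_coe_ne_top_iff_summable, hgeo]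
      exact ENNReal.mul_ne_top (by simp) (by simp)
  obtain ⟨k, hk, hkG, hkM⟩ := exists_measurable_bounded_rep (f := fun x => ∑' n, G n x)
    (M := 2 * M) (μ := μ)
    (aestronglyMeasurable_of_tendsto_ae (u := atTop)
      (f := fun n : ℕ => fun x => ∑ j ∈ Finset.range n, G j x)
      (fun n => Finset.aestronglyMeasurable_fun_sum _ fun j _ => (hGn j).1) (by
        filter_upwards [hsummable] with x hx using hx.hasSum.tendsto_sum_nat))
    (by
      filter_upwards [hae] with x hx
      rw [← hgeo]
      exact enorm_tsum_le_tsum_enorm.trans (ENNReal.tsum_le_tsum hx))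
  have hH1 : H1Le μ lam ρ q (fun x => g x - B.carrier.indicator k x) (2 * (C₁ * m) * M : ℝ≥0) := by
    refine H1Le.tsum h.measure_ball_lt_top hρ hq hGb ?_ ENNReal.coe_ne_top ?_
    · calc ∑' n : ℕ, ((C₁ * m * (M / 2 ^ n) : ℝ≥0) : ℝ≥0∞)
          = ∑' n : ℕ, ((C₁ * m : ℝ≥0) : ℝ≥0∞) * ((M / 2 ^ n : ℝ≥0) : ℝ≥0∞) :=
            tsum_congr fun n => ENNReal.coe_mul _ _
        _ = (C₁ * m : ℝ≥0) * (2 * M) := by rw [ENNReal.tsum_mul_left, hgeo]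
        _ ≤ _ := by push_cast; exact le_of_eq (by ring)
    · filter_upwards [hsummable, hkG] with x hx hkx
      have h1 := hx.hasSum
      rw [hkx] at h1
      have h2 := (hasSum_nat_add_iff' 1).2 h1
      have h3 := h1.sub h2
      rw [Finset.sum_range_one, sub_sub_cancel] at h3
      by_cases hxB : x ∈ B.carrier
      · rw [indicator_of_mem hxB]
        have h4 : (fun n => B.carrierᶜ.indicator (G n) x - G (n + 1) x) =
            fun n => G n x - G (n + 1) x - G n x := by
          funext n
          rw [indicator_of_notMem (by simpa using hxB)]
          ring
        rw [h4]
        exact h3.sub h1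
      · rw [indicator_of_notMem hxB, sub_zero]
        have h4 : (fun n => B.carrierᶜ.indicator (G n) x - G (n + 1) x) =
            fun n => G n x - G (n + 1) x := by
          funext n
          rw [indicator_of_mem (by simpa using hxB)]
        rw [h4]
        exact h3
  have hBfin : μ B.carrier ≠ ∞ := (h.measure_ball_lt_top _ _).ne
  have hBreal : (μ.real B.carrier : ℂ) ≠ 0 := by
    exact_mod_cast (ENNReal.toReal_ne_zero.2 ⟨hB, hBfin⟩)
  set c : ℂ := (μ.real B.carrier : ℂ)⁻¹ * ∫ x in B.carrier, k x ∂μ with hc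
  have hkint : IntegrableOn k B.carrier μ := by
    refine Measure.integrableOn_of_bounded (M := 2 * M) hBfin hk.aestronglyMeasurable
      (Eventually.of_forall fun x => ?_)
    have := hkM x
    exact_mod_cast (ENNReal.coe_le_coe.1 this)
  have hcM : ‖c‖ₑ ≤ (2 * M : ℝ≥0) := by
    have h1 : ‖∫ x in B.carrier, k x ∂μ‖ ≤ (2 * M : ℝ≥0) * μ.real B.carrier := by
      refine norm_setIntegral_le_of_norm_le_const hBfin.lt_top fun x _ => ?_
      exact_mod_cast (ENNReal.coe_le_coe.1 (hkM x))
    have h2 : 0 < μ.real B.carrier := ENNReal.toReal_pos hB hBfin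
    have h3 : ‖c‖ ≤ (2 * M : ℝ≥0) := by
      rw [hc, norm_mul, norm_inv, Complex.norm_real, Real.norm_of_nonneg h2.le,
        inv_mul_le_iff₀ h2, mul_comm]
      exact h1
    exact ENNReal.coe_le_coe.2 h3
  have hblock := H1Le.of_add (q := q) (lam := lam) (μ := μ) (A₁ := B) (A₂ := B) (B := B)
    (K₁ := 2 * M) (K₂ := 2 * M)
    (u₁ := B.carrier.indicator k) (u₂ := B.carrier.indicator fun _ => -c) h.measure_ball_lt_top hρ
    subset_rfl subset_rfl (h.delta_self_le B) (h.delta_self_le B) hB hB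
    (hk.indicator hBm).aestronglyMeasurable (aestronglyMeasurable_const.indicator hBm)
    support_indicator_subset support_indicator_subset
    (fun x => by
      by_cases hxB : x ∈ B.carrier
      · rw [indicator_of_mem hxB]; exact hkM x
      · rw [indicator_of_notMem hxB]; simp)
    (fun x => by
      by_cases hxB : x ∈ B.carrier
      · rw [indicator_of_mem hxB, enorm_neg]; exact hcM
      · rw [indicator_of_notMem hxB]; simp)
    (by
      rw [integral_add (hkint.integrable_indicator hBm)
        ((integrableOn_const hBfin).integrable_indicator hBm), integral_indicator hBm,
        integral_indicator hBm, setIntegral_const, Complex.real_smul, hc, mul_neg,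
        mul_inv_cancel_left₀ hBreal, add_neg_cancel])
  refine ⟨c, hcM.trans (ENNReal.coe_le_coe.2 ?_), ?_⟩
  · gcongr
    calc (2 : ℝ≥0) ≤ 4 := by norm_num
      _ ≤ 4 + (2 * (C₁ * m) + 4 * (μ (B.dilate ρ)).toNNReal * (1 + β)) := le_self_add
      _ = _ := by ring
  · refine ((hH1.add h.measure_ball_lt_top hρ hq ENNReal.coe_ne_top ?_ hblock).congr ?_).mono ?_
    · have := (h.measure_ball_lt_top B.center (ρ * B.radius)).ne
      exact ENNReal.mul_ne_top (ENNReal.add_ne_top.2 ⟨ENNReal.mul_ne_top ENNReal.coe_ne_top this,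
        ENNReal.mul_ne_top ENNReal.coe_ne_top this⟩) (by simp)
    · refine Eventually.of_forall fun x => ?_
      simp only [Pi.add_apply]
      by_cases hxB : x ∈ B.carrier
      · simp only [indicator_of_mem hxB]; ring
      · simp only [indicator_of_notMem hxB]; ring
    · obtain ⟨d, hd⟩ : ∃ d : ℝ≥0, μ (B.dilate ρ) = d :=
        ⟨_, (ENNReal.coe_toNNReal (h.measure_ball_lt_top _ _).ne).symm⟩
      rw [hd, ENNReal.toNNReal_coe]
      calc _ = ((2 * (C₁ * m) * M + 4 * d * (1 + β) * M : ℝ≥0) : ℝ≥0∞) := by push_cast; ring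
        _ ≤ _ := by
            refine ENNReal.coe_le_coe.2 ?_
            rw [← add_mul, add_assoc 4]
            exact mul_le_mul_left le_add_self M

/-- If `μ(X) < ∞`, functions in `RBMO(μ)` are integrable: their mean values over the balls with a
given centre and large radius are bounded. -/
lemma IsDominating.integrable_of_rbmoBound [OpensMeasurableSpace X] [Nonempty X]
    (hlam : IsDominating μ lam) (hμ : μ univ ≠ ∞) {u : X → ℂ} {K : ℝ}
    (hu : RBMOBound μ lam η u K) (hum : AEStronglyMeasurable u μ) : Integrable u μ := by
  obtain ⟨x₀⟩ := ‹Nonempty X›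
  obtain ⟨-, m, hm, hmm⟩ := hu
  set B : ℕ → Ball X := fun n => ⟨x₀, n + 1, by positivity⟩ with hB
  set d : ℝ≥0∞ := μ univ * (ENNReal.ofReal (lam x₀ 1))⁻¹ with hd
  have hdtop : d ≠ ∞ := ENNReal.mul_ne_top hμ (by
    simpa using hlam.pos x₀ 1 one_pos)
  have hδ : ∀ n, delta μ lam (B 0) (B n) ≤ d := by
    intro n
    have h1 := hlam.lintegral_diff_ball_le x₀ one_pos ((B n).dilate 2) measurableSet_ball
    have h2 : (B 0).carrier = ball x₀ 1 := by simp [hB, Ball.carrier]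
    rw [delta, h2]
    refine h1.trans ?_
    rw [hd]
    gcongr
    exact subset_univ _
  set k := ENNReal.ofReal K
  set R : ℝ≥0∞ := k * μ univ + (‖m (B 0)‖ₑ + k * (1 + d)) * μ univ with hR
  have hRtop : R ≠ ∞ := by
    have hk : k ≠ ∞ := ENNReal.ofReal_ne_top
    refine ENNReal.add_ne_top.2 ⟨ENNReal.mul_ne_top hk hμ, ENNReal.mul_ne_top
      (ENNReal.add_ne_top.2 ⟨enorm_ne_top, ENNReal.mul_ne_top hk
        (ENNReal.add_ne_top.2 ⟨by simp, hdtop⟩)⟩) hμ⟩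
  have hbound : ∀ n, ∫⁻ x in (B n).carrier, ‖u x‖ₑ ∂μ ≤ R := by
    intro n
    have hmn : ‖m (B n)‖ₑ ≤ ‖m (B 0)‖ₑ + k * (1 + d) := by
      have hsub : (B 0).carrier ⊆ (B n).carrier := ball_subset_ball (by simp [hB])
      calc ‖m (B n)‖ₑ = ‖m (B 0) - (m (B 0) - m (B n))‖ₑ := by rw [sub_sub_cancel]
        _ ≤ ‖m (B 0)‖ₑ + ‖m (B 0) - m (B n)‖ₑ := enorm_sub_le
        _ ≤ _ := by
            gcongr
            exact (hmm _ _ hsub).trans (by gcongr; exact hδ n)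
    calc ∫⁻ x in (B n).carrier, ‖u x‖ₑ ∂μ
        ≤ ∫⁻ x in (B n).carrier, (‖u x - m (B n)‖ₑ + ‖m (B n)‖ₑ) ∂μ := by
          refine lintegral_mono fun x => ?_
          simpa using enorm_add_le (u x - m (B n)) (m (B n))
      _ = ∫⁻ x in (B n).carrier, ‖u x - m (B n)‖ₑ ∂μ + ‖m (B n)‖ₑ * μ (B n).carrier := by
          rw [lintegral_add_right _ measurable_const]; simp
      _ ≤ k * μ univ + (‖m (B 0)‖ₑ + k * (1 + d)) * μ univ := by
          gcongr
          · exact (hm (B n)).trans (by gcongr; exact subset_univ _)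
          · exact subset_univ _
  refine ⟨hum, ?_⟩
  have hUnion : ⋃ n, (B n).carrier = univ := by
    refine eq_univ_of_forall fun x => ?_
    obtain ⟨n, hn⟩ := exists_nat_gt (dist x x₀)
    refine mem_iUnion.2 ⟨n, mem_ball.2 (hn.trans ?_)⟩
    simp [hB]
  have hmono : Monotone fun n => (B n).carrier := fun i j hij =>
    ball_subset_ball (by simpa [hB] using hij)
  calc ∫⁻ x, ‖u x‖ₑ ∂μ = ∫⁻ x in ⋃ n, (B n).carrier, ‖u x‖ₑ ∂μ := by
        rw [hUnion, Measure.restrict_univ]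
    _ = ⨆ n, ∫⁻ x in (B n).carrier, ‖u x‖ₑ ∂μ :=
        setLIntegral_iUnion_of_directed _ hmono.directed_le
    _ ≤ R := iSup_le hbound
    _ < ∞ := hRtop.lt_top

end NonHom

namespace NonHom

open Set Metric Filter

variable {X : Type*} [MetricSpace X] [MeasurableSpace X] {μ : Measure X} {lam : X → ℝ → ℝ}
  {α γ η ρ : ℝ} {β : ℝ≥0} {q : ℝ≥0∞} {T : (X →ₘ[μ] ℂ) → (X →ₘ[μ] ℂ)}

/-- If `μ(X) < ∞`, then `L^p` is contained in the domain of `T`, and `T` maps it boundedly into weak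
`L¹`, since elements of `L^p` are sums of multiples of a fixed indicator function and of elements of
the Hardy space. -/
lemma Admissible.exists_weak_bound [BorelSpace X] [SecondCountableTopology X] [Nonempty X]
    (h : Admissible μ lam α γ β) (hlam : IsDominating μ lam) (hρ : 1 ≤ ρ)
    (hρα : 5 * ρ ≤ α) (hq : 1 < q)
    (hT : IsSublinearOn (linftyAddH1 μ lam ρ q) T) (hT_infty : BoundedLinftyRBMO μ lam η T)
    (hT_one : BoundedH1WeakL1 μ lam ρ q T) (hμ : μ univ ≠ ∞) (hμ0 : μ univ ≠ 0) {p : ℝ}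
    (hp : 1 < p) :
    ∃ C : ℝ≥0, ∀ (f : X →ₘ[μ] ℂ) (N : ℝ≥0), 0 < N → ∫⁻ x, ‖f x‖ₑ ^ p ∂μ ≤ (N : ℝ≥0∞) ^ p →
      f ∈ linftyAddH1 μ lam ρ q ∧
        ∀ t : ℝ≥0, t * μ {x | (t : ℝ≥0∞) < ‖T f x‖ₑ} ≤ (C * N : ℝ≥0) := by
  obtain ⟨s, hs1, hsp⟩ : ∃ s, 1 < s ∧ s < p := exists_between hp
  have hs0 : 0 < s := by linarith
  obtain ⟨C₁, hC₁⟩ := hT_infty.exists_bound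
  obtain ⟨C₂, hC₂⟩ := hT_one.exists_bound h.measure_ball_lt_top hρ hq
  obtain ⟨C, hC⟩ := h.exists_decomposition (q := q) hρ hρα hq hs1
  obtain ⟨B, C', hC'⟩ := h.exists_eq_indicator_add (q := q) hρ hρα hq hμ hμ0
  obtain ⟨m, hm⟩ : ∃ m : ℝ≥0, μ univ = m := ⟨_, (ENNReal.coe_toNNReal hμ).symm⟩
  have hm0 : m ≠ 0 := fun h0 => hμ0 (by rw [hm, h0, ENNReal.coe_zero])
  set χ : X →ₘ[μ] ℂ := AEEqFun.mk (B.carrier.indicator fun _ => (1 : ℂ))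
    (aestronglyMeasurable_const.indicator B.measurableSet_carrier) with hχ
  have hχae : χ =ᵐ[μ] B.carrier.indicator fun _ => (1 : ℂ) := AEEqFun.coeFn_mk _ _
  have hχ1 : ∀ᵐ x ∂μ, ‖χ x‖ₑ ≤ (1 : ℝ≥0) := by
    filter_upwards [hχae] with x hx
    rw [hx]
    by_cases hxB : x ∈ B.carrier
    · rw [indicator_of_mem hxB]; simp
    · rw [indicator_of_notMem hxB]; simp
  obtain ⟨-, K₀, hK₀, -⟩ := hC₁ χ 1 one_pos hχ1
  have hTχ := hlam.integrable_of_rbmoBound hμ hK₀ (T χ).aestronglyMeasurable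
  obtain ⟨J, hJ⟩ : ∃ J : ℝ≥0, ∫⁻ x, ‖T χ x‖ₑ ∂μ = J :=
    ⟨_, (ENNReal.coe_toNNReal (hTχ.2.ne)).symm⟩
  set C₃ : ℝ≥0 := C * (1 + m⁻¹) + 1 with hC₃
  set C₄ : ℝ≥0 := C' * C₃ + C with hC₄
  refine ⟨2 * (C₄ * J + C₂ * C₄), fun f N hN hf => ?_⟩
  have hN0 : (N : ℝ≥0∞) ≠ 0 := by exact_mod_cast hN.ne'
  set I := ∫⁻ x in {x | (N : ℝ≥0∞) < ‖f x‖ₑ}, ‖f x‖ₑ ^ s ∂μ with hI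
  have hIle : (N : ℝ≥0∞) ^ (p - s) * I ≤ (N : ℝ≥0∞) ^ p :=
    (rpow_mul_setLIntegral_le hs0.le hsp.le N (by simp) f.measurable.aemeasurable).trans hf
  have hIfin : I ≠ ∞ := by
    intro hI'
    rw [hI', ENNReal.mul_top (by simp [ENNReal.rpow_eq_zero_iff, hN0]), top_le_iff] at hIle
    exact ENNReal.rpow_ne_top_of_ne_zero hN0 (by simp) hIle
  have hIN : (N : ℝ≥0∞) ^ (1 - s) * I ≤ N := by
    calc (N : ℝ≥0∞) ^ (1 - s) * I = (N : ℝ≥0∞) ^ (1 - p) * ((N : ℝ≥0∞) ^ (p - s) * I) := by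
          rw [← mul_assoc, ← ENNReal.rpow_add _ _ hN0 (by simp)]
          congr 2; ring
      _ ≤ (N : ℝ≥0∞) ^ (1 - p) * (N : ℝ≥0∞) ^ p := mul_le_mul' le_rfl hIle
      _ = N := by
          rw [← ENNReal.rpow_add _ _ hN0 (by simp), sub_add_cancel, ENNReal.rpow_one]
  obtain ⟨g, b, hg, hfgb, hga, -, hb⟩ := hC f N f.aestronglyMeasurable hN hIfin
  have hgM : ∀ᵐ x ∂μ, ‖g x‖ₑ ≤ (C₃ * N : ℝ≥0) := by
    refine hga.mono fun x hx => hx.trans ?_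
    rw [hm]
    calc (C : ℝ≥0∞) * (N + (N : ℝ≥0∞) ^ (1 - s) * I / m) ≤ C * (N + (N : ℝ≥0∞) / m) := by gcongr
      _ = ((C * (1 + m⁻¹) * N : ℝ≥0) : ℝ≥0∞) := by
          rw [← ENNReal.coe_div hm0, ← ENNReal.coe_add, ← ENNReal.coe_mul, div_eq_mul_inv]
          congr 1; ring
      _ ≤ _ := ENNReal.coe_le_coe.2 (by gcongr; exact le_self_add)
  obtain ⟨c, hc, hgc⟩ := hC' g (C₃ * N) hg (by positivity) hgM
  have hcN : ‖c‖ₑ ≤ (C₄ * N : ℝ≥0) := hc.trans (ENNReal.coe_le_coe.2 (by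
    rw [← mul_assoc]; gcongr; exact le_self_add))
  have hcχ := AEEqFun.coeFn_smul c χ
  have hbH : H1Le μ lam ρ q (f - c • χ : X →ₘ[μ] ℂ) (C₄ * N : ℝ≥0) := by
    refine ((hgc.add h.measure_ball_lt_top hρ hq ENNReal.coe_ne_top
      (ENNReal.mul_ne_top ENNReal.coe_ne_top ENNReal.coe_ne_top)
      (hb.mono (mul_le_mul' le_rfl hIN))).mono ?_).congr ?_
    · rw [hC₄]; push_cast; exact le_of_eq (by ring)
    · filter_upwards [hfgb, AEEqFun.coeFn_sub f (c • χ), hcχ, hχae] with x h1 h2 h3 h4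
      rw [h2, Pi.sub_apply, h3, Pi.smul_apply, h4, h1, Pi.add_apply]
      by_cases hxB : x ∈ B.carrier
      · simp only [indicator_of_mem hxB, smul_eq_mul]; ring
      · simp only [indicator_of_notMem hxB, smul_eq_mul]; ring
  have hbmem := (hbH.memH1 h.measure_ball_lt_top hρ hq ENNReal.coe_ne_top).1
  have hcχ1 : ∀ᵐ x ∂μ, ‖(c • χ : X →ₘ[μ] ℂ) x‖ₑ ≤ ‖c‖₊ := by
    filter_upwards [hcχ, hχ1] with x h1 h2
    rw [h1, Pi.smul_apply, enorm_smul]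
    exact mul_le_of_le_one_right' h2
  have hzero : MemH1 μ lam ρ q (0 : X →ₘ[μ] ℂ) :=
    (((H1Le.zero 0).congr AEEqFun.coeFn_zero.symm).memH1 h.measure_ball_lt_top hρ hq
      ENNReal.zero_ne_top).1
  have hfeq : f = c • χ + (f - c • χ) := (add_sub_cancel _ _).symm
  refine ⟨mem_linftyAddH1 hcχ1 hbmem hfeq, fun t => ?_⟩
  have hTf : ∀ᵐ x ∂μ, ‖T f x‖ₑ ≤ ‖c‖ₑ * ‖T χ x‖ₑ + ‖T (f - c • χ) x‖ₑ := by
    have h1 := hT.1 (c • χ) (mem_linftyAddH1 hcχ1 hzero (add_zero _).symm) (f - c • χ)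
      hbmem.mem_linftyAddH1
    filter_upwards [h1, hT.2 c χ (mem_linftyAddH1 hχ1 hzero (add_zero _).symm)] with x h2 h3
    rw [h3, ← hfeq] at h2
    simp only [← ofReal_norm]
    rw [← ENNReal.ofReal_mul (norm_nonneg _), ← ENNReal.ofReal_add (by positivity) (norm_nonneg _)]
    exact ENNReal.ofReal_le_ofReal h2
  set t' : ℝ≥0 := t / 2 with ht'
  have htt : (t : ℝ≥0∞) = 2 * t' := by
    rw [← ENNReal.coe_ofNat, ← ENNReal.coe_mul, ht', mul_div_cancel₀ _ (by norm_num)]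
  have hsub : μ {x | (t : ℝ≥0∞) < ‖T f x‖ₑ} ≤ μ {x | (t' : ℝ≥0∞) ≤ ‖c‖ₑ * ‖T χ x‖ₑ} +
      μ {x | (t' : ℝ≥0∞) < ‖T (f - c • χ) x‖ₑ} := by
    refine le_trans (measure_mono_ae ?_) (measure_union_le _ _)
    filter_upwards [hTf] with x hx hxt
    by_contra hcon
    have h1 : ‖c‖ₑ * ‖T χ x‖ₑ ≤ t' := (not_le.1 fun hh => hcon (Or.inl hh)).le
    have h2 : ‖T (f - c • χ) x‖ₑ ≤ t' := not_lt.1 fun hh => hcon (Or.inr hh)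
    have h3 : (t : ℝ≥0∞) < ‖T f x‖ₑ := hxt
    refine absurd h3 (not_lt.2 (hx.trans ((add_le_add h1 h2).trans (le_of_eq ?_))))
    rw [htt, two_mul]
  have hmarkov : t' * μ {x | (t' : ℝ≥0∞) ≤ ‖c‖ₑ * ‖T χ x‖ₑ} ≤ ‖c‖ₑ * J := by
    rw [← hJ, ← lintegral_const_mul' _ _ enorm_ne_top]
    exact mul_meas_ge_le_lintegral₀ ((T χ).measurable.enorm.const_mul _).aemeasurable _
  calc t * μ {x | (t : ℝ≥0∞) < ‖T f x‖ₑ}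
      ≤ 2 * t' * (μ {x | (t' : ℝ≥0∞) ≤ ‖c‖ₑ * ‖T χ x‖ₑ} +
          μ {x | (t' : ℝ≥0∞) < ‖T (f - c • χ) x‖ₑ}) := by rw [← htt]; gcongr
    _ = 2 * (t' * μ {x | (t' : ℝ≥0∞) ≤ ‖c‖ₑ * ‖T χ x‖ₑ} +
          t' * μ {x | (t' : ℝ≥0∞) < ‖T (f - c • χ) x‖ₑ}) := by ring
    _ ≤ 2 * ((C₄ * N : ℝ≥0) * J + C₂ * (C₄ * N : ℝ≥0)) := by
        refine mul_le_mul' le_rfl (add_le_add (hmarkov.trans (mul_le_mul' hcN le_rfl)) ?_)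
        exact hC₂ _ _ ENNReal.coe_ne_top hbH t'
    _ = _ := by push_cast; ring

/-- The `L^p` estimate on spaces of finite measure. -/
lemma Admissible.exists_lintegral_rpow_le_of_finite [BorelSpace X] [SecondCountableTopology X]
    [Nonempty X] (h : Admissible μ lam α γ β) (hlam : IsDominating μ lam) (hηα : 5 * η ≤ α)
    (hρ : 1 ≤ ρ) (hρα : 5 * ρ ≤ α) (hq : 1 < q)
    (hT : IsSublinearOn (linftyAddH1 μ lam ρ q) T) (hT_infty : BoundedLinftyRBMO μ lam η T)
    (hT_one : BoundedH1WeakL1 μ lam ρ q T) (hμ : μ univ ≠ ∞) (hμ0 : μ univ ≠ 0) {p : ℝ}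
    (hp : 1 < p) :
    ∃ C : ℝ≥0, ∀ f : X →ₘ[μ] ℂ, ∫⁻ x, ‖f x‖ₑ ^ p ∂μ ≠ ∞ → f ∈ linftyAddH1 μ lam ρ q ∧
      ∫⁻ x, ‖T f x‖ₑ ^ p ∂μ ≤ C * ∫⁻ x, ‖f x‖ₑ ^ p ∂μ := by
  have hp0 : 0 < p := by linarith
  obtain ⟨C₁, hC₁⟩ := h.exists_weak_bound hlam hρ hρα hq hT hT_infty hT_one hμ hμ0 hp
  obtain ⟨C₂, a, ha, hC₂⟩ := h.exists_lintegral_rpow_le hηα hρ hρα hq hT hT_infty hT_one hp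
  obtain ⟨m, hm⟩ : ∃ m : ℝ≥0, μ univ = m := ⟨_, (ENNReal.coe_toNNReal hμ).symm⟩
  have hm0 : 0 < m := pos_iff_ne_zero.2 fun h0 => hμ0 (by rw [hm, h0, ENNReal.coe_zero])
  have hβ : 0 < β := one_pos.trans_le h.one_le
  -- the height, relative to the norm of `f`, above which the good-`λ` inequality applies
  set E : ℝ≥0 := 4 * β * (C₁ + 1) / m + a⁻¹ * (m ^ p⁻¹)⁻¹ with hE
  set C : ℝ≥0 := C₂ * (E ^ p * m + 1) with hC
  have key : ∀ (f : X →ₘ[μ] ℂ) (N : ℝ≥0), 0 < N → ∫⁻ x, ‖f x‖ₑ ^ p ∂μ ≤ (N : ℝ≥0∞) ^ p →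
      ∫⁻ x, ‖T f x‖ₑ ^ p ∂μ ≤ C * (N : ℝ≥0∞) ^ p := by
    intro f N hN hf
    have hf' : ∫⁻ x, ‖f x‖ₑ ^ p ∂μ ≠ ∞ :=
      ne_top_of_le_ne_top (ENNReal.rpow_ne_top_of_nonneg hp0.le (by simp)) hf
    have hweak := (hC₁ f N hN hf).2
    refine (hC₂ f (E * N) _ ENNReal.coe_ne_top hf' hweak fun t ht hEt => ⟨?_, ?_⟩).trans ?_
    · by_contra! hcon
      have h1 : (4 * β)⁻¹ * m * t ≤ C₁ * N := by
        rw [← ENNReal.coe_le_coe]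
        refine le_trans ?_ (hweak t)
        rw [mul_comm _ t, ENNReal.coe_mul]
        gcongr
        rw [hm] at hcon
        refine le_trans (le_of_eq ?_) hcon
        rw [ENNReal.coe_mul, ENNReal.coe_inv (by positivity)]
        push_cast; rfl
      have h2 : (C₁ + 1) * N ≤ (4 * β)⁻¹ * m * t := by
        calc (C₁ + 1) * N = (4 * β)⁻¹ * m * (4 * β * (C₁ + 1) / m * N) := by
              field_simp
          _ ≤ (4 * β)⁻¹ * m * (E * N) := by
              gcongr
              exact le_self_add
          _ ≤ _ := by gcongr
      have h3 : C₁ * N < (C₁ + 1) * N := by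
        gcongr
        exact lt_add_of_pos_right _ one_pos
      exact absurd (h2.trans h1) (not_le.2 h3)
    · refine hf.trans ?_
      have h1 : N ≤ a * t * m ^ p⁻¹ := by
        calc N = a * (a⁻¹ * (m ^ p⁻¹)⁻¹ * N) * m ^ p⁻¹ := by
              have : m ^ p⁻¹ ≠ 0 := (NNReal.rpow_pos hm0).ne'
              field_simp
          _ ≤ a * (E * N) * m ^ p⁻¹ := by
              gcongr
              exact le_add_self
          _ ≤ _ := by gcongr
      have h2 : N ^ p ≤ (a * t) ^ p * m := by
        calc N ^ p ≤ (a * t * m ^ p⁻¹) ^ p := by gcongr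
          _ = _ := by
              rw [NNReal.mul_rpow, ← NNReal.rpow_mul, inv_mul_cancel₀ hp0.ne', NNReal.rpow_one]
      rw [hm, ← ENNReal.coe_mul, ← ENNReal.coe_rpow_of_nonneg _ hp0.le,
        ← ENNReal.coe_rpow_of_nonneg _ hp0.le, ← ENNReal.coe_mul]
      exact ENNReal.coe_le_coe.2 h2
    · rw [hm]
      calc C₂ * (((E * N : ℝ≥0) : ℝ≥0∞) ^ p * m + ∫⁻ x, ‖f x‖ₑ ^ p ∂μ)
          ≤ C₂ * (((E * N : ℝ≥0) : ℝ≥0∞) ^ p * m + (N : ℝ≥0∞) ^ p) := by gcongr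
        _ = _ := by
            rw [hC, ENNReal.coe_mul E, ENNReal.mul_rpow_of_nonneg _ _ hp0.le, ENNReal.coe_mul C₂,
              ENNReal.coe_add (E ^ p * m) 1, ENNReal.coe_mul (E ^ p),
              ENNReal.coe_rpow_of_nonneg E hp0.le, ENNReal.coe_one]
            ring
  refine ⟨C, fun f hf => ?_⟩
  have hroot : ∀ r : ℝ≥0, ((r ^ p⁻¹ : ℝ≥0) : ℝ≥0∞) ^ p = r := fun r => by
    rw [← ENNReal.coe_rpow_of_nonneg _ hp0.le, ← NNReal.rpow_mul, inv_mul_cancel₀ hp0.ne',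
      NNReal.rpow_one]
  obtain ⟨I, hI⟩ : ∃ I : ℝ≥0, ∫⁻ x, ‖f x‖ₑ ^ p ∂μ = I := ⟨_, (ENNReal.coe_toNNReal hf).symm⟩
  refine ⟨(hC₁ f ((I + 1) ^ p⁻¹) (NNReal.rpow_pos (by positivity)) ?_).1, ?_⟩
  · rw [hroot, hI]
    exact ENNReal.coe_le_coe.2 le_self_add
  · refine ENNReal.le_of_forall_pos_le_add fun ε hε _ => ?_
    have h1 := key f ((I + ε / (C + 1)) ^ p⁻¹) (NNReal.rpow_pos (by positivity)) (by
      rw [hroot, hI]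
      exact ENNReal.coe_le_coe.2 le_self_add)
    rw [hroot] at h1
    refine h1.trans ?_
    rw [hI, ← ENNReal.coe_mul, ← ENNReal.coe_mul, ← ENNReal.coe_add]
    refine ENNReal.coe_le_coe.2 ?_
    rw [mul_add]
    gcongr
    rw [← mul_div_assoc]
    exact div_le_of_le_mul₀ bot_le bot_le (by
      rw [mul_comm]; gcongr; exact le_self_add)

/-! ### Spaces of infinite measure -/

/-- The `L^p` estimate on spaces of infinite measure, for elements of the Hardy space. -/
lemma Admissible.exists_lintegral_rpow_le_of_infinite [BorelSpace X] [SecondCountableTopology X]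
    [Nonempty X] (h : Admissible μ lam α γ β) (hηα : 5 * η ≤ α)
    (hρ : 1 ≤ ρ) (hρα : 5 * ρ ≤ α) (hq : 1 < q)
    (hT : IsSublinearOn (linftyAddH1 μ lam ρ q) T) (hT_infty : BoundedLinftyRBMO μ lam η T)
    (hT_one : BoundedH1WeakL1 μ lam ρ q T) (hμ : μ univ = ∞) {p : ℝ} (hp : 1 < p) :
    ∃ C : ℝ≥0, ∀ f : X →ₘ[μ] ℂ, MemH1 μ lam ρ q f → ∫⁻ x, ‖f x‖ₑ ^ p ∂μ ≠ ∞ →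
      ∫⁻ x, ‖T f x‖ₑ ^ p ∂μ ≤ C * ∫⁻ x, ‖f x‖ₑ ^ p ∂μ := by
  have hp0 : 0 < p := by linarith
  obtain ⟨C₁, hC₁⟩ := hT_one.exists_bound h.measure_ball_lt_top hρ hq
  obtain ⟨C₂, a, ha, hC₂⟩ := h.exists_lintegral_rpow_le hηα hρ hρα hq hT hT_infty hT_one hp
  refine ⟨C₂, fun f hf hfp => ?_⟩
  obtain ⟨w, hw, hfw⟩ := hf.exists_h1Le
  have hW : C₁ * w ≠ ∞ := ENNReal.mul_ne_top (by simp) hw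
  -- `t₀ = 0` is allowed, and `0 ^ p * μ univ = 0 * ∞ = 0`
  have := hC₂ f 0 (C₁ * w) hW hfp (hC₁ f w hw hfw) fun t ht _ => ⟨?_, ?_⟩
  · simpa [hp0] using this
  · rw [hμ, ENNReal.mul_top (ENNReal.inv_ne_zero.2 (ENNReal.mul_ne_top (by simp) (by simp)))]
    have h1 := hC₁ f w hw hfw t
    refine lt_top_iff_ne_top.2 fun h2 => ?_
    rw [h2, ENNReal.mul_top (by exact_mod_cast ht.ne'), top_le_iff] at h1
    exact hW h1
  · rw [hμ, ENNReal.mul_top]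
    · exact le_top
    · have : (a : ℝ≥0∞) * t ≠ 0 := by exact_mod_cast (by positivity : a * t ≠ 0)
      simp [ENNReal.rpow_eq_zero_iff, this, hp0.le]

end NonHom

namespace NonHom

open Set Metric Filter

/-! ### Extension from a dense subspace of `L^p` -/

/-- A sublinear operator that is bounded in `L^p` on a dense subspace `D` extends to `L^p`. The map
`f ↦ |T f|` is Lipschitz on `D` and thus has a continuous extension `Ψ` to `L^p`, which is used as
the value of the extension outside of `D`. -/
lemma exists_sublinear_extension {X : Type*} [MeasurableSpace X] {μ : Measure X} {p : ℝ≥0∞}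
    [Fact (1 ≤ p)] {T : (X →ₘ[μ] ℂ) → (X →ₘ[μ] ℂ)} (D : Submodule ℂ (Lp ℂ p μ))
    (hD : DenseRange ((↑) : D → Lp ℂ p μ))
    (hadd : ∀ f g : D, ∀ᵐ x ∂μ, ‖T ((f + g : D) : Lp ℂ p μ) x‖ ≤
      ‖T (f : Lp ℂ p μ) x‖ + ‖T (g : Lp ℂ p μ) x‖)
    (hsmul : ∀ (c : ℂ) (f : D), ∀ᵐ x ∂μ, ‖T ((c • f : D) : Lp ℂ p μ) x‖ =
      ‖c‖ * ‖T (f : Lp ℂ p μ) x‖) {C : ℝ≥0}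
    (hC : ∀ f : D, eLpNorm (T (f : Lp ℂ p μ)) p μ ≤ C * eLpNorm (f : Lp ℂ p μ) p μ) :
    ∃ S : (X →ₘ[μ] ℂ) → (X →ₘ[μ] ℂ), IsSublinearOn {f | f ∈ Lp ℂ p μ} S ∧ BoundedLp μ p S ∧
      ∀ f : D, S (f : Lp ℂ p μ) = T (f : Lp ℂ p μ) := by
  classical
  have hmem : ∀ f : D, MemLp (T (f : Lp ℂ p μ)) p μ := fun f =>
    ⟨(T (f : Lp ℂ p μ)).aestronglyMeasurable,
      (hC f).trans_lt (ENNReal.mul_lt_top (by simp) (Lp.memLp (f : Lp ℂ p μ)).2)⟩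
  set Φ : D → Lp ℝ p μ := fun f => (hmem f).norm.toLp with hΦ
  have hΦae : ∀ f : D, ∀ᵐ x ∂μ, Φ f x = ‖T (f : Lp ℂ p μ) x‖ := fun f => (hmem f).norm.coeFn_toLp
  have hΦnorm : ∀ f : D, ‖Φ f‖ ≤ C * ‖(f : Lp ℂ p μ)‖ := by
    intro f
    rw [Lp.norm_toLp, eLpNorm_norm, Lp.norm_def, ← ENNReal.coe_toReal, ← ENNReal.toReal_mul]
    exact ENNReal.toReal_mono (ENNReal.mul_ne_top (by simp) (Lp.memLp (f : Lp ℂ p μ)).2.ne) (hC f)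
  have hΦlip : LipschitzWith C Φ := by
    refine LipschitzWith.of_dist_le_mul fun f g => ?_
    have hsub : ∀ f g : D, ∀ᵐ x ∂μ,
        ‖T (f : Lp ℂ p μ) x‖ ≤ ‖T ((f - g : D) : Lp ℂ p μ) x‖ + ‖T (g : Lp ℂ p μ) x‖ := by
      intro f g
      have := hadd (f - g) g
      rwa [sub_add_cancel] at this
    have hsymm : ∀ᵐ x ∂μ, ‖T ((g - f : D) : Lp ℂ p μ) x‖ = ‖T ((f - g : D) : Lp ℂ p μ) x‖ := by
      have := hsmul (-1) (f - g)
      rw [neg_one_smul, neg_sub, norm_neg, norm_one] at this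
      simpa using this
    have h1 : ‖Φ f - Φ g‖ ≤ ‖Φ (f - g)‖ := by
      refine Lp.norm_le_norm_of_ae_le ?_
      filter_upwards [Lp.coeFn_sub (Φ f) (Φ g), hΦae f, hΦae g, hΦae (f - g), hsub f g, hsub g f,
        hsymm] with x h1 h2 h3 h4 h5 h6 h7
      rw [h1, Pi.sub_apply, h2, h3, h4, norm_norm, Real.norm_eq_abs, abs_sub_le_iff]
      constructor <;> linarith
    rw [dist_eq_norm, Subtype.dist_eq, dist_eq_norm]
    exact h1.trans (hΦnorm (f - g))
  have hind : IsUniformInducing ((↑) : D → Lp ℂ p μ) :=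
    isUniformEmbedding_subtype_val.isUniformInducing
  set Ψ : Lp ℂ p μ → Lp ℝ p μ := (hind.isDenseInducing hD).extend Φ with hΨ
  have hΨc : Continuous Ψ :=
    (uniformContinuous_uniformly_extend hind hD hΦlip.uniformContinuous).continuous
  have hΨD : ∀ f : D, Ψ f = Φ f := fun f =>
    uniformly_extend_of_ind hind hD hΦlip.uniformContinuous f
  have hΨ0 : ∀ f, 0 ≤ Ψ f := by
    refine fun f => hD.induction_on f (isClosed_le continuous_const hΨc) fun f => ?_
    rw [hΨD, ← Lp.coeFn_nonneg]
    filter_upwards [hΦae f] with x hx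
    rw [hx]
    exact norm_nonneg _
  have hΨadd : ∀ f g, Ψ (f + g) ≤ Ψ f + Ψ g := by
    refine fun f g => hD.induction_on₂ (p := fun f g => Ψ (f + g) ≤ Ψ f + Ψ g) (isClosed_le
      (hΨc.comp (continuous_fst.add continuous_snd))
      ((hΨc.comp continuous_fst).add (hΨc.comp continuous_snd))) (fun f g => ?_) f g
    rw [← Submodule.coe_add, hΨD, hΨD, hΨD, ← Lp.coeFn_le]
    filter_upwards [hΦae f, hΦae g, hΦae (f + g), hadd f g, Lp.coeFn_add (Φ f) (Φ g)] with
      x h1 h2 h3 h4 h5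
    rw [h5, Pi.add_apply, h1, h2, h3]
    exact h4
  have hΨsmul : ∀ (c : ℂ) f, Ψ (c • f) = ‖c‖ • Ψ f := by
    refine fun c f => hD.induction_on f (isClosed_eq (hΨc.comp (continuous_const_smul c))
      (hΨc.const_smul ‖c‖)) fun f => ?_
    rw [← Submodule.coe_smul, hΨD, hΨD]
    refine Lp.ext ?_
    filter_upwards [hΦae f, hΦae (c • f), hsmul c f, Lp.coeFn_smul ‖c‖ (Φ f)] with x h1 h2 h3 h4
    rw [h4, Pi.smul_apply, h1, h2, h3, smul_eq_mul]
  have hΨnorm : ∀ f, ‖Ψ f‖ ≤ C * ‖f‖ := by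
    refine fun f => hD.induction_on f (isClosed_le hΨc.norm (continuous_const.mul continuous_norm))
      fun f => ?_
    rw [hΨD]
    exact hΦnorm f
  set S : (X →ₘ[μ] ℂ) → (X →ₘ[μ] ℂ) := fun f =>
    if h : f ∈ Lp ℂ p μ then
      if (⟨f, h⟩ : Lp ℂ p μ) ∈ D then T f
      else AEEqFun.comp (fun r : ℝ => (r : ℂ)) Complex.continuous_ofReal (Ψ ⟨f, h⟩)
    else 0 with hS
  have hSD : ∀ f : D, S (f : Lp ℂ p μ) = T (f : Lp ℂ p μ) := by
    intro f
    simp only [hS, Subtype.coe_eta, SetLike.coe_mem, dite_true, if_true]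
  have hSΨ : ∀ f : Lp ℂ p μ, ∀ᵐ x ∂μ, ‖S f x‖ = Ψ f x := by
    intro f
    by_cases hf : f ∈ D
    · rw [hSD ⟨f, hf⟩, hΨD ⟨f, hf⟩]
      filter_upwards [hΦae ⟨f, hf⟩] with x hx using hx.symm
    · have h1 : S f = AEEqFun.comp (fun r : ℝ => (r : ℂ)) Complex.continuous_ofReal (Ψ f) := by
        simp only [hS, Subtype.coe_eta, SetLike.coe_mem, dite_true, hf, if_false]
      rw [h1]
      filter_upwards [AEEqFun.coeFn_comp (fun r : ℝ => (r : ℂ)) Complex.continuous_ofReal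
        (Ψ f : X →ₘ[μ] ℝ), (Lp.coeFn_nonneg (Ψ f)).2 (hΨ0 f)] with x h2 h3
      rw [h2, Function.comp_apply, Complex.norm_real]
      exact Real.norm_of_nonneg h3
  refine ⟨S, ⟨fun f hf g hg => ?_, fun c f hf => ?_⟩, ⟨C, fun f hf => ?_⟩, hSD⟩
  · filter_upwards [hSΨ ⟨f, hf⟩, hSΨ ⟨g, hg⟩, hSΨ (⟨f, hf⟩ + ⟨g, hg⟩),
      (Lp.coeFn_le _ _).2 (hΨadd ⟨f, hf⟩ ⟨g, hg⟩),
      Lp.coeFn_add (Ψ ⟨f, hf⟩) (Ψ ⟨g, hg⟩)] with x h1 h2 h3 h4 h5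
    rw [h5, Pi.add_apply, ← h1, ← h2, ← h3] at h4
    exact h4
  · have h0 := hSΨ (c • ⟨f, hf⟩)
    rw [hΨsmul] at h0
    filter_upwards [hSΨ ⟨f, hf⟩, h0, Lp.coeFn_smul ‖c‖ (Ψ ⟨f, hf⟩)] with x h1 h2 h3
    rw [h3, Pi.smul_apply, ← h1, smul_eq_mul] at h2
    exact h2
  · have h1 : eLpNorm (S f) p μ = eLpNorm (Ψ ⟨f, hf⟩) p μ := by
      refine eLpNorm_congr_norm_ae ?_
      filter_upwards [hSΨ ⟨f, hf⟩, (Lp.coeFn_nonneg _).2 (hΨ0 ⟨f, hf⟩)] with x h1 h2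
      rw [Real.norm_of_nonneg h2]
      exact h1
    have h2 : eLpNorm (Ψ ⟨f, hf⟩) p μ ≤ C * eLpNorm f p μ := by
      have h3 := hΨnorm ⟨f, hf⟩
      rw [Lp.norm_def, Lp.norm_def, ← ENNReal.coe_toReal, ← ENNReal.toReal_mul] at h3
      exact (ENNReal.toReal_le_toReal (Lp.memLp (Ψ ⟨f, hf⟩)).2.ne
        (ENNReal.mul_ne_top (by simp) (Lp.memLp (⟨f, hf⟩ : Lp ℂ p μ)).2.ne)).1 h3
    exact ⟨Lp.mem_Lp_iff_eLpNorm_lt_top.2 (h1 ▸ (Lp.memLp (Ψ ⟨f, hf⟩)).2), h1 ▸ h2⟩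

variable {X : Type*} [MetricSpace X] [MeasurableSpace X] {μ : Measure X} {lam : X → ℝ → ℝ}
  {α γ η ρ : ℝ} {β : ℝ≥0} {q : ℝ≥0∞} {T : (X →ₘ[μ] ℂ) → (X →ₘ[μ] ℂ)}

/-- If `μ(X) = ∞`, then `H¹` is dense in `L^p`: the mean value of a bounded function with bounded
support can be removed by a constant on a large ball, the `L^p` norm of which is small. -/
lemma Admissible.exists_h1Le_eLpNorm_sub_le [BorelSpace X] [Nonempty X]
    (h : Admissible μ lam α γ β) (hρ : 1 ≤ ρ) (hq : 1 < q) (hμ : μ univ = ∞) {p : ℝ≥0∞}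
    (hp : 1 < p) (hp_top : p ≠ ∞) {f : X → ℂ} (hf : MemLp f p μ) {ε : ℝ≥0∞} (hε : ε ≠ 0) :
    ∃ g : X → ℂ, eLpNorm (f - g) p μ ≤ ε ∧ MemLp g p μ ∧ ∃ w ≠ ∞, H1Le μ lam ρ q g w := by
  have hp0 : p ≠ 0 := (one_pos.trans hp).ne'
  have hpr : 1 < p.toReal := by
    rw [← ENNReal.toReal_one]
    exact (ENNReal.toReal_lt_toReal (by simp) hp_top).2 hp
  refine hf.induction_dense hp_top (fun g => MemLp g p μ ∧ ∃ w ≠ ∞, H1Le μ lam ρ q g w) ?_ ?_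
    (fun g hg => hg.1.1) hε
  · intro c s hs hsfin δ hδ
    obtain ⟨x₀⟩ := ‹Nonempty X›
    have hmono : Monotone fun n : ℕ => ball x₀ (n : ℝ) := fun i j hij =>
      ball_subset_ball (by exact_mod_cast hij)
    have hlim1 : Tendsto (fun n : ℕ => μ (s \ ball x₀ n)) atTop (nhds 0) := by
      have := tendsto_measure_iInter_atTop (μ := μ) (s := fun n : ℕ => s \ ball x₀ n)
        (fun n => (hs.diff measurableSet_ball).nullMeasurableSet)
        (fun i j hij => sdiff_subset_sdiff_right (hmono hij))
        ⟨0, (measure_mono sdiff_subset |>.trans_lt hsfin).ne⟩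
      rw [← sdiff_iUnion, iUnion_ball_nat, sdiff_univ, measure_empty] at this
      exact this
    have hlim2 : Tendsto (fun n : ℕ => μ (ball x₀ n)) atTop (nhds ∞) := by
      have := tendsto_measure_iUnion_atTop (μ := μ) hmono
      rwa [iUnion_ball_nat, hμ] at this
    have hlim : Tendsto (fun n : ℕ => ‖c‖ₑ * μ (s \ ball x₀ n) ^ (1 / p.toReal) +
        ‖c‖ₑ * μ s * μ (ball x₀ n) ^ (1 / p.toReal - 1)) atTop (nhds 0) := by
      have e1 := ENNReal.Tendsto.const_mul (a := ‖c‖ₑ)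
        (((ENNReal.continuous_rpow_const (y := 1 / p.toReal)).tendsto 0).comp hlim1)
        (Or.inr enorm_ne_top)
      have e2 := ENNReal.Tendsto.const_mul (a := ‖c‖ₑ * μ s)
        (((ENNReal.continuous_rpow_const (y := 1 / p.toReal - 1)).tendsto ∞).comp hlim2)
        (Or.inr (ENNReal.mul_ne_top enorm_ne_top hsfin.ne))
      have h3 : 1 / p.toReal - 1 < 0 := by
        rw [sub_neg, div_lt_one (by linarith)]; exact hpr
      have h4 := e1.add e2
      rw [ENNReal.top_rpow_of_neg h3, ENNReal.zero_rpow_of_pos (by positivity), mul_zero,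
        mul_zero, add_zero] at h4
      exact h4
    obtain ⟨n, ⟨hnδ, hnμ⟩, hn⟩ := (((hlim.eventually (gt_mem_nhds (pos_iff_ne_zero.2 hδ))).and
      (hlim2.eventually (lt_mem_nhds ENNReal.zero_lt_top))).and (eventually_gt_atTop 0)).exists
    set B : Ball X := ⟨x₀, n, by exact_mod_cast hn⟩ with hB
    have hBm : MeasurableSet B.carrier := B.measurableSet_carrier
    have hBfin : μ B.carrier ≠ ∞ := (h.measure_ball_lt_top _ _).ne
    have hB0 : μ B.carrier ≠ 0 := hnμ.ne'
    have hBreal : μ.real B.carrier ≠ 0 := ENNReal.toReal_ne_zero.2 ⟨hB0, hBfin⟩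
    have hsBm : MeasurableSet (s ∩ B.carrier) := hs.inter hBm
    have hsBfin : μ (s ∩ B.carrier) ≠ ∞ := (measure_mono inter_subset_left |>.trans_lt hsfin).ne
    set c' : ℂ := ((μ.real (s ∩ B.carrier) / μ.real B.carrier : ℝ) : ℂ) * c with hc'
    have hmemB : ∀ (d : ℂ) (A : Set X), MeasurableSet A → μ A ≠ ∞ →
        MemLp (A.indicator fun _ => d) p μ := fun d A hA hAfin =>
      memLp_indicator_const p hA d (Or.inr hAfin)
    have hbound : ∀ (d : ℂ) (A : Set X) (x : X), ‖A.indicator (fun _ => d) x‖ₑ ≤ ‖d‖₊ := by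
      intro d A x
      by_cases hx : x ∈ A
      · rw [indicator_of_mem hx]; rfl
      · rw [indicator_of_notMem hx]; simp
    have hblock := H1Le.of_add (q := q) (lam := lam) (μ := μ) (A₁ := B) (A₂ := B) (B := B)
      (u₁ := (s ∩ B.carrier).indicator fun _ => c) (u₂ := B.carrier.indicator fun _ => -c')
      h.measure_ball_lt_top hρ subset_rfl subset_rfl (h.delta_self_le B) (h.delta_self_le B)
      hB0 hB0 (aestronglyMeasurable_const.indicator hsBm)
      (aestronglyMeasurable_const.indicator hBm)
      (support_indicator_subset.trans inter_subset_right) support_indicator_subset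
      (hbound _ _) (hbound _ _) (by
        rw [integral_add ((integrableOn_const hsBfin).integrable_indicator hsBm)
          ((integrableOn_const hBfin).integrable_indicator hBm), integral_indicator hsBm,
          integral_indicator hBm, setIntegral_const, setIntegral_const, Complex.real_smul,
          Complex.real_smul, hc', mul_neg, ← mul_assoc, ← Complex.ofReal_mul,
          mul_div_cancel₀ _ hBreal, add_neg_cancel])
    refine ⟨_, ?_, (hmemB c _ hsBm hsBfin).add (hmemB (-c') _ hBm hBfin), _, ?_, hblock⟩
    · have heq : ((s ∩ B.carrier).indicator fun _ => c) + (B.carrier.indicator fun _ => -c') -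
          (s.indicator fun _ => c) =
          ((s \ B.carrier).indicator fun _ => -c) + B.carrier.indicator fun _ => -c' := by
        funext x
        by_cases hxs : x ∈ s <;> by_cases hxB : x ∈ B.carrier <;>
          simp [indicator, hxs, hxB]
      rw [heq]
      refine (eLpNorm_add_le ((hmemB _ _ (hs.diff hBm)
        (measure_mono sdiff_subset |>.trans_lt hsfin).ne).1) (hmemB _ _ hBm hBfin).1 hp.le).trans
        (le_trans (add_le_add ?_ ?_) hnδ.le)
      · rw [eLpNorm_indicator_const (hs.diff hBm) hp0 hp_top, enorm_neg]
        rfl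
      · rw [eLpNorm_indicator_const hBm hp0 hp_top, enorm_neg]
        have hc'le : ‖c'‖ₑ ≤ ‖c‖ₑ * μ s * (μ B.carrier)⁻¹ := by
          rw [hc', enorm_mul, ← ofReal_norm, Complex.norm_real, Real.norm_of_nonneg (by positivity),
            ENNReal.ofReal_div_of_pos (by positivity), ofReal_measureReal hsBfin,
            ofReal_measureReal hBfin, div_eq_mul_inv]
          calc μ (s ∩ B.carrier) * (μ B.carrier)⁻¹ * ‖c‖ₑ ≤ μ s * (μ B.carrier)⁻¹ * ‖c‖ₑ := by
                gcongr; exact inter_subset_left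
            _ = _ := by ring
        calc ‖c'‖ₑ * μ B.carrier ^ (1 / p.toReal)
            ≤ ‖c‖ₑ * μ s * (μ B.carrier)⁻¹ * μ B.carrier ^ (1 / p.toReal) := by gcongr
          _ = ‖c‖ₑ * μ s * μ B.carrier ^ (1 / p.toReal - 1) := by
              rw [ENNReal.rpow_sub _ _ hB0 hBfin, ENNReal.rpow_one, mul_assoc,
                mul_comm (μ B.carrier)⁻¹, ← div_eq_mul_inv]
          _ ≤ _ := le_rfl
    · have := (h.measure_ball_lt_top B.center (ρ * B.radius)).ne
      exact ENNReal.mul_ne_top (ENNReal.add_ne_top.2 ⟨ENNReal.mul_ne_top ENNReal.coe_ne_top this,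
        ENNReal.mul_ne_top ENNReal.coe_ne_top this⟩) (by simp)
  · rintro g₁ g₂ ⟨hg₁, w₁, hw₁, hH₁⟩ ⟨hg₂, w₂, hw₂, hH₂⟩
    exact ⟨hg₁.add hg₂, _, ENNReal.add_ne_top.2 ⟨hw₁, hw₂⟩,
      hH₁.add h.measure_ball_lt_top hρ hq hw₁ hw₂ hH₂⟩

/-- The subspace of `L^p` of the elements that belong to the Hardy space. The hypotheses only
serve to show that it is closed under the vector space operations. -/
def lpH1 (μ : Measure X) (lam : X → ℝ → ℝ) (ρ : ℝ) (q : ℝ≥0∞) (p : ℝ≥0∞) [OpensMeasurableSpace X]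
    [Nonempty X] (hfin : ∀ x r, μ (ball x r) < ∞) (hρ : 1 ≤ ρ) (hq : 1 < q) :
    Submodule ℂ (Lp ℂ p μ) where
  carrier := {f | MemH1 μ lam ρ q f}
  add_mem' := by
    rintro f g hf hg
    obtain ⟨w₁, hw₁, hH₁⟩ := MemH1.exists_h1Le hf
    obtain ⟨w₂, hw₂, hH₂⟩ := MemH1.exists_h1Le hg
    exact (((hH₁.add hfin hρ hq hw₁ hw₂ hH₂).congr (Lp.coeFn_add f g).symm).memH1 hfin hρ hq
      (ENNReal.add_ne_top.2 ⟨hw₁, hw₂⟩)).1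
  zero_mem' := (((H1Le.zero 0).congr (Lp.coeFn_zero ℂ p μ).symm).memH1 hfin hρ hq
    ENNReal.zero_ne_top).1
  smul_mem' := by
    intro c f hf
    obtain ⟨w, hw, hH⟩ := MemH1.exists_h1Le hf
    exact (((hH.const_smul c).congr (Lp.coeFn_smul c f).symm).memH1 hfin hρ hq
      (ENNReal.mul_ne_top enorm_ne_top hw)).1

lemma Admissible.denseRange_lpH1 [BorelSpace X] [Nonempty X] (h : Admissible μ lam α γ β)
    (hρ : 1 ≤ ρ) (hq : 1 < q) (hμ : μ univ = ∞) {p : ℝ≥0∞} [Fact (1 ≤ p)] (hp : 1 < p)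
    (hp_top : p ≠ ∞) :
    DenseRange ((↑) : lpH1 μ lam ρ q p h.measure_ball_lt_top hρ hq → Lp ℂ p μ) := by
  refine fun f => EMetric.mem_closure_iff.2 fun ε hε => ?_
  obtain ⟨ε', hε', hεε'⟩ := exists_between hε
  obtain ⟨g, hfg, hg, w, hw, hgw⟩ := h.exists_h1Le_eLpNorm_sub_le (q := q) hρ hq hμ hp hp_top
    (Lp.memLp f) hε'.ne'
  refine ⟨hg.toLp g, ⟨⟨hg.toLp g, ((hgw.congr hg.coeFn_toLp.symm).memH1 h.measure_ball_lt_top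
    hρ hq hw).1⟩, rfl⟩, ?_⟩
  rw [Lp.edist_def]
  refine lt_of_le_of_lt (le_of_eq_of_le (eLpNorm_congr_ae ?_) hfg) hεε'
  filter_upwards [hg.coeFn_toLp] with x hx
  rw [Pi.sub_apply, Pi.sub_apply, hx]

lemma eLpNorm_le_of_lintegral_rpow_le {X : Type*} [MeasurableSpace X] {μ : Measure X} {p : ℝ≥0∞}
    (hp0 : p ≠ 0) (hp_top : p ≠ ∞) {f g : X → ℂ} {C : ℝ≥0}
    (h : ∫⁻ x, ‖f x‖ₑ ^ p.toReal ∂μ ≤ C * ∫⁻ x, ‖g x‖ₑ ^ p.toReal ∂μ) :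
    eLpNorm f p μ ≤ (C ^ (1 / p.toReal) : ℝ≥0) * eLpNorm g p μ := by
  rw [eLpNorm_eq_lintegral_rpow_enorm_toReal hp0 hp_top,
    eLpNorm_eq_lintegral_rpow_enorm_toReal hp0 hp_top,
    ENNReal.coe_rpow_of_nonneg _ (by positivity), ← ENNReal.mul_rpow_of_nonneg _ _ (by positivity)]
  gcongr

lemma lintegral_rpow_ne_top_of_mem_Lp {X : Type*} [MeasurableSpace X] {μ : Measure X} {p : ℝ≥0∞}
    (hp0 : p ≠ 0) (hp_top : p ≠ ∞) {f : X →ₘ[μ] ℂ} (hf : f ∈ Lp ℂ p μ) :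
    ∫⁻ x, ‖f x‖ₑ ^ p.toReal ∂μ ≠ ∞ :=
  (lintegral_rpow_enorm_lt_top_of_eLpNorm_lt_top hp0 hp_top
    (Lp.mem_Lp_iff_eLpNorm_lt_top.1 hf)).ne

end NonHom

theorem theorem1p1 {X : Type*} [MetricSpace X] [MeasurableSpace X] [BorelSpace X]
    (hX : NonHom.GeometricallyDoubling X)
    (μ : Measure X) (lam : X → ℝ → ℝ) (hlam : NonHom.IsDominating μ lam)
    (η : ℝ) (hη : 1 < η) (ρ : ℝ) (hρ : 1 < ρ) (q : ℝ≥0∞) (hq : 1 < q)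
    (T : (X →ₘ[μ] ℂ) → (X →ₘ[μ] ℂ))
    (hT : NonHom.IsSublinearOn (NonHom.linftyAddH1 μ lam ρ q) T)
    (hT_infty : NonHom.BoundedLinftyRBMO μ lam η T)
    (hT_one : NonHom.BoundedH1WeakL1 μ lam ρ q T)
    (p : ℝ≥0∞) (hp : 1 < p) (hp_top : p < ∞) :
    ∃ S : (X →ₘ[μ] ℂ) → (X →ₘ[μ] ℂ),
      NonHom.IsSublinearOn {f | f ∈ Lp ℂ p μ} S ∧
      NonHom.BoundedLp μ p S ∧
      (∀ f ∈ Lp ℂ p μ, NonHom.MemH1 μ lam ρ q f → S f = T f) ∧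
      (μ Set.univ < ∞ → ∀ f ∈ Lp ℂ p μ, f ∈ NonHom.linftyAddH1 μ lam ρ q → S f = T f) := by
  classical
  have hp0 : p ≠ 0 := (one_pos.trans hp).ne'
  have hp_ne : p ≠ ∞ := hp_top.ne
  have hp1 : 1 < p.toReal := by
    rw [← ENNReal.toReal_one]
    exact (ENNReal.toReal_lt_toReal (by simp) hp_ne).2 hp
  have : Fact (1 ≤ p) := ⟨hp.le⟩
  rcases eq_or_ne (μ Set.univ) 0 with hμ0 | hμ0
  · have hμ : μ = 0 := Measure.measure_univ_eq_zero.1 hμ0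
    subst hμ
    exact ⟨T, ⟨fun f _ g _ => by simp, fun c f _ => by simp⟩,
      ⟨0, fun f _ => ⟨Lp.mem_Lp_iff_eLpNorm_lt_top.2 (by simp), by simp⟩⟩,
      fun f _ _ => rfl, fun _ f _ _ => rfl⟩
  have : Nonempty X := by
    by_contra hne
    rw [not_nonempty_iff] at hne
    exact hμ0 (by rw [Set.univ_eq_empty_iff.2 hne, measure_empty])
  have := hX.secondCountableTopology
  obtain ⟨γ, β, h⟩ :=
    NonHom.exists_admissible hX hlam (max 5 (max (5 * η) (5 * ρ))) (le_max_left _ _)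
  have hηα : 5 * η ≤ max 5 (max (5 * η) (5 * ρ)) := (le_max_left _ _).trans (le_max_right _ _)
  have hρα : 5 * ρ ≤ max 5 (max (5 * η) (5 * ρ)) := (le_max_right _ _).trans (le_max_right _ _)
  rcases eq_or_ne (μ Set.univ) ∞ with hμ | hμ
  · obtain ⟨C, hC⟩ := h.exists_lintegral_rpow_le_of_infinite hηα hρ.le hρα hq hT hT_infty hT_one
      hμ hp1
    have hD := h.denseRange_lpH1 (q := q) hρ.le hq hμ hp hp_ne
    obtain ⟨S, hS, hSp, hST⟩ := NonHom.exists_sublinear_extension (T := T) _ hD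
      (fun f g => hT.1 _ (NonHom.MemH1.mem_linftyAddH1 f.2) _ (NonHom.MemH1.mem_linftyAddH1 g.2))
      (fun c f => hT.2 c _ (NonHom.MemH1.mem_linftyAddH1 f.2))
      (fun f => NonHom.eLpNorm_le_of_lintegral_rpow_le hp0 hp_ne
        (hC _ f.2 (NonHom.lintegral_rpow_ne_top_of_mem_Lp hp0 hp_ne (f : Lp ℂ p μ).2)))
    exact ⟨S, hS, hSp, fun f hf hfH => hST ⟨⟨f, hf⟩, hfH⟩, fun hlt => absurd hμ hlt.ne⟩
  · obtain ⟨C, hC⟩ := h.exists_lintegral_rpow_le_of_finite hlam hηα hρ.le hρα hq hT hT_infty hT_one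
      hμ hμ0 hp1
    have hC' := fun f (hf : f ∈ Lp ℂ p μ) =>
      hC f (NonHom.lintegral_rpow_ne_top_of_mem_Lp hp0 hp_ne hf)
    refine ⟨T, ⟨fun f hf g hg => hT.1 f (hC' f hf).1 g (hC' g hg).1,
      fun c f hf => hT.2 c f (hC' f hf).1⟩, ⟨C ^ (1 / p.toReal), fun f hf => ?_⟩,
      fun f _ _ => rfl, fun _ f _ _ => rfl⟩
    have hle := NonHom.eLpNorm_le_of_lintegral_rpow_le hp0 hp_ne (hC' f hf).2
    exact ⟨Lp.mem_Lp_iff_eLpNorm_lt_top.2 (hle.trans_lt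
      (ENNReal.mul_lt_top (by simp) (Lp.mem_Lp_iff_eLpNorm_lt_top.1 hf))), hle⟩
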